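/- The semirandom (star) graph process on a vertex set of size $n$ starts with the empty graph. In each round a player, Builder, is offered a vertex $v$ chosen uniformly at random, independently of all previous rounds, and, knowing the offers and choices so far, either adds to the graph an edge incident with $v$ or adds no edge. Theorem. There is a function $f:\mathbb{N}\to[0,\infty)$ with $f(\Delta)\to 0$ as $\Delta\to\infty$ such that the following holds for every sequence $(H_n)_{n\ge 1}$ of graphs, where $H_n$ has $n$ vertices and maximum degree $\Delta=\Delta(n)$. For each $n$, Builder has a strategy in the semirandom graph process on $n$ vertices such that, with probability tending to $1$ as $n\to\infty$, the graph constructed after $$\Big\lfloor (1+f(\Delta))\,\frac{\Delta n}{2}\Big\rfloor$$ rounds contains a copy of $H_n$, that is, a (not necessarily induced) subgraph isomorphic to $H_n$. Moreover, with the same strategy and the same $f$, with probability tending to $1$ as $n\to\infty$ the graph constructed after $N$ rounds contains a copy of $H_n$, where $N$ is a Poisson random variable with mean $(1+f(\Delta))\frac{\Delta n}{2}$, independent of the offers. This is asymptotically optimal in $\Delta$: for all integers $n\ge 1$ and $0\le\Delta<n$ with $\Delta n$ even, there is an $n$-vertex graph $H$ of maximum degree $\Delta$ such that, for every strategy of Builder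 and every sequence of offers, Builder's graph cannot contain a copy of $H$ after fewer than $\frac{\Delta n}{2}$ rounds. -/

import Mathlib

open Filter Topology MeasureTheory ProbabilityTheory
open scoped NNReal ENNReal

/-- A (deterministic) strategy for Builder in the semirandom (star) graph process on vertex set `V`.
In round `t + 1`, knowing the vertices `past 0, …, past (t - 1)` offered in the previous `t` rounds
(hence also Builder's own earlier choices), and being offered the vertex `v`, Builder either chooses
a vertex `w ≠ v`, that is, claims the edge `vw`, or claims no edge (`none`). -/
def BuilderStrategy (V : Type*) : Type _ :=
  (t : ℕ) → (past : Fin t → V) → (v : V) → Option {w : V // w ≠ v}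

/-- Builder's graph after `t` rounds, when Builder plays `σ` and the vertices offered are
`v 0, v 1, v 2, …`. It starts empty, and each round adds the edge claimed in it, if any. -/
def BuilderStrategy.graphAfter {V : Type*} (σ : BuilderStrategy V) (v : ℕ → V) :
    ℕ → SimpleGraph V
  | 0 => ⊥
  | t + 1 =>
    match σ t (fun i : Fin t => v i) (v t) with
    | none => σ.graphAfter v t
    | some w => σ.graphAfter v t ⊔ SimpleGraph.edge (v t) w

/-- The law of the sequence of offered vertices: independent and uniform on the `n` vertices. -/
noncomputable def offerLaw (n : ℕ) [NeZero n] : Measure (ℕ → Fin n) :=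
  Measure.infinitePi fun _ : ℕ => (PMF.uniformOfFintype (Fin n)).toMeasure

/-- The probability that, when Builder plays `σ`, Builder's graph after exactly `t` rounds contains
a copy of `H` (as a not necessarily induced subgraph). -/
noncomputable def successProb {n : ℕ} [NeZero n] (H : SimpleGraph (Fin n))
    (σ : BuilderStrategy (Fin n)) (t : ℕ) : ℝ≥0∞ :=
  offerLaw n {v | H.IsContained (σ.graphAfter v t)}

/-- The probability that, when Builder plays `σ`, Builder's graph after `N` rounds contains a copy
of `H`, where `N` is Poisson with mean `μ` and independent of the offered vertices. -/
noncomputable def poissonSuccessProb {n : ℕ} [NeZero n] (H : SimpleGraph (Fin n))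
    (σ : BuilderStrategy (Fin n)) (μ : ℝ≥0) : ℝ≥0∞ :=
  ((poissonMeasure μ).prod (offerLaw n)) {x | H.IsContained (σ.graphAfter x.2 x.1)}

/-! Optimal play is a backward recursion, `optFail`, realised by a strategy in `exists_strategy`. To
bound it, any plan will do in which, during a window of rounds, each vertex answers its offers from
a fixed list (`optFail_add_le`). Only the numbers of offers in the window are then random, and all
vertices of a set `A` are offered too rarely with probability at most `q ^ A.card`, as if they were
independent (`offerProb_lacking_le`).

By Hall's theorem the edges of `H` can be distributed so that each vertex is responsible for at most
`Δ / 2` of them, rounded up. After `(1 + ε/2) Δ n / 2` rounds most vertices have been offered that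
often; the others form the uncovered set `B`, and the identity embeds all edges avoiding `B`. An
uncovered `h` is repaired by exchanging its place with that of a covered vertex `i`: this only needs
edges from the neighbours of `h` to the place of `i` and from the neighbours of `i` to the place of
`h` (`EmbedsOff.swap`). Repairs at pairwise distance more than two do not interfere
(`EmbedsOff.exists_sdiff`).

Let `g` be about `Δ^(1/12)`. While many vertices are uncovered, each member of a maximal
conflict-free set gets `2 * g ^ 8` candidates for `i` and two windows of `16 * g ^ 8 * n` rounds
(`optFail_repair_le`). Repeating this `g ^ 3` times costs order `g ^ 11 * n`, which is `o(Δ n)`, and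
leaves at most about `exp (-g ^ 14) * n` uncovered vertices, up to a polynomial factor in `Δ`.

With `b` vertices uncovered, the number of candidates per vertex can be of order `n / b` up to
factors depending on `Δ`. In `2 * Δ` windows of `n * (b / n) ^ (1 / (8 * Δ))` rounds, each candidate
requests one needed edge per window, and survives if all are granted (`optFail_sift_repair_le`). The
chance of survival is at least `(b / n) ^ (1 / 4) / 16 ^ Δ`, so enough candidates survive to repair
half of a conflict-free set. The window lengths decay geometrically as `b` shrinks, and their sum is
`o(Δ n)` because `b / n` is tiny from the outset.

This gives failure probability at most `1 / n` for each fixed `ε` and large `Δ`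
(`eventually_optFail_le`); a diagonal choice lets `ε` tend to zero, and small `Δ` is absorbed by
large values of `f`. An extra `Δ^(-1/2)` in `f` covers the Poisson fluctuation. For optimality, a
`Δ`-regular graph has `Δ n / 2` edges and a round adds at most one. -/

/-! ### Optimal play and windows of rounds with a fixed plan -/

section OptimalPlay

variable {V : Type*}

/-- The edges claimed when each vertex `v` has been offered `c v` times, and answered its offers
with `todo v 0, todo v 1, …`. -/
def claimed (todo : V → ℕ → V) (c : V → ℕ) : SimpleGraph V :=
  SimpleGraph.fromRel fun a b => ∃ k < c a, todo a k = b

theorem claimed_adj {todo : V → ℕ → V} {c : V → ℕ} {a b : V} :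
    (claimed todo c).Adj a b ↔
      a ≠ b ∧ ((∃ k < c a, todo a k = b) ∨ ∃ k < c b, todo b k = a) :=
  SimpleGraph.fromRel_adj _ _ _

variable [Fintype V]

/-- The expectation of `F c`, where `c v` is the number of times `v` is offered in `m` rounds. -/
noncomputable def offerMean [DecidableEq V] : ℕ → ((V → ℕ) → ℝ) → ℝ
  | 0, F => F 0
  | m + 1, F => (∑ v, offerMean m (fun c => F (c + Pi.single v 1))) / Fintype.card V

/-- The least probability, over all ways of playing the next `m` rounds starting from the graph `G`,
that the final graph does not satisfy `P`. -/
noncomputable def optFail (P : SimpleGraph V → Prop) : ℕ → SimpleGraph V → ℝ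
  | 0, G => open Classical in if P G then 0 else 1
  | m + 1, G => (∑ v, ⨅ w, optFail P m (G ⊔ SimpleGraph.edge v w)) / Fintype.card V

section offerMean
variable [DecidableEq V]

theorem offerMean_mono {F F' : (V → ℕ) → ℝ} (h : ∀ c, F c ≤ F' c) (m : ℕ) :
    offerMean m F ≤ offerMean m F' := by
  induction m generalizing F F' with
  | zero => exact h 0
  | succ m ih =>
    simp only [offerMean]
    gcongr with v
    exact ih fun c => h _

theorem offerMean_add (F F' : (V → ℕ) → ℝ) (m : ℕ) :
    offerMean m (fun c => F c + F' c) = offerMean m F + offerMean m F' := by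
  induction m generalizing F F' with
  | zero => rfl
  | succ m ih =>
    simp only [offerMean, ih]
    rw [Finset.sum_add_distrib, add_div]

theorem offerMean_const_mul (a : ℝ) (F : (V → ℕ) → ℝ) (m : ℕ) :
    offerMean m (fun c => a * F c) = a * offerMean m F := by
  induction m generalizing F with
  | zero => rfl
  | succ m ih =>
    simp only [offerMean, ih]
    rw [← Finset.mul_sum, mul_div_assoc]

theorem offerMean_const [Nonempty V] (a : ℝ) (m : ℕ) :
    offerMean m (fun _ : V → ℕ => a) = a := by
  induction m with
  | zero => rfl
  | succ m ih =>
    simp only [offerMean, ih, Finset.sum_const, Finset.card_univ, nsmul_eq_mul]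
    field_simp

theorem offerMean_sum {ι : Type*} (s : Finset ι) (F : ι → (V → ℕ) → ℝ) (m : ℕ) :
    offerMean m (fun c => ∑ i ∈ s, F i c) = ∑ i ∈ s, offerMean m (F i) := by
  classical
  induction s using Finset.induction_on with
  | empty =>
    have := offerMean_const_mul (V := V) 0 (fun _ => 0) m
    simpa using this
  | insert i s hi ih =>
    simp only [Finset.sum_insert hi, offerMean_add, ih]

/-- The probability that the numbers of offers in `m` rounds satisfy `p`. -/
noncomputable def offerProb (m : ℕ) (p : (V → ℕ) → Prop) : ℝ :=
  open Classical in offerMean m fun c => if p c then 1 else 0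

theorem offerProb_mono {p p' : (V → ℕ) → Prop} (h : ∀ c, p c → p' c) (m : ℕ) :
    offerProb m p ≤ offerProb m p' := by
  refine offerMean_mono (fun c => ?_) m
  by_cases hp : p c
  · simp [hp, h c hp]
  · simp only [hp, if_false]
    split_ifs <;> norm_num

theorem offerProb_exists_le {ι : Type*} (s : Finset ι) (p : ι → (V → ℕ) → Prop) (m : ℕ) :
    offerProb m (fun c => ∃ i ∈ s, p i c) ≤ ∑ i ∈ s, offerProb m (p i) := by
  classical
  unfold offerProb
  rw [← offerMean_sum]
  refine offerMean_mono (fun c => ?_) m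
  split_ifs with h
  · obtain ⟨i, hi, hp⟩ := h
    calc (1 : ℝ) = if p i c then 1 else 0 := by simp [hp]
      _ ≤ _ := Finset.single_le_sum (f := fun i => if p i c then (1 : ℝ) else 0)
        (fun j _ => by split_ifs <;> norm_num) hi
  · exact Finset.sum_nonneg fun j _ => by split_ifs <;> norm_num

theorem offerProb_or_le (p p' : (V → ℕ) → Prop) (m : ℕ) :
    offerProb m (fun c => p c ∨ p' c) ≤ offerProb m p + offerProb m p' := by
  classical
  unfold offerProb
  rw [← offerMean_add]
  refine offerMean_mono (fun c => ?_) m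
  by_cases h : p c <;> by_cases h' : p' c <;> simp [h, h']

end offerMean

theorem optFail_nonneg (P : SimpleGraph V → Prop) (m : ℕ) (G : SimpleGraph V) :
    0 ≤ optFail P m G := by
  induction m generalizing G with
  | zero => simp only [optFail]; split_ifs <;> norm_num
  | succ m ih =>
    simp only [optFail]
    exact div_nonneg (Finset.sum_nonneg fun v _ => Real.iInf_nonneg fun w => ih _)
      (Nat.cast_nonneg _)

theorem optFail_le_one [Nonempty V] (P : SimpleGraph V → Prop) (m : ℕ) (G : SimpleGraph V) :
    optFail P m G ≤ 1 := by
  induction m generalizing G with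
  | zero => simp only [optFail]; split_ifs <;> norm_num
  | succ m ih =>
    simp only [optFail]
    rw [div_le_one (by positivity)]
    calc _ ≤ ∑ v : V, (1 : ℝ) := Finset.sum_le_sum fun v _ =>
          (ciInf_le (Set.finite_range _).bddBelow v).trans (ih _)
      _ = _ := by simp

theorem optFail_anti_graph {P : SimpleGraph V → Prop} (hP : Monotone P) (m : ℕ) :
    Antitone (optFail P m) := by
  induction m with
  | zero =>
    intro G G' h
    simp only [optFail]
    by_cases h1 : P G
    · have : P G' := hP h h1
      simp [h1, this]
    · simp only [h1, if_false]
      split_ifs <;> norm_num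
  | succ m ih =>
    intro G G' h
    simp only [optFail]
    gcongr with v _ w
    · exact (Set.finite_range fun w => optFail P m (G' ⊔ SimpleGraph.edge v w)).bddBelow
    · exact ih (sup_le_sup_right h _)

theorem optFail_succ_le [Nonempty V] {P : SimpleGraph V → Prop} (m : ℕ) (G : SimpleGraph V) :
    optFail P (m + 1) G ≤ optFail P m G := by
  simp only [optFail]
  rw [div_le_iff₀ (by positivity)]
  calc _ ≤ ∑ v : V, optFail P m G := Finset.sum_le_sum fun v _ => by
        -- The choice `w = v` adds no edge, so the infimum in `optFail` includes passing.
        refine (ciInf_le (Set.finite_range _).bddBelow v).trans_eq ?_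
        simp
    _ = _ := by simp [mul_comm]

theorem optFail_anti_rounds [Nonempty V] (P : SimpleGraph V → Prop) (G : SimpleGraph V) :
    Antitone fun m => optFail P m G :=
  antitone_nat_of_succ_le fun m => optFail_succ_le m G

theorem optFail_eq_zero [Nonempty V] {P : SimpleGraph V → Prop} {G : SimpleGraph V} (h : P G)
    (m : ℕ) : optFail P m G = 0 := by
  refine le_antisymm ?_ (optFail_nonneg _ _ _)
  refine (optFail_anti_rounds P G (Nat.zero_le m)).trans ?_
  simp [optFail, h]

/-- Answering offers from `todo` is one admissible way to play, and the graph it produces depends on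
the offers only through their counts, not their order. -/
theorem optFail_add_le_offerMean [DecidableEq V] {P : SimpleGraph V → Prop} (hP : Monotone P)
    (m m' : ℕ) (todo : V → ℕ → V) (G : SimpleGraph V) :
    optFail P (m + m') G ≤ offerMean m fun c => optFail P m' (G ⊔ claimed todo c) := by
  induction m generalizing G todo with
  | zero =>
    simp only [offerMean, zero_add]
    exact optFail_anti_graph hP _ (by
      refine sup_le le_rfl ?_
      intro a b hab
      simp [claimed_adj] at hab)
  | succ m ih =>
    rw [show m + 1 + m' = (m + m') + 1 by ring]
    simp only [optFail, offerMean]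
    gcongr with v
    refine (ciInf_le (Set.finite_range _).bddBelow (todo v 0)).trans ?_
    -- The first entry of the list of `v` is used up, so the remaining rounds follow that list
    -- shifted by one.
    refine (ih (fun u => if u = v then fun k => todo v (k + 1) else todo u) _).trans ?_
    refine offerMean_mono (fun c => optFail_anti_graph hP _ ?_) m
    rw [sup_assoc]
    refine sup_le_sup_left ?_ G
    intro a b hab
    rw [SimpleGraph.sup_adj, claimed_adj, SimpleGraph.edge_adj]
    rw [claimed_adj] at hab
    obtain ⟨hne, hab⟩ := hab
    have key : ∀ x y : V, x ≠ y → (∃ k < (c + Pi.single v 1 : V → ℕ) x, todo x k = y) →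
        (v = x ∧ todo v 0 = y) ∨
        ∃ k < c x, (if x = v then fun k => todo v (k + 1) else todo x) k = y := by
      rintro x y - ⟨k, hk, rfl⟩
      by_cases hx : x = v
      · subst hx
        cases k with
        | zero => exact Or.inl ⟨rfl, rfl⟩
        | succ k => exact Or.inr ⟨k, by simpa using hk, by simp⟩
      · refine Or.inr ⟨k, ?_, by simp [hx]⟩
        simpa [Pi.single_apply, hx] using hk
    rcases hab with h | h
    · rcases key a b hne h with ⟨h1, h2⟩ | h
      · exact Or.inl ⟨by subst h1 h2; simp, hne⟩
      · exact Or.inr ⟨hne, Or.inl h⟩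
    · rcases key b a hne.symm h with ⟨h1, h2⟩ | h
      · exact Or.inl ⟨by subst h1 h2; simp, hne⟩
      · exact Or.inr ⟨hne, Or.inr h⟩

/-- One window of `m` rounds: if the graph is good for the next `m'` rounds whenever the numbers of
offers avoid the bad event `bad`, then the failure probability grows by that of `bad` only. -/
theorem optFail_add_le [DecidableEq V] [Nonempty V] {P : SimpleGraph V → Prop} (hP : Monotone P)
    {m m' : ℕ} (todo : V → ℕ → V) {G : SimpleGraph V} {bad : (V → ℕ) → Prop} {η : ℝ} (hη : 0 ≤ η)
    (h : ∀ c, ¬ bad c → optFail P m' (G ⊔ claimed todo c) ≤ η) :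
    optFail P (m + m') G ≤ offerProb m bad + η := by
  classical
  refine (optFail_add_le_offerMean hP m m' todo G).trans ?_
  rw [← offerMean_const (V := V) η m]
  unfold offerProb
  rw [← offerMean_add]
  refine offerMean_mono (fun c => ?_) m
  by_cases hc : bad c
  · simp only [hc, if_true]
    linarith [optFail_le_one P m' (G ⊔ claimed todo c)]
  · simp only [hc, if_false, zero_add]
    exact h c hc

end OptimalPlay

/-! ### From an optimal rule to a strategy -/

section Strategy

variable {V : Type*}

theorem BuilderStrategy.graphAfter_mono (σ : BuilderStrategy V) (v : ℕ → V) :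
    Monotone (σ.graphAfter v) := by
  refine monotone_nat_of_le_succ fun t => ?_
  simp only [BuilderStrategy.graphAfter]
  split
  · exact le_rfl
  · exact le_sup_left

/-- The graph after `t` rounds, when `m` rounds are to be played and the vertex `π r G v` is chosen
as the other endpoint on the offer of `v` at a time when the graph is `G` and `r` further rounds
remain. -/
def playGraph (π : ℕ → SimpleGraph V → V → V) (m : ℕ) : (t : ℕ) → (Fin t → V) → SimpleGraph V
  | 0, _ => ⊥
  | t + 1, x => playGraph π m t (Fin.init x) ⊔ SimpleGraph.edge (x (Fin.last t))
      (π (m - (t + 1)) (playGraph π m t (Fin.init x)) (x (Fin.last t)))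

/-- The strategy that follows the rule `π` as in `playGraph`. -/
noncomputable def policyStrategy (π : ℕ → SimpleGraph V → V → V) (m : ℕ) : BuilderStrategy V :=
  open Classical in fun t past v =>
    if h : π (m - (t + 1)) (playGraph π m t past) v ≠ v then
      some ⟨π (m - (t + 1)) (playGraph π m t past) v, h⟩ else none

theorem graphAfter_policyStrategy (π : ℕ → SimpleGraph V → V → V) (m : ℕ) (v : ℕ → V) (t : ℕ) :
    (policyStrategy π m).graphAfter v t = playGraph π m t fun i => v i := by
  induction t with
  | zero => rfl
  | succ t ih =>
    have hinit : (Fin.init fun i : Fin (t + 1) => v i) = fun i : Fin t => v i := rfl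
    simp only [BuilderStrategy.graphAfter, playGraph, hinit, Fin.val_last]
    rw [ih]
    split
    · next h =>
      simp only [policyStrategy] at h
      split_ifs at h with h'
      rw [not_not.mp h']
      simp
    · next w h =>
      simp only [policyStrategy] at h
      split_ifs at h with h'
      have := (Option.some.inj h).symm
      subst this
      rfl

variable [Fintype V]

/-- Under an optimal rule `π` the average of `optFail` over all offer histories is the same in every
round. -/
theorem sum_optFail_playGraph [Nonempty V] {P : SimpleGraph V → Prop}
    {π : ℕ → SimpleGraph V → V → V}
    (hπ : ∀ r G v, optFail P r (G ⊔ SimpleGraph.edge v (π r G v)) =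
      ⨅ w, optFail P r (G ⊔ SimpleGraph.edge v w)) (m t : ℕ) (ht : t ≤ m) :
    ∑ x : Fin t → V, optFail P (m - t) (playGraph π m t x) =
      (Fintype.card V : ℝ) ^ t * optFail P m ⊥ := by
  induction t with
  | zero => simp [playGraph]
  | succ t ih =>
    rw [← (Fin.snocEquiv fun _ : Fin (t + 1) => V).sum_comp, Fintype.sum_prod_type,
      Finset.sum_comm, pow_succ, mul_right_comm, ← ih (by omega), Finset.sum_mul]
    refine Finset.sum_congr rfl fun x _ => ?_
    have hm : m - t = (m - (t + 1)) + 1 := by omega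
    rw [hm]
    simp only [optFail]
    rw [div_mul_cancel₀ _ (by positivity)]
    refine Finset.sum_congr rfl fun v _ => ?_
    rw [← hπ]
    simp [playGraph, Fin.snocEquiv]

end Strategy

/-! ### Probabilities under the law of the offers and the Poisson law -/

section Measure

theorem offerLaw_prefix {n : ℕ} [NeZero n] {m : ℕ} (x : Fin m → Fin n) :
    offerLaw n {v | (fun i : Fin m => v i) = x} = ((n : ℝ≥0∞)⁻¹) ^ m := by
  let y : ℕ → Fin n := fun i => if h : i < m then x ⟨i, h⟩ else 0
  have : {v : ℕ → Fin n | (fun i : Fin m => v i) = x} =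
      Set.pi (Finset.range m : Set ℕ) fun i => {y i} := by
    ext v
    simp only [Set.mem_ofPred_eq, Set.mem_pi, Finset.coe_range, Set.mem_Iio,
      Set.mem_singleton_iff, y]
    constructor
    · intro h i hi
      simp [hi, ← h]
    · intro h
      ext i : 1
      rw [h i i.2]
      simp
  rw [this, offerLaw, Measure.infinitePi_pi _ fun i _ => measurableSet_singleton _]
  simp

theorem measurableSet_prefix {n : ℕ} {m : ℕ} (x : Fin m → Fin n) :
    MeasurableSet {v : ℕ → Fin n | (fun i : Fin m => v i) = x} := by
  have : Measurable fun v : ℕ → Fin n => (fun i : Fin m => v i) := by fun_prop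
  exact this (measurableSet_singleton x)

/-- Optimal play for `m` rounds is realised by a strategy. -/
theorem exists_strategy {n : ℕ} [NeZero n] {P : SimpleGraph (Fin n) → Prop} (hP : Monotone P)
    (m : ℕ) : ∃ σ : BuilderStrategy (Fin n), ∀ t, m ≤ t →
      ENNReal.ofReal (1 - optFail P m ⊥) ≤ offerLaw n {v | P (σ.graphAfter v t)} := by
  classical
  have hπ : ∀ r G v, ∃ u, optFail P r (G ⊔ SimpleGraph.edge v u) =
      ⨅ w : Fin n, optFail P r (G ⊔ SimpleGraph.edge v w) := fun r G v =>
    exists_eq_ciInf_of_finite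
  choose π hπ using hπ
  refine ⟨policyStrategy π m, fun t ht => ?_⟩
  have hsub : {v | P ((policyStrategy π m).graphAfter v m)} ⊆
      {v | P ((policyStrategy π m).graphAfter v t)} := fun v hv =>
    hP ((policyStrategy π m).graphAfter_mono v ht) hv
  refine le_trans ?_ (measure_mono hsub)
  simp only [graphAfter_policyStrategy]
  set A : Finset (Fin m → Fin n) := {x | P (playGraph π m m x)} with hA
  have hset : {v : ℕ → Fin n | P (playGraph π m m fun i => v i)} =
      ⋃ x ∈ A, {v : ℕ → Fin n | (fun i : Fin m => v i) = x} := by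
    ext v
    simp [hA]
  rw [hset, measure_biUnion_finset
    (fun x _ y _ hxy => Set.disjoint_left.mpr fun v hx hy => hxy (hx.symm.trans hy))
    (fun x _ => measurableSet_prefix x)]
  simp only [offerLaw_prefix, Finset.sum_const, nsmul_eq_mul]
  -- With no rounds left the conserved sum counts the failing prefixes, and all prefixes are equally
  -- likely.
  have hsum := sum_optFail_playGraph hπ m m le_rfl
  have hn : (0 : ℝ) < n := by exact_mod_cast Nat.pos_of_ne_zero (NeZero.ne n)
  have hcard : (A.card : ℝ) = (n : ℝ) ^ m * (1 - optFail P m ⊥) := by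
    have h1 : ∀ x : Fin m → Fin n, optFail P (m - m) (playGraph π m m x) =
        1 - if x ∈ A then (1 : ℝ) else 0 := by
      intro x
      simp only [Nat.sub_self, optFail, hA, Finset.mem_filter, Finset.mem_univ, true_and]
      split_ifs <;> norm_num
    simp only [h1, Finset.sum_sub_distrib, Finset.sum_ite_mem, Fintype.card_fin] at hsum
    simp at hsum
    linarith
  have : 1 - optFail P m ⊥ = A.card * ((n : ℝ)⁻¹) ^ m := by
    rw [hcard, mul_right_comm, ← mul_pow, mul_inv_cancel₀ hn.ne', one_pow, one_mul]
  rw [this, ENNReal.ofReal_mul (Nat.cast_nonneg _), ENNReal.ofReal_pow (inv_nonneg.mpr hn.le),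
    ENNReal.ofReal_inv_of_pos hn, ENNReal.ofReal_natCast, ENNReal.ofReal_natCast]

/-- The lower tail of the Poisson distribution. -/
theorem poissonMeasure_Iio_le (μ : ℝ≥0) (m : ℕ) {z : ℝ} (hz : 0 < z) (hz1 : z ≤ 1) :
    poissonMeasure μ (Set.Iio m) ≤ ENNReal.ofReal (z⁻¹ ^ m * Real.exp (-(μ * (1 - z)))) := by
  have hexp : HasSum (fun j : ℕ => Real.exp (-μ) * (μ : ℝ) ^ j / j.factorial * z ^ j)
      (Real.exp (-(μ * (1 - z)))) := by
    have h := (NormedSpace.expSeries_div_hasSum_exp (μ * z : ℝ)).mul_left (Real.exp (-μ))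
    rw [← Real.exp_eq_exp_ℝ, ← Real.exp_add] at h
    have he : -(μ * (1 - z)) = -(μ : ℝ) + μ * z := by ring
    rw [he]
    refine h.congr_fun fun j => ?_
    rw [mul_pow]
    ring
  have hS : Set.Iio m = ((Finset.range m : Finset ℕ) : Set ℕ) := by ext; simp
  rw [hS, ← sum_measure_singleton]
  simp only [poissonMeasure_singleton]
  rw [← ENNReal.ofReal_sum_of_nonneg fun j _ => by positivity]
  refine ENNReal.ofReal_le_ofReal ?_
  calc ∑ j ∈ Finset.range m, Real.exp (-μ) * (μ : ℝ) ^ j / j.factorial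
      ≤ ∑ j ∈ Finset.range m, z⁻¹ ^ m * (Real.exp (-μ) * (μ : ℝ) ^ j / j.factorial * z ^ j) := by
        refine Finset.sum_le_sum fun j hj => ?_
        have hj : j ≤ m := (Finset.mem_range.mp hj).le
        have : (1 : ℝ) ≤ z⁻¹ ^ m * z ^ j := by
          rw [← Nat.sub_add_cancel hj, pow_add, mul_assoc, ← mul_pow, inv_mul_cancel₀ hz.ne',
            one_pow, mul_one]
          exact one_le_pow₀ ((one_le_inv₀ hz).mpr hz1)
        have h0 : (0 : ℝ) ≤ Real.exp (-μ) * (μ : ℝ) ^ j / j.factorial := by positivity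
        nlinarith
    _ = z⁻¹ ^ m * ∑ j ∈ Finset.range m, (Real.exp (-μ) * (μ : ℝ) ^ j / j.factorial * z ^ j) := by
        rw [Finset.mul_sum]
    _ ≤ _ := by
        gcongr
        exact sum_le_hasSum _ (fun j _ => by positivity) hexp

/-- Containment persists as rounds are added, so it suffices that the Poisson number is at least `m`
and, independently, that round `m` is a success. -/
theorem poissonSuccessProb_ge {n : ℕ} [NeZero n] {H : SimpleGraph (Fin n)}
    {σ : BuilderStrategy (Fin n)} {m : ℕ} (μ : ℝ≥0) {p : ℝ≥0∞}
    (h : p ≤ successProb H σ m) :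
    poissonMeasure μ (Set.Ici m) * p ≤ poissonSuccessProb H σ μ := by
  have : IsProbabilityMeasure (offerLaw n) := by unfold offerLaw; infer_instance
  calc _ ≤ poissonMeasure μ (Set.Ici m) * successProb H σ m := by gcongr
    _ = ((poissonMeasure μ).prod (offerLaw n))
        (Set.Ici m ×ˢ {v | H.IsContained (σ.graphAfter v m)}) := by
        rw [Measure.prod_prod]; rfl
    _ ≤ _ := by
        refine measure_mono ?_
        rintro ⟨t, v⟩ ⟨ht, hv⟩
        exact SimpleGraph.IsContained.trans hv
          (SimpleGraph.IsContained.of_le (σ.graphAfter_mono v ht))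

end Measure

/-! ### Tail bounds for the numbers of offers -/

section OfferBounds

variable {V : Type*} [Fintype V] [DecidableEq V]

/-- Every round multiplies the mean by the same factor `w = 1 - A.card * (1 - z) / n`, so it equals
`w ^ m`. The resulting bound has the product form of independent Poisson counts with mean `m / n`.
-/
theorem offerMean_prod_pow_le [Nonempty V] (m : ℕ) (A : Finset V) {z : ℝ} (hz : 0 ≤ z) :
    offerMean m (fun c => ∏ v ∈ A, z ^ c v) ≤
      Real.exp (-(m / Fintype.card V * (1 - z))) ^ A.card := by
  have hn : (0 : ℝ) < Fintype.card V := by exact_mod_cast Fintype.card_pos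
  set w : ℝ := (∑ v : V, if v ∈ A then z else 1) / Fintype.card V with hw
  have hw0 : 0 ≤ w := div_nonneg (Finset.sum_nonneg fun v _ => by split_ifs <;> linarith) hn.le
  have hval : offerMean m (fun c => ∏ v ∈ A, z ^ c v) = w ^ m := by
    induction m with
    | zero => simp [offerMean]
    | succ m ih =>
      have hstep : ∀ (v : V) (c : V → ℕ), ∏ u ∈ A, z ^ (c + Pi.single v 1 : V → ℕ) u =
          (if v ∈ A then z else 1) * ∏ u ∈ A, z ^ c u := by
        intro v c
        simp only [Pi.add_apply, pow_add, Finset.prod_mul_distrib]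
        rw [mul_comm]
        congr 1
        simp only [Pi.single_apply, pow_ite, pow_one, pow_zero, Finset.prod_ite_eq']
      simp only [offerMean, hstep, offerMean_const_mul, ih]
      rw [← Finset.sum_mul, mul_div_right_comm, pow_succ, mul_comm]
  have hw1 : w = 1 - A.card * (1 - z) / Fintype.card V := by
    have h1 : ∀ v : V, (if v ∈ A then z else 1) = 1 - if v ∈ A then (1 - z) else 0 := by
      intro v; split_ifs <;> ring
    rw [hw]
    simp only [h1, Finset.sum_sub_distrib, Finset.sum_ite_mem, Finset.univ_inter,
      Finset.sum_const, nsmul_eq_mul, Finset.card_univ]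
    field_simp
  rw [hval]
  calc w ^ m ≤ Real.exp (-(A.card * (1 - z) / Fintype.card V)) ^ m := by
        refine pow_le_pow_left₀ hw0 ?_ m
        rw [hw1]
        linarith [Real.add_one_le_exp (-(A.card * (1 - z) / (Fintype.card V : ℝ)))]
    _ = _ := by
        rw [← Real.exp_nat_mul, ← Real.exp_nat_mul]
        congr 1
        ring

theorem offerProb_unoffered_le [Nonempty V] (m : ℕ) (A : Finset V) :
    offerProb m (fun c => ∀ v ∈ A, c v = 0) ≤
      Real.exp (-(m / Fintype.card V : ℝ)) ^ A.card := by
  have h := offerMean_prod_pow_le m A (le_refl (0 : ℝ))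
  rw [sub_zero, mul_one] at h
  refine le_trans (offerMean_mono (fun c => ?_) m) h
  split_ifs with hc
  · exact (Finset.prod_eq_one fun v hv => by simp [hc v hv]).ge
  · exact Finset.prod_nonneg fun v _ => by positivity

/-- Chernoff's method: on the event, every factor `z⁻¹ ^ b * z ^ c v` is at least 1. -/
theorem offerProb_lacking_le [Nonempty V] (m : ℕ) (A : Finset V) (b : ℕ) {z : ℝ} (hz : 0 < z)
    (hz1 : z ≤ 1) :
    offerProb m (fun c => ∀ v ∈ A, c v < b + 1) ≤
      (z⁻¹ ^ b * Real.exp (-(m / Fintype.card V * (1 - z)))) ^ A.card := by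
  rw [mul_pow]
  have h := offerMean_prod_pow_le m A hz.le
  refine le_trans ?_ (mul_le_mul_of_nonneg_left h (by positivity))
  rw [← offerMean_const_mul]
  refine offerMean_mono (fun c => ?_) m
  split_ifs with hc
  · rw [← Finset.prod_const, ← Finset.prod_mul_distrib]
    rw [← Finset.prod_const_one (s := A)]
    refine Finset.prod_le_prod (fun _ _ => zero_le_one) fun v hv => ?_
    have hle : c v ≤ b := Nat.lt_succ_iff.mp (hc v hv)
    rw [← Nat.sub_add_cancel hle, pow_add, mul_assoc, ← mul_pow, inv_mul_cancel₀ hz.ne', one_pow,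
      mul_one]
    exact one_le_pow₀ ((one_le_inv₀ hz).mpr hz1)
  · positivity

/-- If every set of vertices is lacking (offered less than `a` times) with probability at most `q`
to the power of its size, then it is unlikely that many disjoint sets `D h` contain at least `k`
lacking vertices each. -/
theorem offerProb_many_lacking_le {m a : ℕ} {q : ℝ} (hq : 0 ≤ q)
    (hlack : ∀ A : Finset V, offerProb m (fun c => ∀ v ∈ A, c v < a) ≤ q ^ A.card)
    {ι : Type*} [DecidableEq ι] (S : Finset ι) (D : ι → Finset V) {N : ℕ}
    (hN : ∀ h ∈ S, (D h).card ≤ N) (k t : ℕ) :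
    offerProb m (fun c => ∃ T ⊆ S, T.card = t ∧ (T : Set ι).PairwiseDisjoint D ∧
        ∀ h ∈ T, k ≤ ((D h).filter (fun v => c v < a)).card) ≤
      S.card.choose t * (((N : ℝ) * q) ^ k) ^ t := by
  classical
  -- The induction needs a set `A` already known to be lacking: each new `h` adds to it `k` lacking
  -- vertices of `D h`, chosen in at most `N ^ k` ways and disjoint from the earlier ones, so that
  -- the single bound `hlack` is applied only at the end.
  have main : ∀ T : Finset ι, T ⊆ S → (T : Set ι).PairwiseDisjoint D → ∀ A : Finset V,
      (∀ h ∈ T, Disjoint A (D h)) →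
      offerProb m (fun c => (∀ v ∈ A, c v < a) ∧
        ∀ h ∈ T, k ≤ ((D h).filter (fun v => c v < a)).card) ≤
      q ^ A.card * (((N : ℝ) * q) ^ k) ^ T.card := by
    intro T
    induction T using Finset.induction_on with
    | empty =>
      intro _ _ A _
      simpa using hlack A
    | insert h T hT ih =>
      intro hTS hdisj A hA
      calc offerProb m (fun c => (∀ v ∈ A, c v < a) ∧
            ∀ h' ∈ insert h T, k ≤ ((D h').filter (fun v => c v < a)).card)
          ≤ offerProb m (fun c => ∃ A' ∈ (D h).powersetCard k, (∀ v ∈ A ∪ A', c v < a) ∧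
            ∀ h' ∈ T, k ≤ ((D h').filter (fun v => c v < a)).card) := by
            refine offerProb_mono (fun c hc => ?_) m
            obtain ⟨h1, h2⟩ := hc
            obtain ⟨A', hA'sub, hA'card⟩ :=
              Finset.exists_subset_card_eq (h2 h (Finset.mem_insert_self _ _))
            refine ⟨A', Finset.mem_powersetCard.mpr
              ⟨hA'sub.trans (Finset.filter_subset _ _), hA'card⟩, ?_,
              fun h' hh' => h2 h' (Finset.mem_insert_of_mem hh')⟩
            intro v hv
            rcases Finset.mem_union.mp hv with hv | hv
            · exact h1 v hv
            · exact (Finset.mem_filter.mp (hA'sub hv)).2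
        _ ≤ ∑ A' ∈ (D h).powersetCard k, offerProb m (fun c => (∀ v ∈ A ∪ A', c v < a) ∧
            ∀ h' ∈ T, k ≤ ((D h').filter (fun v => c v < a)).card) :=
            offerProb_exists_le _ _ m
        _ ≤ ∑ A' ∈ (D h).powersetCard k, q ^ (A.card + k) * (((N : ℝ) * q) ^ k) ^ T.card := by
            refine Finset.sum_le_sum fun A' hA' => ?_
            obtain ⟨hsub, hcard⟩ := Finset.mem_powersetCard.mp hA'
            have hd : Disjoint A A' :=
              Finset.disjoint_of_subset_right hsub (hA h (Finset.mem_insert_self _ _))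
            have := ih ((Finset.subset_insert _ _).trans hTS)
              (hdisj.subset (Finset.coe_subset.mpr (Finset.subset_insert _ _))) (A ∪ A') ?_
            · rwa [Finset.card_union_of_disjoint hd, hcard] at this
            · intro h' hh'
              refine Finset.disjoint_union_left.mpr ⟨hA h' (Finset.mem_insert_of_mem hh'), ?_⟩
              refine Finset.disjoint_of_subset_left hsub ?_
              refine hdisj (by simp) (by simp [hh']) ?_
              rintro rfl
              exact hT hh'
        _ = ((D h).card.choose k : ℝ) * (q ^ (A.card + k) * (((N : ℝ) * q) ^ k) ^ T.card) := by
            rw [Finset.sum_const, Finset.card_powersetCard, nsmul_eq_mul]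
        _ ≤ (N : ℝ) ^ k * (q ^ (A.card + k) * (((N : ℝ) * q) ^ k) ^ T.card) := by
            gcongr
            have h1 : (D h).card.choose k ≤ (D h).card ^ k := Nat.choose_le_pow _ _
            have h2 : (D h).card ^ k ≤ N ^ k :=
              Nat.pow_le_pow_left (hN h (hTS (Finset.mem_insert_self _ _))) k
            exact_mod_cast h1.trans h2
        _ = _ := by
            rw [Finset.card_insert_of_notMem hT, pow_succ, mul_pow, pow_add]
            ring
  calc _ ≤ offerProb m (fun c => ∃ T ∈ S.powersetCard t, (T : Set ι).PairwiseDisjoint D ∧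
        ∀ h ∈ T, k ≤ ((D h).filter (fun v => c v < a)).card) :=
        offerProb_mono (fun c ⟨T, hT, hc, h⟩ => ⟨T, Finset.mem_powersetCard.mpr ⟨hT, hc⟩, h⟩) m
    _ ≤ ∑ T ∈ S.powersetCard t, offerProb m (fun c => (T : Set ι).PairwiseDisjoint D ∧
        ∀ h ∈ T, k ≤ ((D h).filter (fun v => c v < a)).card) := offerProb_exists_le _ _ m
    _ ≤ ∑ T ∈ S.powersetCard t, (((N : ℝ) * q) ^ k) ^ t := by
        refine Finset.sum_le_sum fun T hT => ?_
        obtain ⟨hTS, hcard⟩ := Finset.mem_powersetCard.mp hT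
        by_cases hd : (T : Set ι).PairwiseDisjoint D
        · have := main T hTS hd ∅ (by simp)
          simpa [hd, hcard] using this
        · simp only [hd, false_and]
          have := offerProb_mono (V := V) (p := fun _ => False) (p' := fun _ => False)
            (fun _ h => h) m
          have h0 : offerProb (V := V) m (fun _ => False) = 0 := by
            have := offerMean_const_mul (V := V) 0 (fun _ => 0) m
            simpa [offerProb] using this
          rw [h0]
          positivity
    _ = _ := by rw [Finset.sum_const, Finset.card_powersetCard, nsmul_eq_mul]

/-- The generating function of the number of vertices `a i`, `i ∈ A`, which are offered. -/
theorem offerMean_pow_card_offered_le [Nonempty V] {ι : Type*} (A : Finset ι) {a : ι → V}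
    (ha : Set.InjOn a A) (m : ℕ) {z : ℝ} (hz : 0 ≤ z) (hz1 : z ≤ 1) :
    offerMean m (fun c => z ^ (A.filter fun i => c (a i) ≠ 0).card) ≤
      (1 - (1 - z) * (1 - Real.exp (-(m / Fintype.card V : ℝ)))) ^ A.card := by
  classical
  set x := Real.exp (-(m / Fintype.card V : ℝ)) with hx
  -- Each factor is `z` plus `1 - z` times the indicator of being unoffered. The expanded
  -- coefficients are nonnegative because `z ≤ 1`, so upper bounds on the probabilities that sets
  -- are unoffered suffice.
  have hpt : ∀ c : V → ℕ, z ^ (A.filter fun i => c (a i) ≠ 0).card =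
      ∑ t ∈ A.powerset, ((1 - z) ^ t.card * z ^ (A \ t).card) *
        (if ∀ v ∈ t.image a, c v = 0 then 1 else 0) := by
    intro c
    calc z ^ (A.filter fun i => c (a i) ≠ 0).card
        = ∏ i ∈ A, ((if c (a i) = 0 then (1 - z) else 0) + z) := by
          rw [Finset.card_filter, ← Finset.prod_pow_eq_pow_sum]
          refine Finset.prod_congr rfl fun i _ => ?_
          by_cases h : c (a i) = 0 <;> simp [h]
      _ = _ := by
          rw [Finset.prod_add]
          refine Finset.sum_congr rfl fun t _ => ?_
          have hconst : ∏ _i ∈ A \ t, z = z ^ (A \ t).card := Finset.prod_const z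
          rw [hconst]
          by_cases h : ∀ v ∈ t.image a, c v = 0
          · have hprod : ∏ i ∈ t, (if c (a i) = 0 then 1 - z else 0) = (1 - z) ^ t.card :=
              Finset.prod_eq_pow_card fun i hi => if_pos (h _ (Finset.mem_image_of_mem a hi))
            rw [if_pos h, mul_one, hprod]
          · rw [if_neg h, mul_zero]
            push Not at h
            obtain ⟨v, hv, hne⟩ := h
            obtain ⟨i, hi, rfl⟩ := Finset.mem_image.mp hv
            rw [Finset.prod_eq_zero (f := fun i => if c (a i) = 0 then 1 - z else 0) hi
              (if_neg hne), zero_mul]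
  simp only [hpt]
  rw [offerMean_sum]
  calc _ ≤ ∑ t ∈ A.powerset, ((1 - z) * x) ^ t.card * z ^ (A.card - t.card) := by
        refine Finset.sum_le_sum fun t ht => ?_
        have htA := Finset.mem_powerset.mp ht
        rw [offerMean_const_mul]
        have h := offerProb_unoffered_le m (t.image a)
        rw [Finset.card_image_of_injOn (ha.mono (Finset.coe_subset.mpr htA))] at h
        rw [Finset.card_sdiff_of_subset htA, mul_pow, mul_right_comm]
        have h1z : 0 ≤ 1 - z := by linarith
        refine mul_le_mul_of_nonneg_right ?_ (by positivity)
        refine mul_le_mul_of_nonneg_left ?_ (by positivity)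
        refine le_of_eq_of_le ?_ h
        unfold offerProb
        congr! 3
    _ = ((1 - z) * x + z) ^ A.card := Finset.sum_pow_mul_eq_add_pow _ _ _
    _ = _ := by congr 1; ring

end OfferBounds

/-! ### Conflicts, distribution of edges, and repair by exchanging places -/

section GraphCombinatorics

open scoped Classical in
/-- A maximal extension of an independent set inside `A`. -/
theorem SimpleGraph.exists_isIndepSet_card {V : Type*} [Fintype V] (G : SimpleGraph V) {d : ℕ}
    (hd : ∀ v, G.degree v ≤ d) {S A : Finset V} (hSA : S ⊆ A) (hS : G.IsIndepSet S) :
    ∃ T : Finset V, S ⊆ T ∧ T ⊆ A ∧ G.IsIndepSet T ∧ A.card ≤ (d + 1) * T.card ∧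
      ∀ a ∈ A, a ∉ T → ∃ b ∈ T, G.Adj b a := by
  obtain ⟨T, hT, hmax⟩ := Finset.exists_max_image
    (A.powerset.filter fun T => S ⊆ T ∧ G.IsIndepSet T) Finset.card
    ⟨S, by simp [hSA, hS]⟩
  simp only [Finset.mem_filter, Finset.mem_powerset] at hT hmax
  obtain ⟨hTA, hST, hTI⟩ := hT
  have hdom : ∀ a ∈ A, a ∉ T → ∃ b ∈ T, G.Adj b a := by
    intro a ha haT
    by_contra! hno
    have := hmax (insert a T) ⟨Finset.insert_subset ha hTA,
      hST.trans (Finset.subset_insert _ _), by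
        rw [Finset.coe_insert]
        refine Set.Pairwise.insert hTI fun b hb _ => ⟨fun h => hno b hb h.symm, hno b hb⟩⟩
    rw [Finset.card_insert_of_notMem haT] at this
    omega
  refine ⟨T, hST, hTA, hTI, ?_, hdom⟩
  calc A.card ≤ (T.biUnion fun b => insert b (G.neighborFinset b)).card := by
        refine Finset.card_le_card fun a ha => ?_
        by_cases haT : a ∈ T
        · exact Finset.mem_biUnion.mpr ⟨a, haT, Finset.mem_insert_self _ _⟩
        · obtain ⟨b, hb, hab⟩ := hdom a ha haT
          exact Finset.mem_biUnion.mpr ⟨b, hb, Finset.mem_insert_of_mem (by simpa using hab)⟩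
    _ ≤ T.card * (d + 1) := Finset.card_biUnion_le_card_mul _ _ _ fun b _ =>
        (Finset.card_insert_le _ _).trans (by simpa using hd b)
    _ = _ := mul_comm _ _

/-- Two distinct vertices conflict if they are at distance at most two. -/
def SimpleGraph.conflict {V : Type*} (H : SimpleGraph V) : SimpleGraph V where
  Adj a b := a ≠ b ∧ (H.Adj a b ∨ ∃ u, H.Adj a u ∧ H.Adj u b)
  symm := ⟨fun _ _ ⟨h, h'⟩ => ⟨h.symm, h'.imp (fun h => h.symm)
    fun ⟨u, h1, h2⟩ => ⟨u, h2.symm, h1.symm⟩⟩⟩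
  loopless := ⟨fun _ h => h.1 rfl⟩

theorem SimpleGraph.IsIndepSet.not_adj {V : Type*} {H : SimpleGraph V} {T : Set V}
    (hT : H.conflict.IsIndepSet T) {a b : V} (ha : a ∈ T) (hb : b ∈ T) : ¬ H.Adj a b :=
  fun h => hT ha hb h.ne ⟨h.ne, Or.inl h⟩

/-- Together with `not_adj`: the closed neighbourhoods of the members of a conflict-free set are
disjoint, so plans made for different members never give one vertex two tasks. -/
theorem SimpleGraph.IsIndepSet.eq_of_adj {V : Type*} {H : SimpleGraph V} {T : Set V}
    (hT : H.conflict.IsIndepSet T) {a b u : V} (ha : a ∈ T) (hb : b ∈ T) (hau : H.Adj a u)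
    (hbu : H.Adj b u) : a = b := by
  by_contra hne
  exact hT ha hb hne ⟨hne, Or.inr ⟨u, hau, hbu.symm⟩⟩

open scoped Classical in
theorem SimpleGraph.degree_conflict_le {V : Type*} [Fintype V] (H : SimpleGraph V) {d : ℕ}
    (hd : ∀ v, H.degree v ≤ d) (v : V) : H.conflict.degree v ≤ d * d := by
  have hsub : H.conflict.neighborFinset v ⊆ H.neighborFinset v ∪
      (H.neighborFinset v).biUnion fun u => (H.neighborFinset u).erase v := by
    intro b hb
    rw [SimpleGraph.mem_neighborFinset] at hb
    obtain ⟨hne, h | ⟨u, h1, h2⟩⟩ := hb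
    · exact Finset.mem_union_left _ (by simpa using h)
    · exact Finset.mem_union_right _
        (Finset.mem_biUnion.mpr ⟨u, by simpa using h1, by simpa [hne.symm] using h2⟩)
  have h1 : ((H.neighborFinset v).biUnion fun u => (H.neighborFinset u).erase v).card ≤
      (H.neighborFinset v).card * (d - 1) := by
    refine Finset.card_biUnion_le_card_mul _ _ _ fun u hu => ?_
    rw [Finset.card_erase_of_mem (by simpa using (H.mem_neighborFinset v u |>.mp hu).symm)]
    have := hd u
    rw [SimpleGraph.card_neighborFinset_eq_degree]
    omega
  have h2 := (Finset.card_le_card hsub).trans (Finset.card_union_le _ _)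
  rw [SimpleGraph.card_neighborFinset_eq_degree] at h1 h2
  rw [SimpleGraph.card_neighborFinset_eq_degree] at h2
  have h3 := hd v
  rcases Nat.eq_zero_or_pos d with rfl | hpos
  · have : H.degree v = 0 := by omega
    rw [this] at h1 h2
    omega
  · obtain ⟨e, rfl⟩ : ∃ e, d = e + 1 := ⟨d - 1, by omega⟩
    simp only [Nat.add_sub_cancel] at h1
    nlinarith

open scoped Classical in
/-- The edges of a graph of maximum degree at most `d` can be distributed among their endpoints
so that no vertex receives more than `d / 2`, rounded up. -/
theorem SimpleGraph.exists_todo {V : Type*} [Fintype V] (H : SimpleGraph V) {d : ℕ}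
    (hd : ∀ v, H.degree v ≤ d) : ∃ todo : V → ℕ → V, ∀ a b, H.Adj a b →
      (∃ k < (d + 1) / 2, todo a k = b) ∨ ∃ k < (d + 1) / 2, todo b k = a := by
  -- Hall's theorem matches each edge to a slot `(v, k)` at one of its endpoints, each vertex having
  -- `(d + 1) / 2` slots. Hall's condition holds by double counting: `s` edges meet at least `2 * s
  -- / d` vertices.
  let t : H.edgeSet → Finset (V × ℕ) := fun e =>
    (Finset.univ.filter (· ∈ e.1)) ×ˢ Finset.range ((d + 1) / 2)
  have hall : ∀ s : Finset H.edgeSet, s.card ≤ (s.biUnion t).card := by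
    intro s
    set W : Finset V := Finset.univ.filter fun v => ∃ e ∈ s, v ∈ e.1 with hW
    have hU : s.biUnion t = W ×ˢ Finset.range ((d + 1) / 2) := by
      ext ⟨v, k⟩
      simp only [t, hW, Finset.mem_biUnion, Finset.mem_product, Finset.mem_filter,
        Finset.mem_univ, true_and]
      tauto
    rw [hU, Finset.card_product, Finset.card_range]
    have h2 : s.card * 2 ≤ W.card * d := by
      refine Finset.card_mul_le_card_mul (fun (e : H.edgeSet) (v : V) => v ∈ e.1) ?_ ?_
      · rintro ⟨e, he⟩ hes
        induction e using Sym2.ind with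
        | _ a b =>
          have hne : a ≠ b := (H.mem_edgeSet.mp he).ne
          rw [← Finset.card_pair hne]
          refine Finset.card_le_card ?_
          intro v hv
          have hv' : v ∈ s(a, b) := by simpa using hv
          simp only [Finset.mem_bipartiteAbove, hW, Finset.mem_filter, Finset.mem_univ, true_and]
          exact ⟨⟨_, hes, hv'⟩, hv'⟩
      · intro v _
        refine le_trans ?_ (hd v)
        rw [← SimpleGraph.card_incidenceFinset_eq_degree]
        refine Finset.card_le_card_of_injOn (fun e => e.1) ?_ Subtype.val_injective.injOn
        intro e he
        have := (Finset.mem_bipartiteBelow _).mp (Finset.mem_coe.mp he)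
        simp only [Finset.mem_coe, SimpleGraph.mem_incidenceFinset]
        exact ⟨e.2, this.2⟩
    have h3 : d ≤ 2 * ((d + 1) / 2) := by omega
    nlinarith [Nat.mul_le_mul_left W.card h3]
  obtain ⟨f, hf, hft⟩ := (Finset.all_card_le_biUnion_card_iff_exists_injective t).mp hall
  refine ⟨fun a k => if h : ∃ b, ∃ hab : H.Adj a b, f ⟨s(a, b), hab⟩ = (a, k) then h.choose else a,
    ?_⟩
  have key : ∀ a b k, ∀ hab : H.Adj a b, f ⟨s(a, b), hab⟩ = (a, k) →
      (if h : ∃ b, ∃ hab : H.Adj a b, f ⟨s(a, b), hab⟩ = (a, k) then h.choose else a) = b := by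
    intro a b k hab hfab
    have h : ∃ b, ∃ hab : H.Adj a b, f ⟨s(a, b), hab⟩ = (a, k) := ⟨b, hab, hfab⟩
    rw [dif_pos h]
    obtain ⟨h1, h2⟩ := h.choose_spec
    exact Sym2.congr_right.mp (congrArg Subtype.val (hf (h2.trans hfab.symm)))
  intro a b hab
  have hmem := hft ⟨s(a, b), hab⟩
  simp only [t, Finset.mem_product, Finset.mem_filter, Finset.mem_univ, true_and,
    Finset.mem_range, Sym2.mem_iff] at hmem
  obtain ⟨h1 | h1, h2⟩ := hmem
  · exact Or.inl ⟨_, h2, key a b _ hab (Prod.ext h1 rfl)⟩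
  · refine Or.inr ⟨_, h2, key b a _ hab.symm ?_⟩
    simp only [Sym2.eq_swap (a := b) (b := a)]
    exact Prod.ext h1 rfl

/-- The bijection `φ` maps to `G` all edges of `H` that have no endpoint in `B`. -/
def EmbedsOff {V : Type*} (H : SimpleGraph V) (φ : Equiv.Perm V) (G : SimpleGraph V)
    (B : Finset V) : Prop :=
  ∀ a b, H.Adj a b → a ∉ B → b ∉ B → G.Adj (φ a) (φ b)

namespace EmbedsOff

variable {V : Type*} {H G : SimpleGraph V} {φ : Equiv.Perm V} {B : Finset V}

theorem mono_graph {G' : SimpleGraph V} (h : EmbedsOff H φ G B) (hG : G ≤ G') :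
    EmbedsOff H φ G' B := fun a b hab ha hb => hG (h a b hab ha hb)

theorem isContained (h : EmbedsOff H φ G ∅) : H.IsContained G :=
  ⟨⟨⟨φ, fun {a b} hab => h a b hab (by simp) (by simp)⟩, φ.injective⟩⟩

variable [DecidableEq V]

/-- Only edges at `h` or `i` are affected. As `h` and `i` are not adjacent, their neighbours keep
their places, so `e1` and `e2` supply exactly the edges needed, including those to neighbours in
`B`. -/
theorem swap (hφ : EmbedsOff H φ G B) {h i : V} (hi : i ∉ B) (hadj : ¬ H.Adj h i)
    (e1 : ∀ u, H.Adj h u → G.Adj (φ u) (φ i)) (e2 : ∀ u, H.Adj i u → G.Adj (φ u) (φ h)) :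
    EmbedsOff H ((Equiv.swap h i).trans φ) G (B.erase h) := by
  have key : ∀ a b, H.Adj a b → (a = h ∨ a = i) →
      G.Adj (φ (Equiv.swap h i a)) (φ (Equiv.swap h i b)) := by
    rintro a b hab (rfl | rfl)
    · rw [Equiv.swap_apply_left, Equiv.swap_apply_of_ne_of_ne hab.ne.symm
        (by rintro rfl; exact hadj hab)]
      exact (e1 b hab).symm
    · rw [Equiv.swap_apply_right, Equiv.swap_apply_of_ne_of_ne
        (by rintro rfl; exact hadj hab.symm) hab.ne.symm]
      exact (e2 b hab).symm
  intro a b hab ha hb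
  simp only [Equiv.trans_apply]
  by_cases h1 : a = h ∨ a = i
  · exact key a b hab h1
  by_cases h2 : b = h ∨ b = i
  · exact (key b a hab.symm h2).symm
  push Not at h1 h2
  rw [Equiv.swap_apply_of_ne_of_ne h1.1 h1.2, Equiv.swap_apply_of_ne_of_ne h2.1 h2.2]
  exact hφ a b hab (fun h => ha (Finset.mem_erase.mpr ⟨h1.1, h⟩))
    (fun h => hb (Finset.mem_erase.mpr ⟨h2.1, h⟩))

/-- The exchanges are made one at a time. Since `X` is conflict-free, an exchange moves no neighbour
of a member of `X`, and by injectivity of `κ` it moves no other pair, so the hypotheses for the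
remaining pairs persist. -/
theorem exists_sdiff {R : Finset V} {κ : V → V} {X : Set V} (hφ : EmbedsOff H φ G B)
    (hX : H.conflict.IsIndepSet X) (hRX : ∀ h ∈ R, h ∈ X) (hκX : ∀ h ∈ R, κ h ∈ X)
    (hκ : Set.InjOn κ R) (hRB : R ⊆ B) (hκB : ∀ h ∈ R, κ h ∉ B)
    (e1 : ∀ h ∈ R, ∀ u, H.Adj h u → G.Adj (φ u) (φ (κ h)))
    (e2 : ∀ h ∈ R, ∀ u, H.Adj (κ h) u → G.Adj (φ u) (φ h)) :
    ∃ φ', EmbedsOff H φ' G (B \ R) := by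
  induction R using Finset.induction_on generalizing φ B with
  | empty => exact ⟨φ, by simpa using hφ⟩
  | insert h R hR ih =>
    have hm := Finset.mem_insert_self h R
    have hs : ∀ x ∈ R, x ∈ insert h R := fun x hx => Finset.mem_insert_of_mem hx
    have hsw := hφ.swap (hκB h hm) (hX.not_adj (hRX h hm) (hκX h hm)) (e1 h hm) (e2 h hm)
    have hfix : ∀ x, x ≠ h → x ≠ κ h → ((Equiv.swap h (κ h)).trans φ) x = φ x := fun x h1 h2 => by
      rw [Equiv.trans_apply, Equiv.swap_apply_of_ne_of_ne h1 h2]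
    have hnb : ∀ x ∈ X, ∀ u, H.Adj x u → ((Equiv.swap h (κ h)).trans φ) u = φ u := by
      intro x hx u hu
      refine hfix u ?_ ?_
      · rintro rfl; exact hX.not_adj hx (hRX _ hm) hu
      · rintro rfl; exact hX.not_adj hx (hκX h hm) hu
    have hfixR : ∀ x ∈ R, ((Equiv.swap h (κ h)).trans φ) x = φ x := by
      intro x hx
      refine hfix x ?_ ?_
      · rintro rfl; exact hR hx
      · intro hx'; exact hκB h hm (hx' ▸ hRB (hs x hx))
    have hfixκ : ∀ x ∈ R, ((Equiv.swap h (κ h)).trans φ) (κ x) = φ (κ x) := by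
      intro x hx
      refine hfix _ ?_ ?_
      · intro h'; exact hκB x (hs x hx) (h' ▸ hRB hm)
      · intro h'
        have := hκ (Finset.mem_coe.mpr (hs x hx)) (Finset.mem_coe.mpr hm) h'
        exact hR (this ▸ hx)
    have hRe : R ⊆ B.erase h := fun x hx => Finset.mem_erase.mpr
      ⟨fun h' => hR (h' ▸ hx), hRB (hs x hx)⟩
    obtain ⟨φ', hφ'⟩ := ih hsw (fun x hx => hRX x (hs x hx)) (fun x hx => hκX x (hs x hx))
      (hκ.mono (by simp)) hRe (fun x hx h' => hκB x (hs x hx) (Finset.mem_of_mem_erase h'))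
      (fun x hx u hu => by
        rw [hnb x (hRX x (hs x hx)) u hu, hfixκ x hx]; exact e1 x (hs x hx) u hu)
      (fun x hx u hu => by
        rw [hnb (κ x) (hκX x (hs x hx)) u hu, hfixR x hx]; exact e2 x (hs x hx) u hu)
    refine ⟨φ', ?_⟩
    rwa [Finset.erase_sdiff_comm, ← Finset.sdiff_insert] at hφ'

end EmbedsOff

open scoped Classical in
/-- Every `h ∈ S` can be given `M` candidates `e h j`, `j < M`, outside `B`, so that the members of
`S` and all the candidates are pairwise distinct and do not conflict. -/
theorem exists_candidates {V : Type*} [Fintype V] [DecidableEq V] (H : SimpleGraph V) {d : ℕ}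
    (hd : ∀ v, H.degree v ≤ d) {S B : Finset V} (hSB : S ⊆ B) (hS : H.conflict.IsIndepSet S)
    {M : ℕ} (hcard : (d * d + 1) * (S.card * (M + 1)) + B.card ≤ Fintype.card V) :
    ∃ e : V → ℕ → V, (∀ h ∈ S, ∀ j < M, e h j ∉ B) ∧
      (∀ h ∈ S, ∀ h' ∈ S, ∀ j < M, ∀ j' < M, e h j = e h' j' → h = h' ∧ j = j') ∧
      H.conflict.IsIndepSet {x | x ∈ S ∨ ∃ h ∈ S, ∃ j < M, e h j = x} := by
  -- Extending `S` to a maximal conflict-free set within `S ∪ Bᶜ` yields at least `S.card * (M + 1)`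
  -- vertices; those outside `S` serve as candidates.
  obtain ⟨T, hST, hTA, hTI, hTc, -⟩ := H.conflict.exists_isIndepSet_card
    (fun v => by convert H.degree_conflict_le hd v)
    (Finset.subset_union_left (s₁ := S) (s₂ := Bᶜ)) hS
  have hA : (S ∪ Bᶜ).card = S.card + (Fintype.card V - B.card) := by
    rw [Finset.card_union_of_disjoint, Finset.card_compl]
    exact Finset.disjoint_of_subset_left hSB disjoint_compl_right
  have hle : S.card * M ≤ (T \ S).card := by
    rw [Finset.card_sdiff_of_subset hST]
    have hTS : S.card * (M + 1) ≤ T.card := by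
      by_contra! hlt
      have h1 : (d * d + 1) * (T.card + 1) ≤ (d * d + 1) * (S.card * (M + 1)) :=
        Nat.mul_le_mul_left _ hlt
      rw [hA] at hTc
      rw [mul_add, mul_one] at h1
      omega
    rw [mul_add, mul_one] at hTS
    omega
  obtain ⟨g⟩ : Nonempty (↥(S ×ˢ Finset.range M) ↪ ↥(T \ S)) :=
    Function.Embedding.nonempty_of_card_le (by
      rwa [Fintype.card_coe, Fintype.card_coe, Finset.card_product, Finset.card_range])
  have hmem : ∀ h ∈ S, ∀ j < M, (h, j) ∈ S ×ˢ Finset.range M := fun h hh j hj =>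
    Finset.mem_product.mpr ⟨hh, Finset.mem_range.mpr hj⟩
  have hT : ∀ (x : ↥(S ×ˢ Finset.range M)), (g x : V) ∈ T ∧ (g x : V) ∉ S := fun x =>
    Finset.mem_sdiff.mp (g x).2
  obtain ⟨e, he⟩ : ∃ e : V → ℕ → V, ∀ h (hh : h ∈ S) j (hj : j < M),
      e h j = g ⟨(h, j), hmem h hh j hj⟩ :=
    ⟨fun h j => if hj : (h, j) ∈ S ×ˢ Finset.range M then g ⟨(h, j), hj⟩ else h,
      fun h hh j hj => dif_pos (hmem h hh j hj)⟩
  refine ⟨e, ?_⟩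
  refine ⟨?_, ?_, ?_⟩
  · intro h hh j hj
    rw [he h hh j hj]
    obtain ⟨h1, h2⟩ := hT ⟨(h, j), hmem h hh j hj⟩
    rcases Finset.mem_union.mp (hTA h1) with h3 | h3
    · exact absurd h3 h2
    · exact Finset.mem_compl.mp h3
  · intro h hh h' hh' j hj j' hj' heq
    rw [he h hh j hj, he h' hh' j' hj'] at heq
    have := g.injective (Subtype.ext heq)
    simpa using this
  · refine Set.Pairwise.mono ?_ hTI
    rintro x (hx | ⟨h, hh, j, hj, rfl⟩)
    · exact hST hx
    · rw [he h hh j hj]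
      exact (hT _).1

end GraphCombinatorics

/-! ### Repair with few candidates in two windows -/

section RepairByNeighbours

variable {V : Type*} [Fintype V] [DecidableEq V]

theorem card_filter_lt_of_not_exists {ι α : Type*} {S : Finset ι} {D : ι → Finset α}
    (hD : (S : Set ι).PairwiseDisjoint D) {p : ι → Prop} [DecidablePred p] {t : ℕ}
    (h : ¬ ∃ T ⊆ S, T.card = t ∧ (T : Set ι).PairwiseDisjoint D ∧ ∀ h ∈ T, p h) :
    (S.filter p).card < t := by
  by_contra! hle
  obtain ⟨T, hT, hc⟩ := Finset.exists_subset_card_eq hle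
  exact h ⟨T, hT.trans (Finset.filter_subset _ _), hc,
    hD.subset (Finset.coe_subset.mpr (hT.trans (Finset.filter_subset _ _))),
    fun h hh => (Finset.mem_filter.mp (hT hh)).2⟩

theorem exists_getD_toList {α : Type*} {U : Finset α} {u : α} (hu : u ∈ U) (x : α) :
    ∃ i < U.card, U.toList.getD i x = u := by
  obtain ⟨i, hi, rfl⟩ := List.getElem_of_mem (Finset.mem_toList.mpr hu)
  exact ⟨i, by simpa using hi, by
    rw [List.getD_eq_getElem]⟩

open scoped Classical in
/-- In two windows of `m` rounds, all but `2 * (t - 1)` members of an independent set `S` of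
uncovered vertices are moved to new places: each has `2 * k` candidates, to which the neighbours
link in the first window, and which link to the remaining neighbours in the second window. -/
theorem optFail_repair_le [Nonempty V] {P : SimpleGraph V → Prop} (hP : Monotone P)
    {H : SimpleGraph V} {d : ℕ} (hd : ∀ v, H.degree v ≤ d) {φ : Equiv.Perm V} {G : SimpleGraph V}
    {B S : Finset V} (hφ : EmbedsOff H φ G B) (hSB : S ⊆ B) (hS : H.conflict.IsIndepSet S) {k : ℕ}
    (hcard : (d * d + 1) * (S.card * (2 * k + 1)) + B.card ≤ Fintype.card V)
    {m : ℕ} {q : ℝ} (hq : 0 ≤ q)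
    (hlack : ∀ A : Finset V, offerProb m (fun c => ∀ v ∈ A, c v < 2 * k) ≤ q ^ A.card)
    {N : ℕ} (hN : d * (2 * k + 1) ≤ N) (hN' : 2 * k ≤ N) {t m' : ℕ} {η : ℝ} (hη : 0 ≤ η)
    (hnext : ∀ φ' G' B', EmbedsOff H φ' G' B' → B' ⊆ B → (B' ∩ S).card ≤ 2 * (t - 1) →
      optFail P m' G' ≤ η) :
    optFail P (m + (m + m')) G ≤ 2 * (S.card.choose t * (((N : ℝ) * q) ^ k) ^ t) + η := by
  obtain ⟨e, heB, heinj, hX⟩ := exists_candidates H hd hSB hS hcard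
  set X : Set V := {x | x ∈ S ∨ ∃ h ∈ S, ∃ j < 2 * k, e h j = x} with hXdef
  have hSX : ∀ h ∈ S, h ∈ X := fun h hh => Or.inl hh
  have heX : ∀ h ∈ S, ∀ j < 2 * k, e h j ∈ X := fun h hh j hj => Or.inr ⟨h, hh, j, hj, rfl⟩
  -- the first window
  obtain ⟨todo, htodo1, htodo2⟩ : ∃ todo : V → ℕ → V,
      (∀ h ∈ S, ∀ u, H.Adj h u → ∀ j, todo (φ u) j = φ (e h j)) ∧
      (∀ h ∈ S, ∀ j < 2 * k, ∀ u, H.Adj (e h j) u → todo (φ u) 0 = φ h) := by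
    -- The plan is unambiguous because a vertex is adjacent to at most one member of `X`. A
    -- neighbour of `h` links to all candidates in turn; a neighbour of a candidate of `h` only
    -- needs its first offer, to link to the place of `h`.
    refine ⟨fun x j => if hx : ∃ h ∈ S, H.Adj h (φ.symm x) then φ (e hx.choose j) else
      if hx : ∃ h ∈ S, ∃ j < 2 * k, H.Adj (e h j) (φ.symm x) then φ hx.choose else x, ?_, ?_⟩
    · intro h hh u hu j
      have hx : ∃ h ∈ S, H.Adj h (φ.symm (φ u)) := ⟨h, hh, by simpa using hu⟩
      have hc := hx.choose_spec
      simp only [dif_pos hx]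
      rw [hX.eq_of_adj (hSX _ hc.1) (hSX _ hh) (by simpa using hc.2) hu]
    · intro h hh j hj u hu
      have hx1 : ¬ ∃ h ∈ S, H.Adj h (φ.symm (φ u)) := by
        rintro ⟨h', hh', hu'⟩
        rw [Equiv.symm_apply_apply] at hu'
        have := hX.eq_of_adj (hSX _ hh') (heX _ hh _ hj) hu' hu
        exact heB h hh j hj (this ▸ hSB hh')
      have hx : ∃ h ∈ S, ∃ j < 2 * k, H.Adj (e h j) (φ.symm (φ u)) :=
        ⟨h, hh, j, hj, by simpa using hu⟩
      obtain ⟨hc1, j', hj', hc2⟩ := hx.choose_spec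
      simp only [dif_neg hx1, dif_pos hx]
      have := hX.eq_of_adj (heX _ hc1 _ hj') (heX _ hh _ hj) (by simpa using hc2) hu
      rw [(heinj _ hc1 _ hh _ hj' _ hj this).1]
  -- The places whose offers in the first window matter to `h`; `h` fails the window if `k` of them
  -- are lacking.
  let D : V → Finset V := fun h => (H.neighborFinset h ∪
    (Finset.range (2 * k)).biUnion fun j => H.neighborFinset (e h j)).image φ
  have hDmem1 : ∀ h u, H.Adj h u → φ u ∈ D h := fun h u hu => Finset.mem_image_of_mem _
    (Finset.mem_union_left _ (by simpa using hu))
  have hDmem2 : ∀ h, ∀ j < 2 * k, ∀ u, H.Adj (e h j) u → φ u ∈ D h := fun h j hj u hu =>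
    Finset.mem_image_of_mem _ (Finset.mem_union_right _
      (Finset.mem_biUnion.mpr ⟨j, Finset.mem_range.mpr hj, by simpa using hu⟩))
  have hDcard : ∀ h ∈ S, (D h).card ≤ N := by
    intro h _
    refine le_trans ?_ hN
    refine Finset.card_image_le.trans ((Finset.card_union_le _ _).trans ?_)
    have h1 := hd h
    have h2 : ((Finset.range (2 * k)).biUnion fun j => H.neighborFinset (e h j)).card ≤
        (Finset.range (2 * k)).card * d :=
      Finset.card_biUnion_le_card_mul _ _ _ fun j _ => by simpa using hd (e h j)
    rw [Finset.card_range] at h2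
    rw [SimpleGraph.card_neighborFinset_eq_degree]
    nlinarith
  have hDX : ∀ h ∈ S, ∀ x ∈ D h, ∃ y ∈ X, H.Adj y (φ.symm x) ∧
      (y = h ∨ ∃ j < 2 * k, e h j = y) := by
    intro h hh x hx
    obtain ⟨u, hu, rfl⟩ := Finset.mem_image.mp hx
    rw [Equiv.symm_apply_apply]
    rcases Finset.mem_union.mp hu with hu | hu
    · exact ⟨h, hSX h hh, by simpa using hu, Or.inl rfl⟩
    · obtain ⟨j, hj, hu⟩ := Finset.mem_biUnion.mp hu
      have hj := Finset.mem_range.mp hj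
      exact ⟨e h j, heX h hh j hj, by simpa using hu, Or.inr ⟨j, hj, rfl⟩⟩
  have hDdisj : (S : Set V).PairwiseDisjoint D := by
    intro h hh h' hh' hne
    refine Finset.disjoint_left.mpr fun x hx hx' => hne ?_
    obtain ⟨y, hy, hyx, hyh⟩ := hDX h hh x hx
    obtain ⟨y', hy', hyx', hyh'⟩ := hDX h' hh' x hx'
    have hyy := hX.eq_of_adj hy hy' hyx hyx'
    subst hyy
    rcases hyh with rfl | ⟨j, hj, rfl⟩ <;> rcases hyh' with h2 | ⟨j', hj', h2⟩
    · exact h2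
    · exact absurd (hSB hh) (h2 ▸ heB h' hh' j' hj')
    · exact absurd (hSB hh') (h2 ▸ heB h hh j hj)
    · exact (heinj _ hh' _ hh _ hj' _ hj h2).1.symm
  set ρ : ℝ := S.card.choose t * (((N : ℝ) * q) ^ k) ^ t with hρ
  have hρ0 : 0 ≤ ρ := by positivity
  have hwin1 := offerProb_many_lacking_le hq hlack S D hDcard k t
  refine (optFail_add_le hP todo (add_nonneg hρ0 hη) (fun c hc => ?_)).trans
    (le_trans (add_le_add_left hwin1 _) (le_of_eq (by rw [← hρ]; ring)))
  have hF1 := card_filter_lt_of_not_exists hDdisj hc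
  set F1 := S.filter fun h => k ≤ ((D h).filter fun v => c v < 2 * k).card with hF1def
  clear hwin1 hc
  -- the second window
  let U : V → Finset V := fun h => (H.neighborFinset h).filter fun u => c (φ u) < 2 * k
  obtain ⟨todo', htodo'⟩ : ∃ todo' : V → ℕ → V, ∀ h ∈ S, ∀ j < 2 * k, ∀ u ∈ U h,
      ∃ i < (U h).card, todo' (φ (e h j)) i = φ u := by
    refine ⟨fun x i => if hx : ∃ h ∈ S, ∃ j < 2 * k, e h j = φ.symm x then
      φ ((U hx.choose).toList.getD i x) else x, ?_⟩
    intro h hh j hj u hu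
    have hx : ∃ h' ∈ S, ∃ j' < 2 * k, e h' j' = φ.symm (φ (e h j)) := ⟨h, hh, j, hj, by simp⟩
    obtain ⟨hc1, j', hj', hc2⟩ := hx.choose_spec
    have hc2 := hc2.trans (Equiv.symm_apply_apply _ _)
    have hch : hx.choose = h := (heinj _ hc1 _ hh _ hj' _ hj hc2).1
    obtain ⟨i, hi, hiu⟩ := exists_getD_toList hu (φ (e h j))
    refine ⟨i, hi, ?_⟩
    simp only [dif_pos hx]
    rw [hch, hiu]
  let D' : V → Finset V := fun h => (Finset.range (2 * k)).image fun j => φ (e h j)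
  have hD'card : ∀ h ∈ S, (D' h).card ≤ N := fun h _ =>
    Finset.card_image_le.trans (by simpa using hN')
  have hD'disj : (S : Set V).PairwiseDisjoint D' := by
    intro h hh h' hh' hne
    refine Finset.disjoint_left.mpr fun x hx hx' => hne ?_
    obtain ⟨j, hj, rfl⟩ := Finset.mem_image.mp hx
    obtain ⟨j', hj', hx'⟩ := Finset.mem_image.mp hx'
    exact (heinj _ hh' _ hh _ (Finset.mem_range.mp hj') _ (Finset.mem_range.mp hj)
      (φ.injective hx')).1.symm
  have hwin2 := offerProb_many_lacking_le hq hlack S D' hD'card k t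
  refine (optFail_add_le hP todo' hη (fun c' hc' => ?_)).trans (add_le_add_left hwin2 _)
  have hF2 := card_filter_lt_of_not_exists hD'disj hc'
  set F2 := S.filter fun h => k ≤ ((D' h).filter fun v => c' v < 2 * k).card with hF2def
  clear hwin2 hc'
  -- a good candidate for every vertex which fails in neither window
  have hgood : ∀ h ∈ S \ (F1 ∪ F2), ∃ j < 2 * k, (∀ u, H.Adj (e h j) u → 2 * k ≤ c (φ u)) ∧
      2 * k ≤ c' (φ (e h j)) ∧ (U h).card < 2 * k := by
    intro h hh
    obtain ⟨hhS, hhF⟩ := Finset.mem_sdiff.mp hh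
    have hlt1 : ((D h).filter fun v => c v < 2 * k).card < k := by
      by_contra! hle
      exact hhF (Finset.mem_union_left _ (Finset.mem_filter.mpr ⟨hhS, hle⟩))
    have hlt2 : ((D' h).filter fun v => c' v < 2 * k).card < k := by
      by_contra! hle
      exact hhF (Finset.mem_union_right _ (Finset.mem_filter.mpr ⟨hhS, hle⟩))
    have hU : (U h).card < 2 * k := by
      refine lt_of_le_of_lt ?_ (hlt1.trans_le (by omega))
      refine Finset.card_le_card_of_injOn φ ?_ φ.injective.injOn
      intro u hu
      obtain ⟨hu1, hu2⟩ := Finset.mem_filter.mp (Finset.mem_coe.mp hu)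
      exact Finset.mem_coe.mpr (Finset.mem_filter.mpr ⟨hDmem1 h u (by simpa using hu1), hu2⟩)
    -- Distinct candidates have disjoint neighbourhoods, so a candidate spoiled by a lacking
    -- neighbour can be charged to a lacking vertex of its own. Fewer than `k` are spoiled this way
    -- and fewer than `k` in the second window, so one of the `2 * k` remains.
    set K1 := (Finset.range (2 * k)).filter fun j => ∃ u, H.Adj (e h j) u ∧ c (φ u) < 2 * k
      with hK1
    set K2 := (Finset.range (2 * k)).filter fun j => c' (φ (e h j)) < 2 * k with hK2
    have hK1c : K1.card < k := by
      refine lt_of_le_of_lt ?_ hlt1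
      have hex : ∀ j ∈ K1, ∃ u, H.Adj (e h j) u ∧ c (φ u) < 2 * k := fun j hj =>
        (Finset.mem_filter.mp hj).2
      refine Finset.card_le_card_of_injOn
        (fun j => if hj : j ∈ K1 then φ (hex j hj).choose else h) ?_ ?_
      · intro j hj
        have hj' := Finset.mem_coe.mp hj
        simp only [dif_pos hj']
        obtain ⟨h1, h2⟩ := (hex j hj').choose_spec
        exact Finset.mem_coe.mpr (Finset.mem_filter.mpr
          ⟨hDmem2 h j (Finset.mem_range.mp (Finset.mem_filter.mp hj').1) _ h1, h2⟩)
      · intro j hj j' hj' heq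
        have hj := Finset.mem_coe.mp hj
        have hj' := Finset.mem_coe.mp hj'
        simp only [dif_pos hj, dif_pos hj'] at heq
        have heq := φ.injective heq
        have h1 := (hex j hj).choose_spec.1
        have h2 := (hex j' hj').choose_spec.1
        rw [← heq] at h2
        have hjr := Finset.mem_range.mp (Finset.mem_filter.mp hj).1
        have hjr' := Finset.mem_range.mp (Finset.mem_filter.mp hj').1
        exact (heinj _ hhS _ hhS _ hjr _ hjr'
          (hX.eq_of_adj (heX h hhS j hjr) (heX h hhS j' hjr') h1 h2)).2
    have hK2c : K2.card < k := by
      refine lt_of_le_of_lt ?_ hlt2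
      refine Finset.card_le_card_of_injOn (fun j => φ (e h j)) ?_ ?_
      · intro j hj
        obtain ⟨h1, h2⟩ := Finset.mem_filter.mp (Finset.mem_coe.mp hj)
        exact Finset.mem_coe.mpr (Finset.mem_filter.mpr
          ⟨Finset.mem_image_of_mem _ h1, h2⟩)
      · intro j hj j' hj' heq
        exact (heinj _ hhS _ hhS _
          (Finset.mem_range.mp (Finset.mem_filter.mp (Finset.mem_coe.mp hj)).1) _
          (Finset.mem_range.mp (Finset.mem_filter.mp (Finset.mem_coe.mp hj')).1)
          (φ.injective heq)).2
    obtain ⟨j, hj, hjK⟩ : ∃ j ∈ Finset.range (2 * k), j ∉ K1 ∪ K2 := by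
      by_contra! hall
      have h1 := Finset.card_le_card (show Finset.range (2 * k) ⊆ K1 ∪ K2 from hall)
      have h2 := Finset.card_union_le K1 K2
      rw [Finset.card_range] at h1
      omega
    rw [Finset.mem_union, not_or] at hjK
    refine ⟨j, Finset.mem_range.mp hj, fun u hu => ?_, ?_, hU⟩
    · by_contra! hlt
      exact hjK.1 (Finset.mem_filter.mpr ⟨hj, u, hu, hlt⟩)
    · by_contra! hlt
      exact hjK.2 (Finset.mem_filter.mpr ⟨hj, hlt⟩)
  choose! J hJ hJ1 hJ2 hJU using hgood
  have hRS : S \ (F1 ∪ F2) ⊆ S := Finset.sdiff_subset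
  -- A neighbour of `h` offered `2 * k` times has linked to every candidate. The fewer than `2 * k`
  -- other neighbours are reached in the second window by the candidate itself, which was offered
  -- often enough.
  have e1 : ∀ h ∈ S \ (F1 ∪ F2), ∀ u, H.Adj h u →
      (G ⊔ claimed todo c ⊔ claimed todo' c').Adj (φ u) (φ (e h (J h))) := by
    intro h hh u hu
    have hne : u ≠ e h (J h) := by
      rintro rfl
      exact hX.not_adj (hSX h (hRS hh)) (heX h (hRS hh) _ (hJ h hh)) hu
    by_cases hcu : 2 * k ≤ c (φ u)
    · refine Or.inl (Or.inr (claimed_adj.mpr ⟨φ.injective.ne hne, Or.inl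
        ⟨J h, (hJ h hh).trans_le hcu, htodo1 h (hRS hh) u hu _⟩⟩))
    · have huU : u ∈ U h := Finset.mem_filter.mpr ⟨by simpa using hu, not_le.mp hcu⟩
      obtain ⟨i, hi, hiu⟩ := htodo' h (hRS hh) (J h) (hJ h hh) u huU
      exact Or.inr (claimed_adj.mpr ⟨φ.injective.ne hne, Or.inr
        ⟨i, (hi.trans (hJU h hh)).trans_le (hJ2 h hh), hiu⟩⟩)
  have e2 : ∀ h ∈ S \ (F1 ∪ F2), ∀ u, H.Adj (e h (J h)) u →
      (G ⊔ claimed todo c ⊔ claimed todo' c').Adj (φ u) (φ h) := by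
    intro h hh u hu
    have hne : u ≠ h := by
      rintro rfl
      exact hX.not_adj (heX u (hRS hh) _ (hJ u hh)) (hSX u (hRS hh)) hu
    refine Or.inl (Or.inr (claimed_adj.mpr ⟨φ.injective.ne hne, Or.inl
      ⟨0, ?_, htodo2 h (hRS hh) (J h) (hJ h hh) u hu⟩⟩))
    have h1 := hJ h hh
    have h2 := hJ1 h hh u hu
    omega
  obtain ⟨φ', hφ'⟩ := (hφ.mono_graph
      (le_sup_left.trans le_sup_left : G ≤ G ⊔ claimed todo c ⊔ claimed todo' c')).exists_sdiff
    (R := S \ (F1 ∪ F2)) (κ := fun h => e h (J h)) hX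
    (fun h hh => hSX h (hRS hh)) (fun h hh => heX h (hRS hh) _ (hJ h hh))
    (fun h hh h' hh' heq => (heinj _ (hRS hh) _ (hRS hh') _ (hJ h hh) _ (hJ h' hh') heq).1)
    (hRS.trans hSB) (fun h hh => heB h (hRS hh) _ (hJ h hh)) e1 e2
  refine hnext φ' _ _ hφ' Finset.sdiff_subset ?_
  have hsub : (B \ (S \ (F1 ∪ F2))) ∩ S ⊆ F1 ∪ F2 := by
    intro x hx
    obtain ⟨hx1, hx2⟩ := Finset.mem_inter.mp hx
    by_contra hxF
    exact (Finset.mem_sdiff.mp hx1).2 (Finset.mem_sdiff.mpr ⟨hx2, hxF⟩)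
  have := (Finset.card_le_card hsub).trans (Finset.card_union_le _ _)
  omega

end RepairByNeighbours

/-! ### Repair with many candidates, sifted over many windows -/

section RepairBySifting

variable {V : Type*} [Fintype V] [DecidableEq V]

/-- In each of `r` windows of `m` rounds, every `i ∈ A` places a request for an edge `a j i, b j i`,
which is granted if `a j i` is offered. The probability that in one of the sets `T κ` no member has
all its requests granted is as if all requests were granted independently. -/
theorem optFail_sift_le [Nonempty V] {P : SimpleGraph V → Prop} (hP : Monotone P)
    {ι κ : Type*} [DecidableEq ι] (a b : ℕ → ι → V) (K : Finset κ) (T : κ → Finset ι)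
    {m m' : ℕ} {η : ℝ} {p : ℝ} (hp : p = 1 - Real.exp (-(m / Fintype.card V : ℝ)))
    (r : ℕ) (G : SimpleGraph V) (A : Finset ι) (ha : ∀ j < r, Set.InjOn (a j) A)
    (hnext : ∀ G', G ≤ G' → ∀ A' ⊆ A,
      (∀ i ∈ A', ∀ j < r, a j i ≠ b j i → G'.Adj (a j i) (b j i)) →
      (∀ k ∈ K, (A' ∩ T k).Nonempty) → optFail P m' G' ≤ η) (hη : 0 ≤ η) :
    optFail P (r * m + m') G ≤ ∑ k ∈ K, (1 - p ^ r) ^ (A ∩ T k).card + η := by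
  have hp0 : 0 ≤ p := by
    rw [hp, sub_nonneg, Real.exp_le_one_iff, neg_nonpos]
    positivity
  have hp1 : p ≤ 1 := by rw [hp]; linarith [Real.exp_pos (-(m / Fintype.card V : ℝ))]
  have hz : ∀ r : ℕ, 0 ≤ 1 - p ^ r := fun r => sub_nonneg.mpr (pow_le_one₀ hp0 hp1)
  induction r generalizing G A with
  | zero =>
    have hsum : ∀ k ∈ K, (0 : ℝ) ≤ (1 - p ^ 0) ^ (A ∩ T k).card := fun k _ => pow_nonneg (hz 0) _
    by_cases hne : ∀ k ∈ K, (A ∩ T k).Nonempty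
    · rw [zero_mul, zero_add]
      have := hnext G le_rfl A subset_rfl (fun _ _ _ h => absurd h (Nat.not_lt_zero _)) hne
      linarith [Finset.sum_nonneg hsum]
    · push Not at hne
      obtain ⟨k, hk, hke⟩ := hne
      -- With no windows left, an empty `A ∩ T k` contributes `0 ^ 0 = 1`, which already dominates
      -- any failure probability.
      have h1 : (1 : ℝ) = (1 - p ^ 0) ^ (A ∩ T k).card := by rw [hke]; simp
      have h2 := Finset.single_le_sum hsum hk
      have h3 := optFail_le_one P (0 * m + m') G
      linarith
  | succ r ih =>
    obtain ⟨todo, htodo⟩ : ∃ todo : V → ℕ → V, ∀ i ∈ A, todo (a r i) 0 = b r i := by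
      classical
      refine ⟨fun x _ => if hx : ∃ i ∈ A, a r i = x then b r hx.choose else x, fun i hi => ?_⟩
      have hx : ∃ i' ∈ A, a r i' = a r i := ⟨i, hi, rfl⟩
      simp only [dif_pos hx]
      rw [ha r (Nat.lt_succ_self r) hx.choose_spec.1 hi hx.choose_spec.2]
    rw [show (r + 1) * m + m' = m + (r * m + m') by ring]
    refine (optFail_add_le_offerMean hP m _ todo G).trans ?_
    have hstep : ∀ c : V → ℕ, optFail P (r * m + m') (G ⊔ claimed todo c) ≤
        ∑ k ∈ K, (1 - p ^ r) ^ ((A ∩ T k).filter fun i => c (a r i) ≠ 0).card + η := by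
      intro c
      have := ih (G ⊔ claimed todo c) (A.filter fun i => c (a r i) ≠ 0)
        (fun j hj => (ha j (hj.trans (Nat.lt_succ_self r))).mono
          (Finset.coe_subset.mpr (Finset.filter_subset _ _)))
        (fun G' hG' A' hA' hreq hT => hnext G' (le_sup_left.trans hG') A'
          (hA'.trans (Finset.filter_subset _ _)) (fun i hi j hj hne => ?_) hT)
      · simpa only [Finset.filter_inter] using this
      · rcases Nat.lt_succ_iff_lt_or_eq.mp hj with hj | rfl
        · exact hreq i hi j hj hne
        · obtain ⟨hiA, hci⟩ := Finset.mem_filter.mp (hA' hi)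
          exact hG' (Or.inr (claimed_adj.mpr ⟨hne, Or.inl
            ⟨0, Nat.pos_of_ne_zero hci, htodo i hiA⟩⟩))
    refine (offerMean_mono hstep m).trans ?_
    rw [offerMean_add, offerMean_const, offerMean_sum]
    gcongr with k hk
    -- The generating function at `z = 1 - p ^ r` gives `1 - p ^ r * p`, which is the passage from
    -- `r` to `r + 1` windows.
    refine (offerMean_pow_card_offered_le (A ∩ T k) (a := a r)
      ((ha r (Nat.lt_succ_self r)).mono (by simp)) m (hz r) (by linarith [pow_nonneg hp0 r])).trans
      (le_of_eq ?_)
    rw [← hp]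
    congr 1
    ring

open scoped Classical in
/-- In `2 * d` windows of `m` rounds, at least half of the members of an independent set `S` of
uncovered vertices are moved to new places, each being given `M` candidates. -/
theorem optFail_sift_repair_le [Nonempty V] {P : SimpleGraph V → Prop} (hP : Monotone P)
    {H : SimpleGraph V} {d : ℕ} (hd : ∀ v, H.degree v ≤ d) {φ : Equiv.Perm V} {G : SimpleGraph V}
    {B S : Finset V} (hφ : EmbedsOff H φ G B) (hSB : S ⊆ B) (hS : H.conflict.IsIndepSet S) {M : ℕ}
    (hcard : (d * d + 1) * (S.card * (M + 1)) + B.card ≤ Fintype.card V)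
    {m m' : ℕ} {η : ℝ} (hη : 0 ≤ η)
    (hnext : ∀ φ' G' B', EmbedsOff H φ' G' B' → B' ⊆ B → 2 * (B' ∩ S).card ≤ S.card →
      optFail P m' G' ≤ η) :
    optFail P (2 * d * m + m') G ≤ 2 ^ S.card *
      (1 - (1 - Real.exp (-(m / Fintype.card V : ℝ))) ^ (2 * d)) ^ (M * ((S.card + 1) / 2)) +
        η := by
  obtain ⟨e, heB, heinj, hX⟩ := exists_candidates H hd hSB hS hcard
  set X : Set V := {x | x ∈ S ∨ ∃ h ∈ S, ∃ j < M, e h j = x} with hXdef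
  have hSX : ∀ h ∈ S, h ∈ X := fun h hh => Or.inl hh
  have heX : ∀ h ∈ S, ∀ j < M, e h j ∈ X := fun h hh j hj => Or.inr ⟨h, hh, j, hj, rfl⟩
  -- A list of the neighbours of `u`, continued by `u` itself. The padding keeps `nb · j` injective
  -- on `X`, since members of `X` are not adjacent, and only creates superfluous requests.
  obtain ⟨nb, hnb1, hnb2⟩ : ∃ nb : V → ℕ → V, (∀ u j, nb u j = u ∨ H.Adj u (nb u j)) ∧
      ∀ u v, H.Adj u v → ∃ j < d, nb u j = v := by
    refine ⟨fun u j => (H.neighborFinset u).toList.getD j u, fun u j => ?_, fun u v huv => ?_⟩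
    · by_cases hj : j < (H.neighborFinset u).toList.length
      · right
        beta_reduce
        rw [List.getD_eq_getElem _ _ hj]
        exact (H.mem_neighborFinset u _).mp (Finset.mem_toList.mp (List.getElem_mem hj))
      · left
        beta_reduce
        rw [List.getD_eq_default _ _ (not_lt.mp hj)]
    · obtain ⟨i, hi, h⟩ := exists_getD_toList ((H.mem_neighborFinset u v).mpr huv) u
      exact ⟨i, hi.trans_le (by simpa using hd u), h⟩
  have hnbinj : ∀ x ∈ X, ∀ y ∈ X, ∀ j, nb x j = nb y j → x = y := by
    intro x hx y hy j hxy
    rcases hnb1 x j with h1 | h1 <;> rcases hnb1 y j with h2 | h2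
    · rw [← h1, hxy, h2]
    · rw [← hxy, h1] at h2
      exact absurd h2 (hX.not_adj hy hx)
    · rw [hxy, h2] at h1
      exact absurd h1 (hX.not_adj hx hy)
    · rw [← hxy] at h2
      exact hX.eq_of_adj hx hy h1 h2
  -- In the first `d` windows a candidate requests the edges to the neighbours of `h`; in the last
  -- `d` its own neighbours request the edge to the place of `h`. In one window, different
  -- candidates use different vertices.
  let a : ℕ → V × ℕ → V := fun j i =>
    if j < d then φ (e i.1 i.2) else φ (nb (e i.1 i.2) (j - d))
  let b : ℕ → V × ℕ → V := fun j i => if j < d then φ (nb i.1 j) else φ i.1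
  have hmem : ∀ i ∈ S ×ˢ Finset.range M, i.1 ∈ S ∧ i.2 < M := fun i hi =>
    ⟨(Finset.mem_product.mp hi).1, Finset.mem_range.mp (Finset.mem_product.mp hi).2⟩
  have hinj : ∀ j < 2 * d, Set.InjOn (a j) (S ×ˢ Finset.range M : Finset (V × ℕ)) := by
    intro j _ i hi i' hi' heq
    obtain ⟨h1, h2⟩ := hmem i hi
    obtain ⟨h1', h2'⟩ := hmem i' hi'
    have : e i.1 i.2 = e i'.1 i'.2 := by
      by_cases hj : j < d
      · simp only [a, if_pos hj] at heq
        exact φ.injective heq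
      · simp only [a, if_neg hj] at heq
        exact hnbinj _ (heX _ h1 _ h2) _ (heX _ h1' _ h2') _ (φ.injective heq)
    obtain ⟨h3, h4⟩ := heinj _ h1 _ h1' _ h2 _ h2' this
    exact Prod.ext h3 h4
  -- If every `t`-subset of `S` contains a vertex with a surviving candidate, then fewer than `t`,
  -- hence at most half, of the members of `S` have none.
  set t := (S.card + 1) / 2 with ht
  have hfinal : ∀ G', G ≤ G' → ∀ A' ⊆ S ×ˢ Finset.range M,
      (∀ i ∈ A', ∀ j < 2 * d, a j i ≠ b j i → G'.Adj (a j i) (b j i)) →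
      (∀ k ∈ S.powersetCard t, (A' ∩ (k ×ˢ Finset.range M)).Nonempty) → optFail P m' G' ≤ η := by
    intro G' hG' A' hA' hreq hT
    set R := S.filter fun h => ∃ l < M, (h, l) ∈ A' with hR
    have hRS : R ⊆ S := Finset.filter_subset _ _
    have hex : ∀ h ∈ R, ∃ l < M, (h, l) ∈ A' := fun h hh => (Finset.mem_filter.mp hh).2
    choose! l hl hlA using hex
    have hlt : (S \ R).card < t := by
      by_contra! hle
      obtain ⟨F, hF, hFc⟩ := Finset.exists_subset_card_eq hle
      obtain ⟨i, hi⟩ := hT F (Finset.mem_powersetCard.mpr ⟨hF.trans Finset.sdiff_subset, hFc⟩)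
      obtain ⟨hiA, hiF⟩ := Finset.mem_inter.mp hi
      obtain ⟨h1, h2⟩ := Finset.mem_sdiff.mp (hF (Finset.mem_product.mp hiF).1)
      exact h2 (Finset.mem_filter.mpr ⟨h1, i.2, (hmem i (hA' hiA)).2, hiA⟩)
    have e1 : ∀ h ∈ R, ∀ u, H.Adj h u → G'.Adj (φ u) (φ (e h (l h))) := by
      intro h hh u hu
      obtain ⟨j, hj, rfl⟩ := hnb2 h u hu
      have := hreq (h, l h) (hlA h hh) j (by omega)
      simp only [a, b, if_pos hj] at this
      refine (this (φ.injective.ne ?_)).symm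
      intro heq
      exact hX.not_adj (hSX h (hRS hh)) (heX h (hRS hh) _ (hl h hh)) (heq ▸ hu)
    have e2 : ∀ h ∈ R, ∀ u, H.Adj (e h (l h)) u → G'.Adj (φ u) (φ h) := by
      intro h hh u hu
      obtain ⟨j, hj, rfl⟩ := hnb2 _ u hu
      have := hreq (h, l h) (hlA h hh) (d + j) (by omega)
      simp only [a, b, if_neg (show ¬ d + j < d by omega), Nat.add_sub_cancel_left] at this
      refine this (φ.injective.ne ?_)
      intro heq
      exact hX.not_adj (heX h (hRS hh) _ (hl h hh)) (hSX h (hRS hh)) (by rwa [heq] at hu)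
    obtain ⟨φ', hφ'⟩ := (hφ.mono_graph hG').exists_sdiff (R := R) (κ := fun h => e h (l h)) hX
      (fun h hh => hSX h (hRS hh)) (fun h hh => heX h (hRS hh) _ (hl h hh))
      (fun h hh h' hh' heq => (heinj _ (hRS hh) _ (hRS hh') _ (hl h hh) _ (hl h' hh') heq).1)
      (hRS.trans hSB) (fun h hh => heB h (hRS hh) _ (hl h hh)) e1 e2
    refine hnext φ' _ _ hφ' Finset.sdiff_subset ?_
    have hsub : (B \ R) ∩ S ⊆ S \ R := by
      intro x hx
      obtain ⟨hx1, hx2⟩ := Finset.mem_inter.mp hx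
      exact Finset.mem_sdiff.mpr ⟨hx2, (Finset.mem_sdiff.mp hx1).2⟩
    have := Finset.card_le_card hsub
    omega
  have hmain := optFail_sift_le hP a b (S.powersetCard t) (fun k => k ×ˢ Finset.range M)
    (m := m) (p := 1 - Real.exp (-(m / Fintype.card V : ℝ))) rfl (2 * d) G (S ×ˢ Finset.range M) hinj hfinal hη
  refine hmain.trans (add_le_add_left ?_ η)
  set z := 1 - (1 - Real.exp (-(m / Fintype.card V : ℝ))) ^ (2 * d) with hz
  have hz0 : 0 ≤ z := by
    rw [hz, sub_nonneg]
    refine pow_le_one₀ ?_ ?_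
    · rw [sub_nonneg, Real.exp_le_one_iff, neg_nonpos]
      positivity
    · linarith [Real.exp_pos (-(m / Fintype.card V : ℝ))]
  calc _ = ∑ k ∈ S.powersetCard t, z ^ (M * t) := by
        refine Finset.sum_congr rfl fun k hk => ?_
        obtain ⟨hkS, hkc⟩ := Finset.mem_powersetCard.mp hk
        rw [Finset.inter_eq_right.mpr (Finset.product_subset_product_left hkS),
          Finset.card_product, Finset.card_range, hkc, mul_comm]
    _ = (S.card.choose t : ℝ) * z ^ (M * t) := by
        rw [Finset.sum_const, Finset.card_powersetCard, nsmul_eq_mul]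
    _ ≤ _ := by
        gcongr
        exact_mod_cast Nat.choose_le_two_pow _ _

end RepairBySifting

/-! ### The first phase and the iterated repairs -/

section Phases

variable {V : Type*} [Fintype V] [DecidableEq V] [Nonempty V]

open scoped Classical in
/-- Repeated application of `optFail_repair_le` to the set `A ⊆ B` of active vertices: after `r`
repetitions, the uncovered vertices are those which had at least `r` conflicts in `A`, and the few
ones which failed. -/
theorem optFail_repeated_repair_le {P : SimpleGraph V → Prop} (hP : Monotone P)
    {H : SimpleGraph V} {d : ℕ} (hd : ∀ v, H.degree v ≤ d) {k b₀ : ℕ}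
    (hb₀ : (d * d + 1) * (b₀ * (2 * k + 1)) + b₀ ≤ Fintype.card V)
    {m : ℕ} {q : ℝ} (hq : 0 ≤ q)
    (hlack : ∀ A : Finset V, offerProb m (fun c => ∀ v ∈ A, c v < 2 * k) ≤ q ^ A.card)
    {N : ℕ} (hN : d * (2 * k + 1) ≤ N) (hN' : 2 * k ≤ N) {t m' : ℕ} {η ρ : ℝ} (hη : 0 ≤ η)
    (hρ : (Fintype.card V).choose t * (((N : ℝ) * q) ^ k) ^ t ≤ ρ) {a : ℕ} (r : ℕ) {f : ℕ}
    {φ : Equiv.Perm V} {G : SimpleGraph V} {A B : Finset V} (hφ : EmbedsOff H φ G B) (hAB : A ⊆ B)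
    (hB : B.card ≤ b₀)
    (hA : (A.filter fun h => r ≤ (A.filter fun h' => H.conflict.Adj h h').card).card ≤ a)
    (hf : (B \ A).card ≤ f)
    (hnext : ∀ φ' G' B', EmbedsOff H φ' G' B' → B'.card ≤ a + f + r * (2 * (t - 1)) →
      optFail P m' G' ≤ η) :
    optFail P (r * (2 * m) + m') G ≤ r * (2 * ρ) + η := by
  have hρ0 : 0 ≤ ρ := le_trans (by positivity) hρ
  induction r generalizing f φ G A B with
  | zero =>
    simp only [zero_mul, Nat.cast_zero, zero_add]
    refine hnext φ G B hφ ?_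
    have h1 := Finset.card_sdiff_add_card_eq_card hAB
    simp only [zero_le, Finset.filter_true] at hA
    omega
  | succ r ih =>
    -- By maximality every active vertex outside `S` conflicts with a member of `S`. Dropping `S`
    -- from the active set therefore lowers all their conflict counts; the members of `S` that
    -- failed are moved to the passive remainder counted by `f`.
    obtain ⟨S, -, hSA, hSI, -, hdom⟩ := H.conflict.exists_isIndepSet_card
      (fun v => H.degree_conflict_le hd v) (S := ∅) (A := A) (by simp) (by simp)
    have hScard : S.card ≤ b₀ := (Finset.card_le_card (hSA.trans hAB)).trans hB
    rw [show (r + 1) * (2 * m) + m' = m + (m + (r * (2 * m) + m')) by ring]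
    have hη' : 0 ≤ r * (2 * ρ) + η := by positivity
    refine (optFail_repair_le hP hd hφ (hSA.trans hAB) hSI (k := k) (t := t) ?_ hq hlack hN hN' hη'
      ?_).trans ?_
    · refine le_trans ?_ hb₀
      gcongr
    · intro φ' G' B' hφ' hB'B hB'S
      refine ih (A := (A \ S) ∩ B') (f := f + 2 * (t - 1)) hφ' Finset.inter_subset_right
        ((Finset.card_le_card hB'B).trans hB) (le_trans (Finset.card_le_card ?_) hA) ?_ ?_
      · intro h hh
        obtain ⟨hhA, hhr⟩ := Finset.mem_filter.mp hh
        obtain ⟨hhA', hhS⟩ := Finset.mem_sdiff.mp (Finset.mem_inter.mp hhA).1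
        obtain ⟨s, hs, hsh⟩ := hdom h hhA' hhS
        refine Finset.mem_filter.mpr ⟨hhA', ?_⟩
        have hlt : (((A \ S) ∩ B').filter fun h' => H.conflict.Adj h h').card <
            (A.filter fun h' => H.conflict.Adj h h').card := by
          refine Finset.card_lt_card ((Finset.ssubset_iff_of_subset ?_).mpr ⟨s, ?_, ?_⟩)
          · exact Finset.filter_subset_filter _
              (Finset.inter_subset_left.trans Finset.sdiff_subset)
          · exact Finset.mem_filter.mpr ⟨hSA hs, hsh.symm⟩
          · simp [hs]
        omega
      · have hsub : B' \ ((A \ S) ∩ B') ⊆ (B \ A) ∪ (B' ∩ S) := by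
          intro x hx
          simp only [Finset.mem_sdiff, Finset.mem_inter, not_and, Finset.mem_union] at hx ⊢
          by_cases hxA : x ∈ A
          · by_cases hxS : x ∈ S
            · exact Or.inr ⟨hx.1, hxS⟩
            · exact absurd hx.1 (hx.2 ⟨hxA, hxS⟩)
          · exact Or.inl ⟨hB'B hx.1, hxA⟩
        have := (Finset.card_le_card hsub).trans (Finset.card_union_le _ _)
        omega
      · intro φ'' G'' B'' hφ'' hB''
        refine hnext φ'' G'' B'' hφ'' (hB''.trans (le_of_eq ?_))
        ring
    · have hle : (S.card.choose t : ℝ) * (((N : ℝ) * q) ^ k) ^ t ≤ ρ := by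
        refine le_trans ?_ hρ
        gcongr
        exact Finset.card_le_univ S
      push_cast
      linarith

open scoped Classical in
/-- Repeated application of `optFail_sift_repair_le` until no vertex is uncovered, where `R b`
rounds are available for `b` uncovered vertices. -/
theorem optFail_repeated_sift_le {H : SimpleGraph V} {d : ℕ} (hd : ∀ v, H.degree v ≤ d)
    {R w : ℕ → ℕ} {bmax : ℕ} {η : ℝ} (hη : 0 ≤ η)
    (hR : ∀ b b', 1 ≤ b → b ≤ bmax → 2 * (d * d + 1) * b' + b ≤ 2 * (d * d + 1) * b →
      2 * d * w b + R b' ≤ R b)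
    (hM : ∀ b s, 1 ≤ b → b ≤ bmax → s ≤ b → b ≤ (d * d + 1) * s →
      ∃ M, (d * d + 1) * (s * (M + 1)) + b ≤ Fintype.card V ∧
        2 ^ s * (1 - (1 - Real.exp (-(w b / Fintype.card V : ℝ))) ^ (2 * d)) ^
          (M * ((s + 1) / 2)) ≤ η)
    (b : ℕ) (hb : b ≤ bmax) {φ : Equiv.Perm V} {G : SimpleGraph V} {B : Finset V}
    (hφ : EmbedsOff H φ G B) (hB : B.card = b) :
    optFail (fun G => H.IsContained G) (R b) G ≤ b * η := by
  have hP : Monotone fun G : SimpleGraph V => H.IsContained G := fun G G' h hG =>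
    SimpleGraph.IsContained.trans hG (SimpleGraph.IsContained.of_le h)
  induction b using Nat.strong_induction_on generalizing φ G B with
  | _ b ih =>
    rcases Nat.eq_zero_or_pos b with rfl | hpos
    · rw [Finset.card_eq_zero] at hB
      subst hB
      rw [optFail_eq_zero hφ.isContained]
      simp
    · obtain ⟨S, -, hSB, hSI, hSc, -⟩ := H.conflict.exists_isIndepSet_card
        (fun v => H.degree_conflict_le hd v) (S := ∅) (A := B) (by simp) (by simp)
      rw [hB] at hSc
      have hSb : S.card ≤ b := hB ▸ Finset.card_le_card hSB
      obtain ⟨M, hM1, hM2⟩ := hM b S.card hpos hb hSb hSc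
      have hbig : 2 * d * w b + (R b - 2 * d * w b) = R b := by
        have := hR b 0 hpos hb (by nlinarith)
        omega
      rw [← hbig]
      have hη' : 0 ≤ ((b : ℝ) - 1) * η := by
        have : (1 : ℝ) ≤ b := by exact_mod_cast hpos
        exact mul_nonneg (by linarith) hη
      refine (optFail_sift_repair_le hP hd hφ hSB hSI (M := M) (by rwa [hB]) hη' ?_).trans ?_
      · intro φ' G' B' hφ' hB'B hB'S
        have hsub : B' ⊆ (B \ S) ∪ (B' ∩ S) := by
          intro x hx
          by_cases hxS : x ∈ S
          · exact Finset.mem_union_right _ (Finset.mem_inter.mpr ⟨hx, hxS⟩)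
          · exact Finset.mem_union_left _ (Finset.mem_sdiff.mpr ⟨hB'B hx, hxS⟩)
        have h1 := (Finset.card_le_card hsub).trans (Finset.card_union_le _ _)
        have h2 := Finset.card_sdiff_add_card_eq_card hSB
        have h3 : 2 * B'.card + S.card ≤ 2 * b := by omega
        -- At least half of `S` is repaired and `S` has at least `b / (d * d + 1)` members, so `b`
        -- shrinks by the factor `1 - 1 / (2 * (d * d + 1))`.
        have h4 : 2 * (d * d + 1) * B'.card + b ≤ 2 * (d * d + 1) * b := by nlinarith
        have h5 : 1 ≤ S.card := by
          by_contra! h0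
          have : S.card = 0 := by omega
          rw [this] at hSc
          omega
        have h6 : B'.card < b := by omega
        have h7 := hR b B'.card hpos hb h4
        calc _ ≤ optFail _ (R B'.card) G' := optFail_anti_rounds _ G' (by omega)
          _ ≤ B'.card * η := ih B'.card h6 (h6.le.trans hb) hφ' rfl
          _ ≤ _ := by
              gcongr
              have : (B'.card : ℝ) + 1 ≤ b := by exact_mod_cast h6
              linarith
      · linarith

open scoped Classical in
/-- The first phase: all edges of `H` are distributed among their endpoints, and the vertices which
are not offered often enough remain uncovered. -/
theorem optFail_first_phase_le {P : SimpleGraph V → Prop} (hP : Monotone P)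
    {H : SimpleGraph V} {d : ℕ} (hd : ∀ v, H.degree v ≤ d) {m : ℕ} {q : ℝ} (hq : 0 ≤ q)
    (hlack : ∀ A : Finset V, offerProb m (fun c => ∀ v ∈ A, c v < (d + 1) / 2) ≤ q ^ A.card)
    {t₀ t L m' : ℕ} (ht₀ : 1 ≤ t₀) (ht : 1 ≤ t) {η : ℝ} (hη : 0 ≤ η)
    (hnext : ∀ φ G B, EmbedsOff H φ G B → B.card ≤ t₀ - 1 →
      (B.filter fun h => L ≤ (B.filter fun h' => H.conflict.Adj h h').card).card ≤
        (d * d * (d * d) + 1) * (t - 1) → optFail P m' G ≤ η) :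
    optFail P (m + m') ⊥ ≤ (Fintype.card V).choose t₀ * q ^ t₀ +
      (Fintype.card V).choose t * ((((d * d + 1 : ℕ) : ℝ) * q) ^ L) ^ t + η := by
  obtain ⟨todo, htodo⟩ := H.exists_todo hd
  have hd' : ∀ v, H.conflict.degree v ≤ d * d := H.degree_conflict_le hd
  let D : V → Finset V := fun h => insert h (H.conflict.neighborFinset h)
  have hD : ∀ h ∈ (Finset.univ : Finset V), (D h).card ≤ d * d + 1 := fun h _ =>
    (Finset.card_insert_le _ _).trans (by simpa using hd' h)
  -- Singletons with `k = 1` bound the number of uncovered vertices; closed conflict neighbourhoods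
  -- bound the number of vertices with at least `L` lacking vertices nearby.
  have h1 := offerProb_many_lacking_le hq hlack Finset.univ (fun h : V => ({h} : Finset V))
    (N := 1) (by simp) 1 t₀
  have h2 := offerProb_many_lacking_le hq hlack Finset.univ D hD L t
  rw [Nat.cast_one, one_mul, pow_one, Finset.card_univ] at h1
  rw [Finset.card_univ] at h2
  refine (optFail_add_le hP todo hη (fun c hc => ?_)).trans
    (add_le_add_left ((offerProb_or_le _ _ m).trans (add_le_add h1 h2)) η)
  rw [not_or] at hc
  obtain ⟨hc1, hc2⟩ := hc
  set B : Finset V := Finset.univ.filter fun v => c v < (d + 1) / 2 with hB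
  refine hnext 1 _ B ?_ ?_ ?_
  · intro a b hab ha hb
    have ha' : (d + 1) / 2 ≤ c a := by simpa [hB] using ha
    have hb' : (d + 1) / 2 ≤ c b := by simpa [hB] using hb
    rw [bot_sup_eq, claimed_adj]
    refine ⟨hab.ne, ?_⟩
    rcases htodo a b hab with ⟨k, hk, h⟩ | ⟨k, hk, h⟩
    · exact Or.inl ⟨k, hk.trans_le ha', h⟩
    · exact Or.inr ⟨k, hk.trans_le hb', h⟩
  · have hlt : B.card < t₀ := by
      by_contra! hle
      obtain ⟨T, hT, hTc⟩ := Finset.exists_subset_card_eq hle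
      refine hc1 ⟨T, Finset.subset_univ _, hTc, ?_, ?_⟩
      · intro a _ b _ hab
        exact Finset.disjoint_singleton.mpr hab
      · intro h hh
        have := (Finset.mem_filter.mp (hT hh)).2
        simp [Finset.filter_singleton, this]
    omega
  · set A' := Finset.univ.filter fun h => L ≤ ((D h).filter fun v => c v < (d + 1) / 2).card
      with hA'
    -- Closed conflict neighbourhoods are disjoint for vertices at distance more than two in the
    -- conflict graph. Hence the second application of `conflict`, and the factor `d ^ 4 + 1`.
    obtain ⟨T, -, hTA, hTI, hTc, -⟩ := H.conflict.conflict.exists_isIndepSet_card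
      (fun v => H.conflict.degree_conflict_le hd' v) (S := ∅) (A := A') (by simp) (by simp)
    have hTt : T.card < t := by
      by_contra! hle
      obtain ⟨T', hT', hT'c⟩ := Finset.exists_subset_card_eq hle
      refine hc2 ⟨T', Finset.subset_univ _, hT'c, ?_, fun h hh =>
        (Finset.mem_filter.mp (hTA (hT' hh))).2⟩
      intro h hh h' hh' hne
      have hh := hT' hh
      have hh' := hT' hh'
      refine Finset.disjoint_left.mpr fun x hx hx' => hne ?_
      rcases Finset.mem_insert.mp hx with rfl | hx <;> rcases Finset.mem_insert.mp hx' with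
        hx' | hx'
      · exact hx'
      · exact absurd ((SimpleGraph.mem_neighborFinset _ _ _).mp hx') (hTI.not_adj hh' hh)
      · exact absurd ((SimpleGraph.mem_neighborFinset _ _ _).mp hx) (hx' ▸ hTI.not_adj hh hh')
      · exact hTI.eq_of_adj hh hh' ((SimpleGraph.mem_neighborFinset _ _ _).mp hx)
          ((SimpleGraph.mem_neighborFinset _ _ _).mp hx')
    have hsub : (B.filter fun h => L ≤ (B.filter fun h' => H.conflict.Adj h h').card) ⊆ A' := by
      intro h hh
      obtain ⟨hhB, hhL⟩ := Finset.mem_filter.mp hh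
      refine Finset.mem_filter.mpr ⟨Finset.mem_univ _, hhL.trans (Finset.card_le_card ?_)⟩
      intro x hx
      obtain ⟨hxB, hxh⟩ := Finset.mem_filter.mp hx
      exact Finset.mem_filter.mpr ⟨Finset.mem_insert_of_mem
        ((SimpleGraph.mem_neighborFinset _ _ _).mpr hxh), (Finset.mem_filter.mp hxB).2⟩
    calc _ ≤ A'.card := Finset.card_le_card hsub
      _ ≤ (d * d * (d * d) + 1) * T.card := hTc
      _ ≤ _ := Nat.mul_le_mul_left _ (by omega)

end Phases

/-! ### The three phases together -/

section Combination

open scoped Classical in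
/-- The failure probability of the three phases together. -/
theorem optFail_isContained_le {V : Type*} [Fintype V] [DecidableEq V] [Nonempty V]
    {H : SimpleGraph V} {d : ℕ} (hd : ∀ v, H.degree v ≤ d) {m₀ m₁ k L N t₀ t bmax : ℕ}
    {q₀ q₁ : ℝ}
    (hq₀ : 0 ≤ q₀) (hq₁ : 0 ≤ q₁)
    (hlack₀ : ∀ A : Finset V, offerProb m₀ (fun c => ∀ v ∈ A, c v < (d + 1) / 2) ≤ q₀ ^ A.card)
    (hlack₁ : ∀ A : Finset V, offerProb m₁ (fun c => ∀ v ∈ A, c v < 2 * k) ≤ q₁ ^ A.card)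
    (ht₀ : 1 ≤ t₀) (ht : 1 ≤ t)
    (hb₀ : (d * d + 1) * ((t₀ - 1) * (2 * k + 1)) + (t₀ - 1) ≤ Fintype.card V)
    (hN : d * (2 * k + 1) ≤ N) (hN' : 2 * k ≤ N)
    (hbmax : (d * d * (d * d) + 1) * (t - 1) + L * (2 * (t - 1)) ≤ bmax) {ρ η : ℝ}
    (hρ₀ : (Fintype.card V).choose t₀ * q₀ ^ t₀ ≤ ρ)
    (hρL : (Fintype.card V).choose t * ((((d * d + 1 : ℕ) : ℝ) * q₀) ^ L) ^ t ≤ ρ)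
    (hρk : (Fintype.card V).choose t * (((N : ℝ) * q₁) ^ k) ^ t ≤ ρ) (hη : 0 ≤ η)
    {R w : ℕ → ℕ} (hRmono : Monotone R)
    (hR : ∀ b b', 1 ≤ b → b ≤ bmax → 2 * (d * d + 1) * b' + b ≤ 2 * (d * d + 1) * b →
      2 * d * w b + R b' ≤ R b)
    (hM : ∀ b s, 1 ≤ b → b ≤ bmax → s ≤ b → b ≤ (d * d + 1) * s →
      ∃ M, (d * d + 1) * (s * (M + 1)) + b ≤ Fintype.card V ∧
        2 ^ s * (1 - (1 - Real.exp (-(w b / Fintype.card V : ℝ))) ^ (2 * d)) ^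
          (M * ((s + 1) / 2)) ≤ η) :
    optFail (fun G : SimpleGraph V => H.IsContained G) (m₀ + (L * (2 * m₁) + R bmax)) ⊥ ≤
      2 * ρ + L * (2 * ρ) + bmax * η := by
  have hP : Monotone fun G : SimpleGraph V => H.IsContained G := fun G G' h hG =>
    SimpleGraph.IsContained.trans hG (SimpleGraph.IsContained.of_le h)
  have hρ0 : 0 ≤ ρ := le_trans (by positivity) hρ₀
  have hbη : 0 ≤ bmax * η := by positivity
  refine (optFail_first_phase_le hP hd hq₀ hlack₀ (L := L) ht₀ ht
    (η := L * (2 * ρ) + bmax * η) (by positivity) ?_).trans (by linarith)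
  intro φ G B hφ hB hBL
  refine optFail_repeated_repair_le hP hd hb₀ hq₁ hlack₁ hN hN' hbη hρk L (f := 0) hφ
    (Finset.Subset.refl B) hB hBL (by simp) ?_
  intro φ' G' B' hφ' hB'
  have hle : B'.card ≤ bmax := by omega
  calc _ ≤ optFail _ (R B'.card) G' := optFail_anti_rounds _ G' (hRmono hle)
    _ ≤ B'.card * η := optFail_repeated_sift_le hd hη hR hM _ hle hφ' rfl
    _ ≤ _ := by gcongr

end Combination

/-! ### Binomial thresholds and the cost of sifting -/

section Estimates

theorem choose_mul_pow_le {n t : ℕ} (ht : 1 ≤ t) {ρ : ℝ} (hρ : 0 ≤ ρ) :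
    (n.choose t : ℝ) * ρ ^ t ≤ (n * Real.exp 1 * ρ / t) ^ t := by
  have ht0 : (0 : ℝ) < t := by exact_mod_cast ht
  have h1 : (n.choose t : ℝ) ≤ (n : ℝ) ^ t / t.factorial := Nat.choose_le_pow_div t n
  have h2 : (t : ℝ) ^ t / t.factorial ≤ Real.exp 1 ^ t := by
    rw [← Real.exp_nat_mul, mul_one]
    exact Real.pow_div_factorial_le_exp (t : ℝ) ht0.le t
  have hf : (0 : ℝ) < t.factorial := by exact_mod_cast t.factorial_pos
  have h3 : 1 / (t.factorial : ℝ) ≤ Real.exp 1 ^ t / (t : ℝ) ^ t := by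
    rw [div_le_div_iff₀ hf (by positivity), one_mul]
    rwa [div_le_iff₀ hf] at h2
  calc (n.choose t : ℝ) * ρ ^ t ≤ (n : ℝ) ^ t * (1 / t.factorial) * ρ ^ t := by
        gcongr
        rwa [mul_one_div]
    _ ≤ (n : ℝ) ^ t * (Real.exp 1 ^ t / (t : ℝ) ^ t) * ρ ^ t := by gcongr
    _ = _ := by
        rw [div_pow, mul_pow, mul_pow]
        ring

/-- A size `t` such that no random set of size at least `t` appears, when each set of `t`
vertices appears with probability at most `ρ ^ t`. -/
theorem exists_threshold {n : ℕ} (hn : 6 * Real.log n ≤ Real.sqrt n) (hn1 : 1 ≤ n) {δ ρ : ℝ}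
    (hδ : 0 < δ) (hδ1 : δ ≤ Real.exp (-1)) (hρ : 0 ≤ ρ) (hρδ : ρ ≤ δ ^ 8) :
    ∃ t : ℕ, 1 ≤ t ∧ (n.choose t : ℝ) * ρ ^ t ≤ 1 / (n : ℝ) ^ 3 ∧ ((t - 1 : ℕ) : ℝ) ≤ δ * n ∧
      (t = 1 ∨ 1 ≤ δ ^ 2 * n) := by
  have hn0 : (0 : ℝ) < n := by exact_mod_cast hn1
  -- If `n < δ⁻²`, even a single vertex is unlikely, so `t = 1` and nothing remains. Otherwise `t =
  -- ⌈δ * n⌉₊` is at least `√n`, which makes `exp (-t)` smaller than `n ^ (-3)`. The final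
  -- alternative records this for the sifting phase, which needs `n` large.
  rcases lt_or_ge (δ ^ 2 * n) 1 with h | h
  · refine ⟨1, le_rfl, ?_, by simp; positivity, Or.inl rfl⟩
    rw [Nat.choose_one_right, pow_one, le_div_iff₀ (by positivity)]
    calc (n : ℝ) * ρ * n ^ 3 ≤ n * δ ^ 8 * n ^ 3 := by gcongr
      _ = (δ ^ 2 * n) ^ 4 := by ring
      _ ≤ 1 := pow_le_one₀ (by positivity) h.le
  · have hpos : 0 < δ * n := by positivity
    refine ⟨⌈δ * n⌉₊, Nat.one_le_ceil_iff.mpr hpos, ?_, ?_, Or.inr h⟩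
    · set t := ⌈δ * n⌉₊ with ht
      have hle : δ * n ≤ t := Nat.le_ceil _
      have ht0 : (0 : ℝ) < t := hpos.trans_le hle
      refine (choose_mul_pow_le (Nat.one_le_ceil_iff.mpr hpos) hρ).trans ?_
      have hexp : Real.exp (-1) ≤ 1 := Real.exp_le_one_iff.mpr (by norm_num)
      have hbase : n * Real.exp 1 * ρ / t ≤ Real.exp (-1) := by
        rw [div_le_iff₀ ht0]
        have h7 : δ ^ 7 ≤ Real.exp (-1) ^ 7 := by gcongr
        calc n * Real.exp 1 * ρ ≤ n * Real.exp 1 * δ ^ 8 := by gcongr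
          _ = (Real.exp 1 * δ ^ 7) * (δ * n) := by ring
          _ ≤ Real.exp (-1) * (δ * n) := by
              gcongr
              calc Real.exp 1 * δ ^ 7 ≤ Real.exp 1 * Real.exp (-1) ^ 7 := by gcongr
                _ = Real.exp (-6) := by
                  rw [← Real.exp_nat_mul, ← Real.exp_add]; norm_num
                _ ≤ _ := Real.exp_le_exp.mpr (by norm_num)
          _ ≤ Real.exp (-1) * t := by gcongr
      have hsqrt : Real.sqrt n ≤ t := by
        refine le_trans ?_ hle
        rw [Real.sqrt_le_left hpos.le]
        nlinarith
      calc _ ≤ Real.exp (-1) ^ t := by gcongr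
        _ = Real.exp (-t) := by rw [← Real.exp_nat_mul]; ring_nf
        _ ≤ Real.exp (-(3 * Real.log n)) := by
            refine Real.exp_le_exp.mpr ?_
            have : 0 ≤ Real.log n := Real.log_nonneg (by exact_mod_cast hn1)
            linarith
        _ = _ := by
            rw [Real.exp_neg, one_div]
            congr 1
            rw [show (3 : ℝ) * Real.log n = ((3 : ℕ) : ℝ) * Real.log n by norm_num,
              Real.exp_nat_mul, Real.exp_log hn0]
    · have := Nat.ceil_lt_add_one hpos.le
      rw [Nat.cast_sub (Nat.one_le_ceil_iff.mpr hpos)]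
      push_cast
      linarith

/-- The recursion for the number of rounds used by `optFail_repeated_sift_le`. -/
theorem sift_rounds_le {n d b b' : ℕ} (hn : 1 ≤ n) (hd : 1 ≤ d)
    (h : 2 * (d * d + 1) * b' + b ≤ 2 * (d * d + 1) * b) :
    2 * d * ⌊(n : ℝ) * ((b : ℝ) / n) ^ (1 / (8 * d) : ℝ)⌋₊ +
      ⌊(32 * d ^ 2 * (d ^ 2 + 1) * n : ℝ) * ((b' : ℝ) / n) ^ (1 / (8 * d) : ℝ)⌋₊ ≤
      ⌊(32 * d ^ 2 * (d ^ 2 + 1) * n : ℝ) * ((b : ℝ) / n) ^ (1 / (8 * d) : ℝ)⌋₊ := by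
  have hn0 : (0 : ℝ) < n := by exact_mod_cast hn
  have hd0 : (0 : ℝ) < d := by exact_mod_cast hd
  set a : ℝ := 1 / (8 * d) with ha
  have ha0 : 0 < a := by positivity
  have ha1 : a ≤ 1 := by
    rw [ha, div_le_one (by positivity)]
    have : (1 : ℝ) ≤ d := by exact_mod_cast hd
    linarith
  set c : ℝ := 1 / (2 * (d ^ 2 + 1)) with hc
  have hc0 : 0 < c := by positivity
  have hc1 : c ≤ 1 := by
    rw [hc, div_le_one (by positivity)]
    nlinarith [sq_nonneg (d : ℝ)]
  have hb' : (b' : ℝ) ≤ (1 - c) * b := by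
    have h' : (2 * (d * d + 1) * b' + b : ℝ) ≤ 2 * (d * d + 1) * b := by exact_mod_cast h
    have : (b' : ℝ) + c * b ≤ b := by
      rw [hc]
      have h2 : (0 : ℝ) < 2 * (d ^ 2 + 1) := by positivity
      rw [one_div, ← sub_nonneg]
      have : (b : ℝ) - (b' + (2 * ((d : ℝ) ^ 2 + 1))⁻¹ * b) =
        (2 * ((d : ℝ) ^ 2 + 1))⁻¹ * (2 * (d * d + 1) * b - (2 * (d * d + 1) * b' + b)) := by
        field_simp
      rw [this]
      exact mul_nonneg (by positivity) (by linarith)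
    linarith
  set x : ℝ := ((b : ℝ) / n) ^ a with hx
  have hx0 : 0 ≤ x := by positivity
  have hy : ((b' : ℝ) / n) ^ a ≤ (1 - a * c) * x := by
    calc ((b' : ℝ) / n) ^ a ≤ ((1 - c) * ((b : ℝ) / n)) ^ a := by
          gcongr
          rw [← mul_div_assoc]
          gcongr
      _ = (1 - c) ^ a * x := by rw [Real.mul_rpow (by linarith) (by positivity)]
      _ ≤ _ := by
          gcongr
          have := rpow_one_add_le_one_add_mul_self (s := -c) (by linarith) ha0.le ha1
          rw [← sub_eq_add_neg] at this
          linarith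
  refine Nat.le_floor ?_
  push_cast
  have hf1 : (⌊(n : ℝ) * x⌋₊ : ℝ) ≤ n * x := Nat.floor_le (by positivity)
  have hf2 : (⌊(32 * d ^ 2 * (d ^ 2 + 1) * n : ℝ) * ((b' : ℝ) / n) ^ a⌋₊ : ℝ) ≤
      (32 * d ^ 2 * (d ^ 2 + 1) * n : ℝ) * ((b' : ℝ) / n) ^ a := Nat.floor_le (by positivity)
  -- Bernoulli's inequality turns the shrinking factor `1 - c` into `1 - a * c`, and the constant is
  -- chosen so that `32 * d ^ 2 * (d ^ 2 + 1) * (a * c) = 2 * d`, paying exactly for the `2 * d`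
  -- windows.
  have hkey : (32 * d ^ 2 * (d ^ 2 + 1) * n : ℝ) * ((1 - a * c) * x) =
      32 * d ^ 2 * (d ^ 2 + 1) * n * x - 2 * d * (n * x) := by
    rw [ha, hc]
    field_simp
    ring
  calc (2 * d * (⌊(n : ℝ) * x⌋₊ : ℝ)) +
        (⌊(32 * d ^ 2 * (d ^ 2 + 1) * n : ℝ) * ((b' : ℝ) / n) ^ a⌋₊ : ℝ)
      ≤ 2 * d * (n * x) + (32 * d ^ 2 * (d ^ 2 + 1) * n : ℝ) * ((1 - a * c) * x) := by
        gcongr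
        exact hf2.trans (by gcongr)
    _ = _ := by rw [hkey]; ring

/-- Rounding down costs at most a factor 2 since `n * x ≥ 2`, and `1 - exp (-y) ≥ y / 2` on `[0, 1]`
costs another. -/
theorem offered_prob_ge {n : ℕ} (hn0 : (0 : ℝ) < n) {x : ℝ} (hx1 : x ≤ 1) (h2 : 2 ≤ (n : ℝ) * x) :
    x / 4 ≤ 1 - Real.exp (-((⌊(n : ℝ) * x⌋₊ : ℝ) / n)) := by
  set y : ℝ := (⌊(n : ℝ) * x⌋₊ : ℝ) / n with hy
  have hx0 : 0 < x := by
    by_contra! h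
    nlinarith
  have hyx : y ≤ x := by
    rw [hy, div_le_iff₀ hn0]
    exact (Nat.floor_le (by positivity)).trans (le_of_eq (mul_comm _ _))
  have hxy : x / 2 ≤ y := by
    rw [hy, le_div_iff₀ hn0]
    have h1 : (n : ℝ) * x < ⌊(n : ℝ) * x⌋₊ + 1 := Nat.lt_floor_add_one _
    linarith
  have hy1 : y ≤ 1 := hyx.trans hx1
  have hy0 : 0 < y := lt_of_lt_of_le (by linarith) hxy
  have h1 := Real.add_one_le_exp y
  rw [Real.exp_neg]
  have h3 : (Real.exp y)⁻¹ ≤ (y + 1)⁻¹ := inv_anti₀ (by linarith) h1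
  have h4 : (y + 1)⁻¹ ≤ 1 - y / 2 := by
    rw [inv_le_iff_one_le_mul₀ (by linarith)]
    nlinarith
  linarith

/-- The failure probability in one step of `optFail_repeated_sift_le`. -/
theorem sift_fail_le {n d b s : ℕ} (hd : 1 ≤ d) (hb : 1 ≤ b) (hsb : s ≤ b)
    (hbs : b ≤ (d * d + 1) * s) (hn : 6 * Real.log n ≤ Real.sqrt n) {E : ℝ}
    (hE : E = 32 * (d ^ 2 + 1) * 16 ^ d) (hbE : (b : ℝ) * E ^ 4 ≤ n) (hnE : E ^ 8 ≤ n) :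
    ∃ M, (d * d + 1) * (s * (M + 1)) + b ≤ n ∧
      2 ^ s * (1 - (1 - Real.exp (-(⌊(n : ℝ) * ((b : ℝ) / n) ^ (1 / (8 * d) : ℝ)⌋₊ / n : ℝ))) ^
        (2 * d)) ^ (M * ((s + 1) / 2)) ≤ 1 / (n : ℝ) ^ 3 := by
  have hd0 : (0 : ℝ) < d := by exact_mod_cast hd
  have hd1 : (1 : ℝ) ≤ d := by exact_mod_cast hd
  have hb1 : (1 : ℝ) ≤ b := by exact_mod_cast hb
  have hE64 : 64 ≤ E := by
    have h1 : (1 : ℝ) ≤ 16 ^ d := one_le_pow₀ (by norm_num)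
    rw [hE]
    nlinarith [sq_nonneg ((d : ℝ) - 1)]
  have hE0 : 0 < E := by linarith
  have hDE : 32 * ((d : ℝ) ^ 2 + 1) ≤ E := by
    have h1 : (1 : ℝ) ≤ 16 ^ d := one_le_pow₀ (by norm_num)
    rw [hE]
    exact le_mul_of_one_le_right (by positivity) h1
  have hn0 : (0 : ℝ) < n := lt_of_lt_of_le (by positivity) hnE
  have hs1 : 1 ≤ s := by
    by_contra! h0
    have : s = 0 := by omega
    subst this
    omega
  have hs1' : (1 : ℝ) ≤ s := by exact_mod_cast hs1
  have hsb' : (s : ℝ) ≤ b := by exact_mod_cast hsb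
  -- `u ^ 4 = b / n`
  set a : ℝ := 1 / (8 * d) with ha
  have ha0 : 0 < a := by positivity
  have ha1 : a ≤ 1 / 8 := by
    rw [ha]
    gcongr
    linarith
  set x : ℝ := ((b : ℝ) / n) ^ a with hx
  have hbn0 : 0 < (b : ℝ) / n := by positivity
  have hbE1 : (b : ℝ) / n ≤ 1 / E ^ 4 := by
    rw [div_le_div_iff₀ hn0 (by positivity)]
    linarith
  have hE41 : 1 / E ^ 4 ≤ 1 := by
    rw [div_le_one (by positivity)]
    exact one_le_pow₀ (by linarith)
  have hx0 : 0 < x := Real.rpow_pos_of_pos hbn0 a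
  have hx1 : x ≤ 1 := Real.rpow_le_one hbn0.le (hbE1.trans hE41) ha0.le
  set u : ℝ := ((b : ℝ) / n) ^ (1 / 4 : ℝ) with hu
  have hu0 : 0 < u := Real.rpow_pos_of_pos hbn0 _
  have hu4 : u ^ 4 = b / n := by
    rw [hu, ← Real.rpow_natCast, ← Real.rpow_mul hbn0.le]
    norm_num
  have hxu : x ^ (2 * d) = u := by
    rw [hx, hu, ← Real.rpow_natCast, ← Real.rpow_mul hbn0.le, ha]
    congr 1
    push_cast
    field_simp
    norm_num
  have huE : u * E ≤ 1 := by
    have : (u * E) ^ 4 ≤ 1 ^ 4 := by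
      rw [mul_pow, hu4, one_pow]
      rwa [le_div_iff₀ (by positivity)] at hbE1
    exact le_of_pow_le_pow_left₀ (by norm_num) (by norm_num) this
  have hux : u ≤ x := by
    rw [hu, hx]
    exact Real.rpow_le_rpow_of_exponent_ge hbn0 (hbE1.trans hE41) (by linarith)
  -- `v ^ 8 = n`
  set v : ℝ := (n : ℝ) ^ (1 / 8 : ℝ) with hv
  have hv0 : 0 < v := Real.rpow_pos_of_pos hn0 _
  have hv8 : v ^ 8 = n := by
    rw [hv, ← Real.rpow_natCast, ← Real.rpow_mul hn0.le]
    norm_num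
  have hEv : E ≤ v := by
    refine le_of_pow_le_pow_left₀ (n := 8) (by norm_num) hv0.le ?_
    rwa [hv8]
  have hv1 : 1 ≤ v := by linarith
  have huv : 1 ≤ u * v ^ 2 := by
    have : (1 : ℝ) ^ 4 ≤ (u * v ^ 2) ^ 4 := by
      rw [mul_pow, hu4, ← pow_mul, hv8, div_mul_cancel₀ _ hn0.ne', one_pow]
      exact hb1
    exact le_of_pow_le_pow_left₀ (by norm_num) (by positivity) this
  have hsqrt : Real.sqrt n = v ^ 4 := by
    rw [← hv8, show v ^ 8 = (v ^ 4) ^ 2 by ring, Real.sqrt_sq (by positivity)]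
  -- the number of candidates
  have hDs : (0 : ℝ) < 4 * (d ^ 2 + 1) * s := by positivity
  have hbn : (b : ℝ) * (32 * (d ^ 2 + 1)) ≤ n := by
    refine le_trans ?_ hbE
    gcongr
    refine hDE.trans ?_
    calc E = E ^ 1 := (pow_one E).symm
      _ ≤ E ^ 4 := pow_le_pow_right₀ (by linarith) (by norm_num)
  have hsn : (s : ℝ) * (32 * (d ^ 2 + 1)) ≤ n := le_trans (by gcongr) hbn
  set M : ℕ := ⌊(n : ℝ) / (4 * (d ^ 2 + 1) * s)⌋₊ with hM
  have hMle : (M : ℝ) * (4 * (d ^ 2 + 1) * s) ≤ n := by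
    rw [← le_div_iff₀ hDs]
    exact Nat.floor_le (by positivity)
  have hMge : (n : ℝ) ≤ M * (8 * (d ^ 2 + 1) * s) := by
    have h1 : (n : ℝ) / (4 * (d ^ 2 + 1) * s) < M + 1 := Nat.lt_floor_add_one _
    rw [div_lt_iff₀ hDs] at h1
    have h2 : (M : ℝ) * (8 * (d ^ 2 + 1) * s) = 2 * (M * (4 * (d ^ 2 + 1) * s)) := by ring
    have h3 : ((M : ℝ) + 1) * (4 * (d ^ 2 + 1) * s) = M * (4 * (d ^ 2 + 1) * s) +
      s * (32 * (d ^ 2 + 1)) / 8 := by ring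
    linarith
  refine ⟨M, ?_, ?_⟩
  · have : ((d : ℝ) * d + 1) * (s * (M + 1)) + b ≤ n := by
      have h1 : ((d : ℝ) * d + 1) * (s * (M + 1)) = M * (4 * (d ^ 2 + 1) * s) / 4 +
        s * (32 * (d ^ 2 + 1)) / 32 := by ring
      have h2 : (b : ℝ) * 32 ≤ b * (32 * (d ^ 2 + 1)) := by
        gcongr
        exact le_mul_of_one_le_right (by norm_num) (by linarith [sq_nonneg (d : ℝ)])
      linarith
    exact_mod_cast this
  · have h2nx : 2 ≤ (n : ℝ) * x := by
      rw [← hv8]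
      calc (2 : ℝ) ≤ v ^ 6 := le_trans (by linarith) (le_self_pow₀ hv1 (by norm_num))
        _ ≤ v ^ 6 * (u * v ^ 2) := le_mul_of_one_le_right (by positivity) huv
        _ ≤ v ^ 6 * (x * v ^ 2) := by gcongr
        _ = _ := by ring
    have hp := offered_prob_ge hn0 hx1 h2nx
    set y : ℝ := (⌊(n : ℝ) * x⌋₊ : ℝ) / n with hy
    have hy0 : 0 ≤ y := by positivity
    set p := 1 - Real.exp (-y) with hpdef
    have hp0 : 0 ≤ p := le_trans (by linarith) hp
    have hp1 : p ≤ 1 := by rw [hpdef]; linarith [Real.exp_pos (-y)]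
    have hpow : u / 16 ^ d ≤ p ^ (2 * d) := by
      calc u / 16 ^ d = (x / 4) ^ (2 * d) := by
            rw [div_pow, hxu, pow_mul (4 : ℝ) 2 d]
            norm_num
        _ ≤ _ := by gcongr
    have hMs : (M : ℝ) * s ≤ 2 * ((M * ((s + 1) / 2) : ℕ) : ℝ) := by
      have : M * s ≤ 2 * (M * ((s + 1) / 2)) := by
        have h1 : s ≤ 2 * ((s + 1) / 2) := by omega
        calc M * s ≤ M * (2 * ((s + 1) / 2)) := Nat.mul_le_mul_left M h1
          _ = _ := by ring
      exact_mod_cast this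
    set T : ℕ := M * ((s + 1) / 2) with hT
    -- The bound for the expected number of survivors is `2 * u * n / E`, where `u ^ 4 = b / n`.
    -- Half of it pays for the factor `2 ^ s`, as `s ≤ b = u ^ 4 * n`, and half for the target `n ^
    -- (-3)`.
    have hexponent : (s : ℝ) + 3 * Real.log n ≤ p ^ (2 * d) * T := by
      have h1 : 2 * (n : ℝ) / E ≤ T / 16 ^ d := by
        rw [div_le_div_iff₀ hE0 (by positivity), hE]
        have h16 : (0 : ℝ) < 16 ^ d := by positivity
        have h2 : 2 * (n : ℝ) ≤ T * (32 * (d ^ 2 + 1)) := by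
          have h3 : (M : ℝ) * s * (16 * (d ^ 2 + 1)) ≤ 2 * T * (16 * (d ^ 2 + 1)) := by gcongr
          linarith
        calc 2 * (n : ℝ) * 16 ^ d ≤ T * (32 * (d ^ 2 + 1)) * 16 ^ d := by gcongr
          _ = _ := by ring
      have h2 : u * (2 * (n : ℝ) / E) ≤ p ^ (2 * d) * T := by
        calc u * (2 * (n : ℝ) / E) ≤ u * (T / 16 ^ d) := by gcongr
          _ = u / 16 ^ d * T := by ring
          _ ≤ _ := by gcongr
      have h3 : (s : ℝ) ≤ u * n / E := by
        refine hsb'.trans ?_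
        have : (b : ℝ) = u ^ 4 * n := by rw [hu4, div_mul_cancel₀ _ hn0.ne']
        rw [this, le_div_iff₀ hE0]
        have hu1 : u ≤ 1 := le_trans (le_mul_of_one_le_right hu0.le (by linarith)) huE
        have h31 : u ^ 3 * E ≤ 1 := by
          calc u ^ 3 * E = u ^ 2 * (u * E) := by ring
            _ ≤ 1 * 1 := by
              gcongr
              exact pow_le_one₀ hu0.le hu1
            _ = 1 := one_mul 1
        calc u ^ 4 * n * E = (u ^ 3 * E) * (u * n) := by ring
          _ ≤ 1 * (u * n) := by gcongr
          _ = _ := one_mul _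
      have h4 : 3 * Real.log n ≤ u * n / E := by
        have h5 : 3 * Real.log n ≤ v ^ 4 := by
          rw [← hsqrt]
          have : 0 ≤ Real.sqrt n := Real.sqrt_nonneg _
          linarith
        refine h5.trans ?_
        rw [le_div_iff₀ hE0, ← hv8]
        calc v ^ 4 * E ≤ v ^ 4 * v := by gcongr
          _ = v ^ 5 := by ring
          _ ≤ v ^ 6 := pow_le_pow_right₀ hv1 (by norm_num)
          _ ≤ v ^ 6 * (u * v ^ 2) := le_mul_of_one_le_right (by positivity) huv
          _ = _ := by ring
      have h6 : u * (2 * (n : ℝ) / E) = u * n / E + u * n / E := by ring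
      linarith
    have h2s : (2 : ℝ) ^ s ≤ Real.exp s := by
      rw [show (s : ℝ) = s * 1 by ring, Real.exp_nat_mul]
      gcongr
      linarith [Real.add_one_le_exp (1 : ℝ)]
    have hle : 1 - p ^ (2 * d) ≤ Real.exp (-p ^ (2 * d)) := by
      linarith [Real.add_one_le_exp (-p ^ (2 * d))]
    have hpos : 0 ≤ 1 - p ^ (2 * d) := sub_nonneg.mpr (pow_le_one₀ hp0 hp1)
    calc (2 : ℝ) ^ s * (1 - p ^ (2 * d)) ^ T ≤ Real.exp s * Real.exp (-p ^ (2 * d)) ^ T := by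
          gcongr
      _ = Real.exp (s - p ^ (2 * d) * T) := by
          rw [← Real.exp_nat_mul, ← Real.exp_add]
          ring_nf
      _ ≤ Real.exp (-(3 * Real.log n)) := Real.exp_le_exp.mpr (by linarith)
      _ = _ := by
          rw [Real.exp_neg, one_div]
          congr 1
          rw [show (3 : ℝ) * Real.log n = ((3 : ℕ) : ℝ) * Real.log n by norm_num,
            Real.exp_nat_mul, Real.exp_log hn0]

end Estimates

/-! ### Choice of parameters -/

section Parameters

/-- With `x = ε / 8` the exponent is at most `-ε ^ 2 * d / 64 + ε / 8`; the last term, due to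
rounding, is absorbed by half of the first since `ε * d ≥ 16`. -/
theorem lacking_first_phase_le {ε : ℝ} (hε : 0 < ε) (hε1 : ε ≤ 1) {n d b : ℕ} (hn : 1 ≤ n)
    (hd : 16 / ε ≤ d) (hb : 2 * b ≤ d) :
    (1 - ε / 8)⁻¹ ^ b * Real.exp (-((⌊(1 + ε / 2) * (d * n / 2)⌋₊ : ℝ) / n * (1 - (1 - ε / 8)))) ≤
      Real.exp (-(ε ^ 2 / 128 * d)) := by
  have hn0 : (1 : ℝ) ≤ n := by exact_mod_cast hn
  have hb' : (2 : ℝ) * b ≤ d := by exact_mod_cast hb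
  have hd' : 16 ≤ ε * d := by rwa [div_le_iff₀ hε, mul_comm] at hd
  set x := ε / 8 with hx
  have hx0 : 0 < x := by positivity
  have hx1 : x ≤ 1 / 8 := by linarith
  have hz : (1 - x)⁻¹ ≤ Real.exp (x + 2 * x ^ 2) := by
    have h1 := Real.add_one_le_exp (x + 2 * x ^ 2)
    refine le_trans ?_ h1
    rw [inv_le_iff_one_le_mul₀ (by linarith)]
    nlinarith [mul_pos hx0 hx0]
  have hm : (1 + ε / 2) * (d / 2) - 1 ≤ (⌊(1 + ε / 2) * (d * n / 2)⌋₊ : ℝ) / n := by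
    rw [le_div_iff₀ (by linarith)]
    have h1 : (1 + ε / 2) * (d * n / 2) < ⌊(1 + ε / 2) * (d * n / 2)⌋₊ + 1 := Nat.lt_floor_add_one _
    linarith
  calc _ ≤ Real.exp (x + 2 * x ^ 2) ^ b * Real.exp (-(((1 + ε / 2) * (d / 2) - 1) * x)) := by
        have : 0 ≤ (1 - x)⁻¹ := inv_nonneg.mpr (by linarith)
        gcongr
        linarith
    _ = Real.exp (b * (x + 2 * x ^ 2) - ((1 + ε / 2) * (d / 2) - 1) * x) := by
        rw [← Real.exp_nat_mul, ← Real.exp_add]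
        ring_nf
    _ ≤ _ := by
        refine Real.exp_le_exp.mpr ?_
        have h1 : (b : ℝ) * (x + 2 * x ^ 2) ≤ d / 2 * (x + 2 * x ^ 2) := by
          gcongr
          linarith
        have h2 : (d : ℝ) / 2 * (x + 2 * x ^ 2) - ((1 + ε / 2) * (d / 2) - 1) * x =
            -(ε ^ 2 / 128 * d) - ε * (ε * d) / 128 + ε / 8 := by rw [hx]; ring
        nlinarith

theorem lacking_repair_le {n k : ℕ} (hn : 1 ≤ n) (hk : 1 ≤ k) :
    (Real.exp (-1))⁻¹ ^ (2 * k - 1) *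
      Real.exp (-(((16 * k * n : ℕ) : ℝ) / n * (1 - Real.exp (-1)))) ≤ Real.exp (-(8 * k)) := by
  have hn0 : (0 : ℝ) < n := by exact_mod_cast hn
  rw [← Real.exp_neg, neg_neg, ← Real.exp_nat_mul, ← Real.exp_add]
  refine Real.exp_le_exp.mpr ?_
  have h1 : Real.exp (-1) ≤ 3 / 8 := by
    rw [Real.exp_neg, inv_le_comm₀ (Real.exp_pos 1) (by norm_num)]
    linarith [Real.exp_one_gt_d9]
  have h2 : ((16 * k * n : ℕ) : ℝ) / n = 16 * k := by
    push_cast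
    field_simp
  rw [h2, Nat.cast_sub (by omega)]
  push_cast
  have hk0 : (0 : ℝ) ≤ k := by positivity
  nlinarith

/-- This is where `L = g ^ 3` suffices: `d * L` is at least `g ^ 15`, one power of `g` above the
exponent of the target density `δ = exp (-g ^ 14)`. -/
theorem lacking_first_phase_pow_le {c : ℝ} {d g : ℕ} (h3 : (d : ℝ) ^ 2 + 1 ≤ Real.exp (c * d / 2))
    (h4 : 16 ≤ c * g) (hc : 0 ≤ c) (hg : (g : ℝ) ^ 12 ≤ d) :
    (((d * d + 1 : ℕ) : ℝ) * Real.exp (-(c * d))) ^ (g ^ 3) ≤ Real.exp (-(g : ℝ) ^ 14) ^ 8 := by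
  calc (((d * d + 1 : ℕ) : ℝ) * Real.exp (-(c * d))) ^ (g ^ 3)
      ≤ (Real.exp (c * d / 2) * Real.exp (-(c * d))) ^ (g ^ 3) := by
        have : ((d * d + 1 : ℕ) : ℝ) ≤ Real.exp (c * d / 2) := by
          push_cast
          rw [← sq]
          exact h3
        gcongr
    _ = Real.exp (-(c * d * g ^ 3 / 2)) := by
        rw [← Real.exp_add, ← Real.exp_nat_mul]
        congr 1
        push_cast
        ring
    _ ≤ Real.exp (-(8 * g ^ 14)) := by
        refine Real.exp_le_exp.mpr ?_
        have : (16 : ℝ) * g ^ 14 ≤ c * d * g ^ 3 := by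
          calc (16 : ℝ) * g ^ 14 ≤ (c * g) * g ^ 14 := by gcongr
            _ = c * g ^ 12 * g ^ 3 := by ring
            _ ≤ _ := by gcongr
        linarith
    _ = Real.exp (-(g : ℝ) ^ 14) ^ 8 := by
        rw [← Real.exp_nat_mul]
        congr 1
        push_cast
        ring

theorem lacking_repair_pow_le {d g : ℕ} (h2 : (d : ℝ) * (2 * g ^ 8 + 1) ≤ Real.exp (g ^ 8))
    (hg : (2 : ℝ) ≤ g) :
    (((d * (2 * g ^ 8 + 1) : ℕ) : ℝ) * Real.exp (-(8 * g ^ 8))) ^ (g ^ 8) ≤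
      Real.exp (-(g : ℝ) ^ 14) ^ 8 := by
  calc (((d * (2 * g ^ 8 + 1) : ℕ) : ℝ) * Real.exp (-(8 * g ^ 8))) ^ (g ^ 8)
      ≤ (Real.exp (g ^ 8) * Real.exp (-(8 * g ^ 8))) ^ (g ^ 8) := by
        have : ((d * (2 * g ^ 8 + 1) : ℕ) : ℝ) ≤ Real.exp (g ^ 8) := by
          push_cast
          exact h2
        gcongr
    _ = Real.exp (-(7 * (g ^ 14 * g ^ 2))) := by
        rw [← Real.exp_add, ← Real.exp_nat_mul]
        congr 1
        push_cast
        ring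
    _ ≤ Real.exp (-(8 * g ^ 14)) := by
        refine Real.exp_le_exp.mpr ?_
        have h0 : (0 : ℝ) ≤ (g : ℝ) ^ 14 := by positivity
        have h4 : (4 : ℝ) ≤ g ^ 2 := by nlinarith
        have : (g : ℝ) ^ 14 * 4 ≤ g ^ 14 * g ^ 2 := mul_le_mul_of_nonneg_left h4 h0
        linarith
    _ = Real.exp (-(g : ℝ) ^ 14) ^ 8 := by
        rw [← Real.exp_nat_mul]
        congr 1
        push_cast
        ring

/-- Of the slack `ε * d * n / 2`, the first phase uses half, and the repairs and the sifting a
quarter each. -/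
theorem total_rounds_le {ε δ : ℝ} {d g n b : ℕ} (hε : 0 ≤ ε) (hn : 1 ≤ n)
    (hgd : (g : ℝ) ^ 12 ≤ d)
    (h7 : 32 * (d : ℝ) ^ 2 * (d ^ 2 + 1) * δ ^ (1 / (8 * d) : ℝ) ≤ ε * d / 8)
    (h8 : 256 ≤ ε * g) (hb : (b : ℝ) ≤ δ * n) :
    ⌊(1 + ε / 2) * ((d : ℝ) * n / 2)⌋₊ + (g ^ 3 * (2 * (16 * g ^ 8 * n)) +
      ⌊(32 * d ^ 2 * (d ^ 2 + 1) * n : ℝ) * ((b : ℝ) / n) ^ (1 / (8 * d) : ℝ)⌋₊) ≤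
      ⌊(1 + ε) * ((d : ℝ) * n / 2)⌋₊ := by
  have hn0 : (0 : ℝ) < n := by exact_mod_cast hn
  refine Nat.le_floor ?_
  push_cast
  have e1 : (⌊(1 + ε / 2) * ((d : ℝ) * n / 2)⌋₊ : ℝ) ≤ (1 + ε / 2) * ((d : ℝ) * n / 2) :=
    Nat.floor_le (by positivity)
  have e2 : (g : ℝ) ^ 3 * (2 * (16 * g ^ 8 * n)) ≤ ε * d / 8 * n := by
    calc (g : ℝ) ^ 3 * (2 * (16 * g ^ 8 * n)) = 256 * g ^ 11 / 8 * n := by ring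
      _ ≤ (ε * g) * g ^ 11 / 8 * n := by gcongr
      _ = ε * g ^ 12 / 8 * n := by ring
      _ ≤ _ := by gcongr
  have e3 : (⌊(32 * d ^ 2 * (d ^ 2 + 1) * n : ℝ) *
      ((b : ℝ) / n) ^ (1 / (8 * d) : ℝ)⌋₊ : ℝ) ≤ ε * d / 8 * n := by
    refine (Nat.floor_le (by positivity)).trans ?_
    calc (32 * d ^ 2 * (d ^ 2 + 1) * n : ℝ) * ((b : ℝ) / n) ^ (1 / (8 * d) : ℝ)
        ≤ (32 * d ^ 2 * (d ^ 2 + 1) * n : ℝ) * δ ^ (1 / (8 * d) : ℝ) := by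
          gcongr
          rwa [div_le_iff₀ hn0]
      _ = (32 * (d : ℝ) ^ 2 * (d ^ 2 + 1) * δ ^ (1 / (8 * d) : ℝ)) * n := by ring
      _ ≤ _ := by gcongr
  linarith

set_option maxHeartbeats 1000000 in
open scoped Classical in
/-- The failure probability is at most `1 / n` within `(1 + ε) d n / 2` rounds, provided that
`d` satisfies a list of largeness conditions. -/
theorem optFail_le_of_large {ε : ℝ} (hε : 0 < ε) (hε1 : ε ≤ 1) {d g : ℕ} (hg : g ^ 12 ≤ d)
    (hg2 : 2 ≤ g) (h1 : 16 / ε ≤ d) (h2 : (d : ℝ) * (2 * g ^ 8 + 1) ≤ Real.exp (g ^ 8))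
    (h3 : (d : ℝ) ^ 2 + 1 ≤ Real.exp (ε ^ 2 / 128 * d / 2)) (h4 : 16 ≤ ε ^ 2 / 128 * g)
    (h5 : ((d : ℝ) ^ 2 + 1) * (2 * d + 1) + 1 ≤ Real.exp (ε ^ 2 / 128 * d / 8))
    (h6 : ((d : ℝ) ^ 4 + 2 * d + 1) * (32 * (d ^ 2 + 1) * 16 ^ d) ^ 4 ≤ Real.exp (g ^ 14))
    (h7 : 32 * (d : ℝ) ^ 2 * (d ^ 2 + 1) *
      (((d : ℝ) ^ 4 + 2 * d + 1) * Real.exp (-g ^ 14)) ^ (1 / (8 * d) : ℝ) ≤ ε * d / 8)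
    (h8 : 256 ≤ ε * g) {n : ℕ} [NeZero n] (hn : d < n) (hlog : 6 * Real.log n ≤ Real.sqrt n)
    {H : SimpleGraph (Fin n)} (hd : ∀ v, H.degree v ≤ d) :
    optFail (fun G : SimpleGraph (Fin n) => H.IsContained G) ⌊(1 + ε) * (d * n / 2)⌋₊ ⊥ ≤ 1 / n := by
  set c := ε ^ 2 / 128 with hc
  have hc0 : 0 < c := by positivity
  have hc1 : c ≤ 1 := by rw [hc]; nlinarith
  have hg0 : (2 : ℝ) ≤ g := by exact_mod_cast hg2
  have hgd : (g : ℝ) ^ 12 ≤ d := by exact_mod_cast hg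
  have hg3d : g ^ 3 ≤ d := (Nat.pow_le_pow_right (by omega) (by norm_num)).trans hg
  have hg8d : g ^ 8 ≤ d := (Nat.pow_le_pow_right (by omega) (by norm_num)).trans hg
  have hk1 : 1 ≤ g ^ 8 := Nat.one_le_pow _ _ (by omega)
  have hd1 : 1 ≤ d := hk1.trans hg8d
  have hd1' : (1 : ℝ) ≤ d := by exact_mod_cast hd1
  have hg3d' : (g : ℝ) ^ 3 ≤ d := by exact_mod_cast hg3d
  have hg8d' : (g : ℝ) ^ 8 ≤ d := by exact_mod_cast hg8d
  have hn1 : 1 ≤ n := by omega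
  have hn0 : (0 : ℝ) < n := by exact_mod_cast hn1
  have hdn : (d : ℝ) + 1 ≤ n := by exact_mod_cast hn
  have hgd1 : (g : ℝ) ≤ d := le_trans (le_self_pow₀ (by linarith) (by norm_num)) hgd
  have hn4 : (256 : ℝ) ≤ n := by
    have : ε * g ≤ 1 * g := by gcongr
    linarith
  -- `δ₀` is the density of uncovered vertices after the first phase, small enough to leave room for
  -- candidates; `δ` controls the density left for sifting, small enough that `δ ^ (1 / (8 * d))`
  -- beats every power of `d` when `d` is about `g ^ 12`.
  set δ₀ := Real.exp (-(c * d / 8)) with hδ₀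
  set δ := Real.exp (-(g : ℝ) ^ 14) with hδ
  have hδpos : 0 < δ := Real.exp_pos _
  have hδ₀1 : δ₀ ≤ Real.exp (-1) := by
    refine Real.exp_le_exp.mpr ?_
    have : c * g ≤ c * d := by gcongr
    linarith
  have hδ1 : δ ≤ Real.exp (-1) := by
    refine Real.exp_le_exp.mpr ?_
    have : (1 : ℝ) ≤ g ^ 14 := one_le_pow₀ (by linarith)
    linarith
  obtain ⟨t₀, ht₀, hCt₀, ht₀n, -⟩ := exists_threshold (n := n) hlog hn1 (Real.exp_pos _) hδ₀1
    (ρ := Real.exp (-(c * d))) (Real.exp_pos _).le (by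
      rw [← Real.exp_nat_mul]
      refine Real.exp_le_exp.mpr (le_of_eq ?_)
      push_cast
      ring)
  obtain ⟨t, ht, hCt, htn, hts⟩ := exists_threshold (n := n) hlog hn1 hδpos hδ1
    (ρ := δ ^ 8) (by positivity) le_rfl
  set E : ℝ := 32 * (d ^ 2 + 1) * 16 ^ d with hE
  have hE1 : 1 ≤ E := by
    have h16 : (1 : ℝ) ≤ 16 ^ d := one_le_pow₀ (by norm_num)
    rw [hE]
    refine one_le_mul_of_one_le_of_one_le ?_ h16
    linarith [sq_nonneg (d : ℝ)]
  have hδinv : Real.exp ((g : ℝ) ^ 14) * δ = 1 := by rw [hδ, ← Real.exp_add]; simp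
  have hpoly1 : (1 : ℝ) ≤ (d : ℝ) ^ 4 + 2 * d + 1 := by
    have : (0 : ℝ) ≤ (d : ℝ) ^ 4 := by positivity
    linarith
  set δ₂ : ℝ := ((d : ℝ) ^ 4 + 2 * d + 1) * δ with hδ₂
  have hδ₂0 : 0 < δ₂ := by positivity
  have hδ₂E : δ₂ * E ^ 4 ≤ 1 := by
    calc δ₂ * E ^ 4 = ((d : ℝ) ^ 4 + 2 * d + 1) * E ^ 4 * δ := by rw [hδ₂]; ring
      _ ≤ Real.exp (g ^ 14) * δ := by gcongr
      _ = 1 := hδinv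
  have hδ₂1 : δ₂ ≤ 1 := le_trans (le_mul_of_one_le_right hδ₂0.le (one_le_pow₀ hE1)) hδ₂E
  set bmax : ℕ := (d * d * (d * d) + 1) * (t - 1) + g ^ 3 * (2 * (t - 1)) with hbmax
  have hbmaxn : (bmax : ℝ) ≤ δ₂ * n := by
    have hcast : (bmax : ℝ) = ((d : ℝ) ^ 4 + 2 * g ^ 3 + 1) * ((t - 1 : ℕ) : ℝ) := by
      rw [hbmax]
      push_cast
      ring
    calc (bmax : ℝ) = ((d : ℝ) ^ 4 + 2 * g ^ 3 + 1) * ((t - 1 : ℕ) : ℝ) := hcast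
      _ ≤ ((d : ℝ) ^ 4 + 2 * d + 1) * (δ * n) := by gcongr
      _ = _ := by rw [hδ₂]; ring
  have hlack₀ : ∀ A : Finset (Fin n), offerProb ⌊(1 + ε / 2) * ((d : ℝ) * n / 2)⌋₊
      (fun c => ∀ v ∈ A, c v < (d + 1) / 2) ≤ Real.exp (-(c * d)) ^ A.card := by
    intro A
    have h := offerProb_lacking_le ⌊(1 + ε / 2) * ((d : ℝ) * n / 2)⌋₊ A ((d + 1) / 2 - 1)
      (z := 1 - ε / 8) (by linarith) (by linarith)
    rw [Nat.sub_add_cancel (by omega), Fintype.card_fin] at h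
    refine h.trans ?_
    have hz : 0 ≤ (1 - ε / 8)⁻¹ := inv_nonneg.mpr (by linarith)
    gcongr
    exact lacking_first_phase_le hε hε1 hn1 h1 (by omega)
  have hlack₁ : ∀ A : Finset (Fin n), offerProb (16 * g ^ 8 * n)
      (fun c => ∀ v ∈ A, c v < 2 * g ^ 8) ≤ Real.exp (-(8 * g ^ 8)) ^ A.card := by
    intro A
    have h := offerProb_lacking_le (16 * g ^ 8 * n) A (2 * g ^ 8 - 1) (Real.exp_pos (-1))
      (Real.exp_le_one_iff.mpr (by norm_num))
    rw [Nat.sub_add_cancel (by omega), Fintype.card_fin] at h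
    refine h.trans ?_
    gcongr
    have := lacking_repair_le hn1 hk1
    push_cast at this ⊢
    exact this
  have hb₀ : (d * d + 1) * ((t₀ - 1) * (2 * g ^ 8 + 1)) + (t₀ - 1) ≤ Fintype.card (Fin n) := by
    rw [Fintype.card_fin]
    have : ((d : ℝ) * d + 1) * (((t₀ - 1 : ℕ) : ℝ) * (2 * g ^ 8 + 1)) + ((t₀ - 1 : ℕ) : ℝ) ≤ n := by
      calc _ = ((t₀ - 1 : ℕ) : ℝ) * (((d : ℝ) ^ 2 + 1) * (2 * g ^ 8 + 1) + 1) := by ring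
        _ ≤ (δ₀ * n) * (((d : ℝ) ^ 2 + 1) * (2 * d + 1) + 1) := by gcongr
        _ ≤ (δ₀ * n) * Real.exp (c * d / 8) := by gcongr
        _ = n := by
          rw [hδ₀, mul_right_comm, ← Real.exp_add]
          simp
    exact_mod_cast this
  have hρL : ((Fintype.card (Fin n)).choose t : ℝ) *
      ((((d * d + 1 : ℕ) : ℝ) * Real.exp (-(c * d))) ^ (g ^ 3)) ^ t ≤ 1 / (n : ℝ) ^ 3 := by
    rw [Fintype.card_fin]
    refine le_trans ?_ hCt
    gcongr
    exact lacking_first_phase_pow_le h3 h4 hc0.le hgd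
  have hρk : ((Fintype.card (Fin n)).choose t : ℝ) *
      ((((d * (2 * g ^ 8 + 1) : ℕ) : ℝ) * Real.exp (-(8 * g ^ 8))) ^ (g ^ 8)) ^ t ≤
      1 / (n : ℝ) ^ 3 := by
    rw [Fintype.card_fin]
    refine le_trans ?_ hCt
    gcongr
    exact lacking_repair_pow_le h2 hg0
  have hmain := optFail_isContained_le hd (m₀ := ⌊(1 + ε / 2) * ((d : ℝ) * n / 2)⌋₊)
    (m₁ := 16 * g ^ 8 * n) (k := g ^ 8) (L := g ^ 3) (N := d * (2 * g ^ 8 + 1))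
    (bmax := bmax) (ρ := 1 / (n : ℝ) ^ 3) (η := 1 / (n : ℝ) ^ 3)
    (R := fun b => ⌊(32 * d ^ 2 * (d ^ 2 + 1) * n : ℝ) * ((b : ℝ) / n) ^ (1 / (8 * d) : ℝ)⌋₊)
    (w := fun b => ⌊(n : ℝ) * ((b : ℝ) / n) ^ (1 / (8 * d) : ℝ)⌋₊)
    (Real.exp_pos _).le (Real.exp_pos _).le hlack₀ hlack₁ ht₀ ht hb₀ le_rfl
    ((by omega : 2 * g ^ 8 ≤ 1 * (2 * g ^ 8 + 1)).trans (Nat.mul_le_mul_right _ hd1)) le_rfl (by rw [Fintype.card_fin]; exact hCt₀) hρL hρk (by positivity)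
    (fun b b' h => Nat.floor_le_floor (by gcongr))
    (fun b b' _ _ h => sift_rounds_le hn1 hd1 h)
    (fun b s hb1 hbm hsb hbs => by
      rw [Fintype.card_fin]
      have hbm' : (b : ℝ) ≤ δ₂ * n := le_trans (by exact_mod_cast hbm) hbmaxn
      -- If the threshold is `t = 1`, then `bmax = 0` and there is no `b` to treat.
      have hδn : 1 ≤ δ ^ 2 * n := by
        rcases hts with h | h
        · exfalso
          have : bmax = 0 := by rw [hbmax, h]; simp
          omega
        · exact h
      have hE4 : E ^ 4 * δ ≤ 1 := by
        calc E ^ 4 * δ ≤ ((d : ℝ) ^ 4 + 2 * d + 1) * (E ^ 4 * δ) :=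
              le_mul_of_one_le_left (by positivity) hpoly1
          _ = δ₂ * E ^ 4 := by rw [hδ₂]; ring
          _ ≤ 1 := hδ₂E
      refine sift_fail_le hd1 hb1 hsb hbs hlog hE ?_ ?_
      · calc (b : ℝ) * E ^ 4 ≤ δ₂ * n * E ^ 4 := by gcongr
          _ = δ₂ * E ^ 4 * n := by ring
          _ ≤ 1 * n := by gcongr
          _ = n := one_mul _
      · calc E ^ 8 ≤ E ^ 8 * (δ ^ 2 * n) := le_mul_of_one_le_right (by positivity) hδn
          _ = (E ^ 4 * δ) ^ 2 * n := by ring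
          _ ≤ 1 * n := by
            gcongr
            exact pow_le_one₀ (by positivity) hE4
          _ = n := one_mul _)
  have htime : ⌊(1 + ε / 2) * ((d : ℝ) * n / 2)⌋₊ + (g ^ 3 * (2 * (16 * g ^ 8 * n)) +
      ⌊(32 * d ^ 2 * (d ^ 2 + 1) * n : ℝ) * ((bmax : ℝ) / n) ^ (1 / (8 * d) : ℝ)⌋₊) ≤
      ⌊(1 + ε) * ((d : ℝ) * n / 2)⌋₊ := by
    exact total_rounds_le hε.le hn1 hgd h7 h8 hbmaxn
  refine (optFail_anti_rounds _ ⊥ htime).trans (hmain.trans ?_)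
  have hbn : (bmax : ℝ) ≤ n := hbmaxn.trans (mul_le_of_le_one_left hn0.le hδ₂1)
  have hg3n : ((g ^ 3 : ℕ) : ℝ) ≤ n := by push_cast; linarith
  calc 2 * (1 / (n : ℝ) ^ 3) + ((g ^ 3 : ℕ) : ℝ) * (2 * (1 / (n : ℝ) ^ 3)) +
        bmax * (1 / (n : ℝ) ^ 3)
      ≤ 2 * (1 / (n : ℝ) ^ 3) + n * (2 * (1 / (n : ℝ) ^ 3)) + n * (1 / (n : ℝ) ^ 3) := by gcongr
    _ = (2 + 3 * n) / (n : ℝ) ^ 3 := by ring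
    _ ≤ _ := by
        rw [div_le_div_iff₀ (by positivity) hn0]
        calc (2 + 3 * (n : ℝ)) * n ≤ (256 * n) * n := by
              gcongr
              linarith
          _ ≤ (n * n) * n := by gcongr
          _ = 1 * n ^ 3 := by ring

end Parameters

/-! ### The largeness conditions hold for all large degrees -/

section Eventually

theorem eventually_const_mul_pow_le_exp (C : ℝ) (k : ℕ) {b : ℝ} (hb : 0 < b) :
    ∀ᶠ n : ℕ in atTop, C * (n : ℝ) ^ k ≤ Real.exp (b * n) := by
  have h := ((isLittleO_pow_exp_pos_mul_atTop k hb).const_mul_left C).bound one_pos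
  filter_upwards [tendsto_natCast_atTop_atTop.eventually h] with n hn
  rw [one_mul, Real.norm_eq_abs, Real.norm_of_nonneg (Real.exp_pos _).le] at hn
  exact (le_abs_self _).trans hn

/-- The integer part of the twelfth root. -/
def twelfthRoot (d : ℕ) : ℕ := Nat.findGreatest (fun x => x ^ 12 ≤ d) d

theorem twelfthRoot_pow_le (d : ℕ) : twelfthRoot d ^ 12 ≤ d :=
  Nat.findGreatest_spec (P := fun x => x ^ 12 ≤ d) (Nat.zero_le d) (by simp)

theorem le_twelfthRoot {x d : ℕ} (h : x ^ 12 ≤ d) : x ≤ twelfthRoot d :=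
  Nat.le_findGreatest ((Nat.le_self_pow (by norm_num) x).trans h) h

theorem tendsto_twelfthRoot : Tendsto twelfthRoot atTop atTop :=
  tendsto_atTop.mpr fun x => (eventually_ge_atTop (x ^ 12)).mono fun _ h => le_twelfthRoot h

theorem le_twelfthRoot_pow {d : ℕ} (h : 1 ≤ twelfthRoot d) : d ≤ 4096 * twelfthRoot d ^ 12 := by
  by_contra! hd
  have h2 : (2 * twelfthRoot d) ^ 12 ≤ d := by rw [mul_pow]; norm_num; omega
  have := le_twelfthRoot h2
  omega

/-- Since `d ≤ 4096 * g ^ 12`, the root is at most `exp (-g ^ 14 / (16 * d)) ≤ exp (-g ^ 2 /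
65536)`, where `65536 = 16 * 4096`. This beats every power of `d`. -/
theorem sift_parameter_bound {d g : ℕ} (hd1 : 1 ≤ d) (hdg : (d : ℝ) ≤ 4096 * g ^ 12)
    (hp : (d : ℝ) ^ 4 + 2 * d + 1 ≤ Real.exp d) (hg : (69632 : ℝ) ≤ g) {ε : ℝ} (hε : 0 < ε)
    (hexp : 512 / ε * 4096 ^ 3 * (g : ℝ) ^ 36 ≤ Real.exp (1 / 65536 * g)) :
    32 * (d : ℝ) ^ 2 * (d ^ 2 + 1) *
      (((d : ℝ) ^ 4 + 2 * d + 1) * Real.exp (-g ^ 14)) ^ (1 / (8 * d) : ℝ) ≤ ε * d / 8 := by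
  have hd0 : (1 : ℝ) ≤ d := by exact_mod_cast hd1
  have hg12 : (0 : ℝ) < g ^ 12 := by positivity
  have hgg : (g : ℝ) ≤ g ^ 2 := le_self_pow₀ (by linarith) (by norm_num)
  have h1 : ((d : ℝ) ^ 4 + 2 * d + 1) * Real.exp (-g ^ 14) ≤ Real.exp (-(g ^ 14 / 2)) := by
    calc _ ≤ Real.exp d * Real.exp (-g ^ 14) := by gcongr
      _ = Real.exp (d - g ^ 14) := by rw [← Real.exp_add]; rfl
      _ ≤ _ := by
        refine Real.exp_le_exp.mpr ?_
        have : (8192 : ℝ) * g ^ 12 ≤ g ^ 2 * g ^ 12 := by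
          gcongr
          linarith
        have h : (g : ℝ) ^ 14 = g ^ 2 * g ^ 12 := by ring
        linarith
  have h2 : (((d : ℝ) ^ 4 + 2 * d + 1) * Real.exp (-g ^ 14)) ^ (1 / (8 * d) : ℝ) ≤
      Real.exp (-(1 / 65536 * g)) := by
    calc _ ≤ Real.exp (-(g ^ 14 / 2)) ^ (1 / (8 * d) : ℝ) := by
          refine Real.rpow_le_rpow (by positivity) h1 (by positivity)
      _ = Real.exp (-(g ^ 14 / (16 * d))) := by
          rw [← Real.exp_mul]
          congr 1
          field_simp
          norm_num
      _ ≤ _ := by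
          refine Real.exp_le_exp.mpr (neg_le_neg ?_)
          rw [le_div_iff₀ (by positivity)]
          calc 1 / 65536 * (g : ℝ) * (16 * d) ≤ 1 / 65536 * g ^ 2 * (16 * (4096 * g ^ 12)) := by
                gcongr
            _ = g ^ 14 := by ring
  have h3 : 512 / ε * (d : ℝ) ^ 3 ≤ Real.exp (1 / 65536 * g) := by
    calc 512 / ε * (d : ℝ) ^ 3 ≤ 512 / ε * (4096 * g ^ 12) ^ 3 := by gcongr
      _ = 512 / ε * 4096 ^ 3 * (g : ℝ) ^ 36 := by ring
      _ ≤ _ := hexp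
  have h4 : (d : ℝ) ^ 3 * Real.exp (-(1 / 65536 * g)) ≤ ε / 512 := by
    rw [Real.exp_neg, ← div_eq_mul_inv, div_le_iff₀ (Real.exp_pos _)]
    calc (d : ℝ) ^ 3 = ε / 512 * (512 / ε * d ^ 3) := by field_simp
      _ ≤ _ := by gcongr
  have h5 : (d : ℝ) ^ 2 + 1 ≤ 2 * d ^ 2 := by
    have : (1 : ℝ) ≤ d ^ 2 := one_le_pow₀ hd0
    linarith
  calc _ ≤ 32 * (d : ℝ) ^ 2 * (2 * d ^ 2) * Real.exp (-(1 / 65536 * g)) := by gcongr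
    _ = 64 * d * (d ^ 3 * Real.exp (-(1 / 65536 * g))) := by ring
    _ ≤ 64 * d * (ε / 512) := by gcongr
    _ = _ := by ring

/-- As `16 ≤ exp 3`, the left side is at most `exp (d + 4 * (d + 3 * d)) = exp (17 * d)`, and `69632
= 17 * 4096`. -/
theorem threshold_parameter_bound {d g : ℕ} (hdg : (d : ℝ) ≤ 4096 * g ^ 12)
    (hp : (d : ℝ) ^ 4 + 2 * d + 1 ≤ Real.exp d) (hq : 32 * ((d : ℝ) ^ 2 + 1) ≤ Real.exp d)
    (hg : (69632 : ℝ) ≤ g) :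
    ((d : ℝ) ^ 4 + 2 * d + 1) * (32 * (d ^ 2 + 1) * 16 ^ d) ^ 4 ≤ Real.exp (g ^ 14) := by
  have h16 : (16 : ℝ) ^ d ≤ Real.exp (3 * d) := by
    have : (16 : ℝ) ≤ Real.exp 3 := by
      have h := Real.exp_one_gt_d9
      calc (16 : ℝ) ≤ 2.7 ^ 3 := by norm_num
        _ ≤ Real.exp 1 ^ 3 := by
          gcongr
          linarith
        _ = Real.exp 3 := by rw [← Real.exp_nat_mul]; norm_num
    calc (16 : ℝ) ^ d ≤ Real.exp 3 ^ d := by gcongr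
      _ = _ := by rw [← Real.exp_nat_mul, mul_comm]
  calc _ ≤ Real.exp d * (Real.exp d * Real.exp (3 * d)) ^ 4 := by gcongr
    _ = Real.exp (17 * d) := by
        rw [← Real.exp_add, ← Real.exp_nat_mul, ← Real.exp_add]
        congr 1
        push_cast
        ring
    _ ≤ _ := by
        refine Real.exp_le_exp.mpr ?_
        calc 17 * (d : ℝ) ≤ 17 * (4096 * g ^ 12) := by gcongr
          _ = 69632 * g ^ 12 := by ring
          _ ≤ g ^ 2 * g ^ 12 := by
            gcongr
            exact hg.trans (le_self_pow₀ (by linarith) (by norm_num))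
          _ = g ^ 14 := by ring

theorem eventually_log_le_sqrt : ∀ᶠ n : ℕ in atTop, 6 * Real.log n ≤ Real.sqrt n := by
  have h := ((isLittleO_log_rpow_atTop (r := 1 / 2) (by norm_num)).const_mul_left 6).bound one_pos
  filter_upwards [tendsto_natCast_atTop_atTop.eventually h] with n hn
  rw [one_mul, ← Real.sqrt_eq_rpow, Real.norm_eq_abs, Real.norm_of_nonneg (Real.sqrt_nonneg _)] at hn
  exact (le_abs_self _).trans hn

open scoped Classical in
/-- For large `d`, every graph on more than `d` vertices with maximum degree at most `d` can be
built within `(1 + ε) d n / 2` rounds with failure probability at most `1 / n`. -/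
theorem eventually_optFail_le {ε : ℝ} (hε : 0 < ε) (hε1 : ε ≤ 1) :
    ∀ᶠ d : ℕ in atTop, ∀ (n : ℕ) [NeZero n], d < n → ∀ H : SimpleGraph (Fin n),
      (∀ v, H.degree v ≤ d) →
      optFail (fun G : SimpleGraph (Fin n) => H.IsContained G) ⌊(1 + ε) * (d * n / 2)⌋₊ ⊥ ≤
        1 / n := by
  have hc : 0 < ε ^ 2 / 128 := by positivity
  have hG : ∀ᶠ g : ℕ in atTop, (12288 : ℝ) * (g : ℝ) ^ 20 ≤ Real.exp (1 * g) ∧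
      512 / ε * 4096 ^ 3 * (g : ℝ) ^ 36 ≤ Real.exp (1 / 65536 * g) ∧ (69632 : ℝ) ≤ g ∧
      16 / (ε ^ 2 / 128) ≤ g ∧ 256 / ε ≤ g :=
    (eventually_const_mul_pow_le_exp _ _ one_pos).and
      ((eventually_const_mul_pow_le_exp _ _ (by norm_num)).and
        ((tendsto_natCast_atTop_atTop.eventually_ge_atTop _).and
          ((tendsto_natCast_atTop_atTop.eventually_ge_atTop _).and
            (tendsto_natCast_atTop_atTop.eventually_ge_atTop _))))
  -- The condition on `n` follows from `d < n` once `d ≥ n₀`, so the result is uniform in `n`.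
  obtain ⟨n₀, hn₀⟩ := eventually_atTop.mp eventually_log_le_sqrt
  filter_upwards [tendsto_twelfthRoot.eventually hG, eventually_ge_atTop 1, eventually_ge_atTop n₀,
    tendsto_natCast_atTop_atTop.eventually_ge_atTop (16 / ε),
    eventually_const_mul_pow_le_exp 2 2 (half_pos hc),
    eventually_const_mul_pow_le_exp 7 3 (show 0 < ε ^ 2 / 128 / 8 by positivity),
    eventually_const_mul_pow_le_exp 4 4 one_pos, eventually_const_mul_pow_le_exp 64 2 one_pos]
    with d hg hd1 hdn h16 e2 e7 e4 e64 n _ hn H hH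
  obtain ⟨g20, g36, gbig, g16, g256⟩ := hg
  have hgd := twelfthRoot_pow_le d
  have hg1 : (1 : ℝ) ≤ twelfthRoot d := by linarith
  have hgN : 2 ≤ twelfthRoot d := by
    have : (2 : ℝ) ≤ twelfthRoot d := by linarith
    exact_mod_cast this
  have hdg' := le_twelfthRoot_pow (d := d) (by omega)
  set g := twelfthRoot d
  have hdg : (d : ℝ) ≤ 4096 * g ^ 12 := by exact_mod_cast hdg'
  have hd0 : (1 : ℝ) ≤ d := by exact_mod_cast hd1
  have p2 : (1 : ℝ) ≤ d ^ 2 := one_le_pow₀ hd0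
  have p3 : (1 : ℝ) ≤ d ^ 3 := one_le_pow₀ hd0
  have p4 : (d : ℝ) ≤ d ^ 4 := le_self_pow₀ hd0 (by norm_num)
  have p23 : (d : ℝ) ^ 2 ≤ d ^ 3 := pow_le_pow_right₀ hd0 (by norm_num)
  have p13 : (d : ℝ) ≤ d ^ 3 := le_self_pow₀ hd0 (by norm_num)
  rw [one_mul] at g20 e4 e64
  refine optFail_le_of_large hε hε1 hgd hgN h16 ?_ ?_ ?_ ?_ ?_ ?_ ?_ hn (hn₀ n (by omega)) hH
  · have h8 : (1 : ℝ) ≤ g ^ 8 := one_le_pow₀ hg1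
    calc (d : ℝ) * (2 * g ^ 8 + 1) ≤ (4096 * g ^ 12) * (2 * g ^ 8 + g ^ 8) := by gcongr
      _ = 12288 * (g : ℝ) ^ 20 := by ring
      _ ≤ Real.exp g := g20
      _ ≤ _ := Real.exp_le_exp.mpr (le_self_pow₀ hg1 (by norm_num))
  · rw [mul_div_right_comm]
    linarith
  · rwa [div_le_iff₀ hc, mul_comm] at g16
  · rw [mul_div_right_comm]
    refine le_trans ?_ e7
    have : ((d : ℝ) ^ 2 + 1) * (2 * d + 1) + 1 = 2 * d ^ 3 + d ^ 2 + 2 * d + 2 := by ring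
    linarith
  · exact threshold_parameter_bound hdg (by linarith) (by linarith) gbig
  · exact sift_parameter_bound hd1 hdg (by linarith) gbig hε g36
  · rwa [div_le_iff₀ hε, mul_comm] at g256

end Eventually

/-! ### Optimality: regular graphs and counting edges -/

section LowerBound

theorem ncard_edgeSet_graphAfter_le {V : Type*} [Finite V] (σ : BuilderStrategy V) (v : ℕ → V)
    (t : ℕ) : (σ.graphAfter v t).edgeSet.ncard ≤ t := by
  induction t with
  | zero => simp [BuilderStrategy.graphAfter]
  | succ t ih =>
    simp only [BuilderStrategy.graphAfter]
    split
    · omega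
    · rw [SimpleGraph.edgeSet_sup]
      refine (Set.ncard_union_le _ _).trans (Nat.add_le_add ih ?_)
      exact (Set.ncard_le_ncard SimpleGraph.edgeSet_edge_subset).trans (by simp)

theorem SimpleGraph.IsRegularOfDegree.mul_card_le_of_isContained {V : Type*} [Fintype V]
    {H G : SimpleGraph V} [DecidableRel H.Adj] {d t : ℕ} (hH : H.IsRegularOfDegree d)
    (h : H.IsContained G) (hG : G.edgeSet.ncard ≤ t) : d * Fintype.card V ≤ 2 * t := by
  classical
  obtain ⟨f⟩ := h
  have h1 : H.edgeSet.ncard ≤ G.edgeSet.ncard := by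
    rw [← Nat.card_coe_set_eq, ← Nat.card_coe_set_eq]
    exact Nat.card_le_card_of_injective _ f.mapEdgeSet.injective
  have h2 := H.sum_degrees_eq_twice_card_edges
  rw [Finset.sum_congr rfl fun v _ => hH v, Finset.sum_const, Finset.card_univ, smul_eq_mul] at h2
  have h3 : H.edgeFinset.card = H.edgeSet.ncard := by
    rw [← SimpleGraph.coe_edgeFinset, Set.ncard_coe_finset]
  rw [mul_comm]
  omega

/-- Connection set of a `d`-regular circulant graph. For odd `d` the order `n` is even, and the
interval is centred at the self-inverse element `n / 2`. -/
theorem exists_symmetric_finset {n d : ℕ} (hd : d < n) (h : Even (d * n)) :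
    ∃ T : Finset ℕ, T.card = d ∧ ∀ x ∈ T, 0 < x ∧ x < n ∧ n - x ∈ T := by
  rcases Nat.even_or_odd' d with ⟨k, rfl | rfl⟩
  · refine ⟨Finset.Icc 1 k ∪ Finset.Ico (n - k) n, ?_, fun x hx => ?_⟩
    · rw [Finset.card_union_of_disjoint, Nat.card_Icc, Nat.card_Ico]
      · omega
      · refine Finset.disjoint_left.mpr fun x hx hx' => ?_
        rw [Finset.mem_Icc] at hx
        rw [Finset.mem_Ico] at hx'
        omega
    · simp only [Finset.mem_union, Finset.mem_Icc, Finset.mem_Ico] at hx ⊢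
      omega
  · have hn : Even n := by
      rcases Nat.even_mul.mp h with h | h
      · exact absurd h (by simp)
      · exact h
    obtain ⟨m, rfl⟩ := hn
    refine ⟨Finset.Icc (m - k) (m + k), ?_, fun x hx => ?_⟩
    · rw [Nat.card_Icc]
      omega
    · simp only [Finset.mem_Icc] at hx ⊢
      omega

theorem exists_isRegularOfDegree {n d : ℕ} [NeZero n] (hd : d < n) (h : Even (d * n)) :
    ∃ (H : SimpleGraph (Fin n)) (_ : DecidableRel H.Adj), H.IsRegularOfDegree d := by
  obtain ⟨T, hT, hsymm⟩ := exists_symmetric_finset hd h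
  let S : Finset (Fin n) := {x | x.val ∈ T}
  have hS : S.card = d := by
    rw [← hT]
    refine Finset.card_bij (fun x _ => x.val) (fun x hx => by simpa [S] using hx)
      (fun x _ y _ hxy => Fin.ext hxy) fun x hx => ⟨⟨x, (hsymm x hx).2.1⟩, by simpa [S] using hx, rfl⟩
  have h0 : (0 : Fin n) ∉ S := fun h => by
    have := (hsymm _ (Finset.mem_filter.mp h).2).1
    simp at this
  have hneg : ∀ x ∈ S, -x ∈ S := fun x hx => by
    have hx0 : x ≠ 0 := fun h => h0 (h ▸ hx)
    refine Finset.mem_filter.mpr ⟨Finset.mem_univ _, ?_⟩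
    rw [Fin.val_neg, if_neg hx0]
    exact (hsymm _ (Finset.mem_filter.mp hx).2).2.2
  refine ⟨SimpleGraph.circulantGraph (S : Set (Fin n)), inferInstance, fun v => ?_⟩
  rw [← hS, ← SimpleGraph.card_neighborFinset_eq_degree]
  refine Finset.card_bij (fun w _ => w - v) (fun w hw => ?_) (fun w _ w' _ hw => sub_left_injective hw)
    fun x hx => ⟨x + v, ?_, add_sub_cancel_right x v⟩
  · rw [SimpleGraph.mem_neighborFinset, SimpleGraph.circulantGraph_adj] at hw
    rcases hw.2 with h | h
    · rw [← neg_sub]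
      exact hneg _ h
    · exact h
  · rw [SimpleGraph.mem_neighborFinset, SimpleGraph.circulantGraph_adj]
    refine ⟨fun h => h0 ?_, Or.inr ?_⟩
    · have : x = 0 := by simpa using h.symm
      exact this ▸ hx
    · rw [add_sub_cancel_right]
      exact hx

theorem exists_graph_mul_le {n : ℕ+} {d : ℕ} (hd : d < n) (h : Even (d * n)) :
    ∃ (H : SimpleGraph (Fin n)) (_ : DecidableRel H.Adj), H.maxDegree = d ∧
      ∀ (σ : BuilderStrategy (Fin n)) (v : ℕ → Fin n) (t : ℕ),
        H.IsContained (σ.graphAfter v t) → d * (n : ℕ) ≤ 2 * t := by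
  obtain ⟨H, hdec, hH⟩ := exists_isRegularOfDegree hd h
  refine ⟨H, hdec, hH.maxDegree_eq, fun σ v t hc => ?_⟩
  simpa using hH.mul_card_le_of_isContained hc (ncard_edgeSet_graphAfter_le σ v t)

end LowerBound

/-! ### One error function for all degrees, and the Poisson version -/

section UpperBound

/-- A sequence of thresholds can be inverted to a sequence that tends to zero. -/
theorem exists_tendsto_zero_of_eventually {p : ℝ≥0 → ℕ → Prop}
    (h : ∀ k : ℕ, ∀ᶠ d in atTop, p (1 / (k + 1)) d) :
    ∃ (g : ℕ → ℝ≥0) (D : ℕ), Tendsto g atTop (𝓝 0) ∧ ∀ d, D ≤ d → p (g d) d := by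
  choose D hD using fun k => eventually_atTop.mp (h k)
  let κ : ℕ → ℕ := fun d => Nat.findGreatest (fun k => D k ≤ d) d
  have hκ : Tendsto κ atTop atTop := tendsto_atTop.mpr fun k => by
    filter_upwards [eventually_ge_atTop k, eventually_ge_atTop (D k)] with d h1 h2
    exact Nat.le_findGreatest h1 h2
  refine ⟨fun d => 1 / (κ d + 1), D 0, ?_, fun d hd => hD _ _ ?_⟩
  · have h0 : Tendsto (fun k : ℕ => (1 : ℝ≥0) / (k + 1)) atTop (𝓝 0) := NNReal.tendsto_coe.mp (by
      simpa using tendsto_one_div_add_atTop_nhds_zero_nat (𝕜 := ℝ))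
    exact h0.comp hκ
  · exact Nat.findGreatest_spec (P := fun k => D k ≤ d) (Nat.zero_le d) hd

open scoped Classical in
theorem exists_rate : ∃ (g : ℕ → ℝ≥0) (N : ℕ) (C : ℝ≥0), Tendsto g atTop (𝓝 0) ∧
    (∀ d, g d ≤ C) ∧
    ∀ (n : ℕ) [NeZero n] (H : SimpleGraph (Fin n)) (d : ℕ), N ≤ n → d < n →
      (∀ v, H.degree v ≤ d) →
      optFail (fun G : SimpleGraph (Fin n) => H.IsContained G)
        ⌊(1 + (g d : ℝ)) * (d * n / 2)⌋₊ ⊥ ≤ 1 / n := by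
  obtain ⟨g, D, hg, hD⟩ := exists_tendsto_zero_of_eventually
    (p := fun ε d => ε ≤ 1 ∧ ∀ (n : ℕ) [NeZero n], d < n → ∀ H : SimpleGraph (Fin n),
      (∀ v, H.degree v ≤ d) →
      optFail (fun G : SimpleGraph (Fin n) => H.IsContained G)
        ⌊(1 + (ε : ℝ)) * (d * n / 2)⌋₊ ⊥ ≤ 1 / n) fun k => by
    have hk : (1 : ℝ≥0) / (k + 1) ≤ 1 := div_le_one_of_le₀ (by simp) (by positivity)
    filter_upwards [eventually_optFail_le (ε := ((1 / (k + 1) : ℝ≥0) : ℝ)) (by positivity)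
      (by exact_mod_cast hk)] with d hd
    exact ⟨hk, hd⟩
  -- For `1 ≤ d < D` a graph of maximum degree at most `d` is built as one of degree at most `D`:
  -- the allowance `(1 + 2 * D) * d` exceeds `(1 + g D) * D`. Being bounded by `C`, the rate gives
  -- Poisson tails uniform in `d`.
  refine ⟨fun d => if d < D then 2 * D else g d, D + 1, 2 * D + 1, ?_, fun d => ?_, ?_⟩
  · refine hg.congr' ?_
    filter_upwards [eventually_ge_atTop D] with d hd
    rw [if_neg (not_lt.mpr hd)]
  · beta_reduce
    split_ifs with h
    · simp
    · exact (hD d (not_lt.mp h)).1.trans (by simp)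
  · intro n _ H d hn hdn hH
    beta_reduce
    rcases lt_or_ge d D with h | h
    · rcases Nat.eq_zero_or_pos d with rfl | hd
      · have hbot : H = ⊥ := SimpleGraph.edgeSet_eq_empty.mp (by
          rw [Set.eq_empty_iff_forall_notMem]
          intro e he
          induction e with
          | _ u v =>
            have h1 : 0 < H.degree u := (H.degree_pos_iff_exists_adj u).mpr ⟨v, he⟩
            have := hH u
            omega)
        subst hbot
        rw [optFail_eq_zero (SimpleGraph.IsContained.refl _)]
        positivity
      · refine le_trans ?_ ((hD D le_rfl).2 n (by omega) H fun v => (hH v).trans h.le)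
        refine optFail_anti_rounds _ ⊥ (Nat.floor_le_floor ?_)
        have h1 : (g D : ℝ) ≤ 1 := (hD D le_rfl).1
        have h2 : (1 : ℝ) ≤ d := by exact_mod_cast hd
        rw [if_pos h]
        push_cast
        calc (1 + (g D : ℝ)) * (D * n / 2) ≤ (1 + 1) * (D * n / 2) := by gcongr
          _ = (2 * D * 1) * (n / 2) := by ring
          _ ≤ (2 * D * d + d) * (n / 2) := by
            have : (2 * D : ℝ) * 1 ≤ 2 * D * d := by gcongr
            gcongr
            linarith
          _ = _ := by ring
    · rw [if_neg (not_lt.mpr h)]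
      exact (hD d h).2 n hdn H hH

/-- The gap `s * d * n / 2` with `s = d ^ (-1/2)` is of order `√n` standard deviations for bounded
`g`, so the tail is exponentially small in `n` whatever `d` is. The value `x = s / (4 * (1 + g))`
minimises the Chernoff exponent. -/
theorem poissonMeasure_Iio_le_of_gap {d n m : ℕ} {g C s : ℝ} {μ : ℝ≥0} (hg : 0 ≤ g) (hgC : g ≤ C)
    (hs : 0 < s) (hs1 : s ≤ 1) (hds : d * s ^ 2 = 1) (hm : (m : ℝ) ≤ (1 + g) * (d * n / 2))
    (hμ : (μ : ℝ) = (1 + (g + s)) * (d * n / 2)) :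
    poissonMeasure μ (Set.Iio m) ≤ ENNReal.ofReal (Real.exp (-(n / (16 * (1 + C))))) := by
  set x := s / (4 * (1 + g)) with hx
  have hx0 : 0 < x := by positivity
  have hx1 : x ≤ 1 / 4 := by
    rw [hx, div_le_iff₀ (by positivity)]
    linarith
  have hz : (1 - x)⁻¹ ≤ Real.exp (x + 2 * x ^ 2) := by
    refine le_trans ?_ (Real.add_one_le_exp (x + 2 * x ^ 2))
    rw [inv_le_iff_one_le_mul₀ (by linarith)]
    nlinarith [mul_pos hx0 hx0]
  refine (poissonMeasure_Iio_le μ m (z := 1 - x) (by linarith) (by linarith)).trans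
    (ENNReal.ofReal_le_ofReal ?_)
  have hinv : 0 ≤ (1 - x)⁻¹ := inv_nonneg.mpr (by linarith)
  calc _ ≤ Real.exp (x + 2 * x ^ 2) ^ m * Real.exp (-(μ * (1 - (1 - x)))) := by gcongr
    _ = Real.exp (m * (x + 2 * x ^ 2) - μ * x) := by
        rw [← Real.exp_nat_mul, ← Real.exp_add]
        ring_nf
    _ ≤ _ := by
        refine Real.exp_le_exp.mpr ?_
        have h1 : (m : ℝ) * (x + 2 * x ^ 2) ≤ (1 + g) * (d * n / 2) * (x + 2 * x ^ 2) := by gcongr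
        have h2 : (1 + g) * (d * n / 2) * (x + 2 * x ^ 2) - μ * x =
            -(n / (16 * (1 + g)) * (d * s ^ 2)) := by
          rw [hμ, hx]
          field_simp
          ring
        have h3 : n / (16 * (1 + C)) ≤ n / (16 * (1 + g)) := by gcongr
        rw [hds] at h2
        linarith

theorem tendsto_one_of_ofReal_le {u : ℕ+ → ℝ≥0∞} {a : ℕ → ℝ} (ha : Tendsto a atTop (𝓝 1))
    (h : ∀ᶠ n : ℕ+ in atTop, ENNReal.ofReal (a n) ≤ u n) (h1 : ∀ n, u n ≤ 1) :
    Tendsto u atTop (𝓝 1) := by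
  have hval : Tendsto (fun n : ℕ+ => (n : ℕ)) atTop atTop := tendsto_PNat_val_atTop_atTop
  have hlim : Tendsto (fun n : ℕ+ => ENNReal.ofReal (a n)) atTop (𝓝 1) := by
    have := (ENNReal.tendsto_ofReal ha).comp hval
    rwa [ENNReal.ofReal_one] at this
  exact tendsto_of_tendsto_of_tendsto_of_le_of_le' hlim tendsto_const_nhds h
    (Eventually.of_forall h1)

theorem le_poissonSuccessProb {n : ℕ} [NeZero n] {H : SimpleGraph (Fin n)}
    {σ : BuilderStrategy (Fin n)} {m : ℕ} {μ : ℝ≥0} {δ η : ℝ} (hδ0 : 0 ≤ δ) (hδ : δ ≤ 1)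
    (h : ENNReal.ofReal (1 - η) ≤ successProb H σ m)
    (hμ : poissonMeasure μ (Set.Iio m) ≤ ENNReal.ofReal δ) :
    ENNReal.ofReal ((1 - δ) * (1 - η)) ≤ poissonSuccessProb H σ μ := by
  refine le_trans ?_ (poissonSuccessProb_ge μ h)
  rw [ENNReal.ofReal_mul (by linarith)]
  gcongr
  have hc : Set.Ici m = (Set.Iio m)ᶜ := Set.compl_Iio.symm
  rw [hc, prob_compl_eq_one_sub measurableSet_Iio, ENNReal.ofReal_sub _ hδ0, ENNReal.ofReal_one]
  gcongr

/-- The strategy plays optimally for the smaller number of rounds given by `g` alone. Both the fixed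
and, with high probability, the Poisson number of rounds exceed it, so one strategy serves both. -/
theorem exists_error_function : ∃ f : ℕ → ℝ≥0, Tendsto f atTop (𝓝 0) ∧
    ∀ (H : (n : ℕ+) → SimpleGraph (Fin n)) [∀ n, DecidableRel (H n).Adj],
      ∃ σ : (n : ℕ+) → BuilderStrategy (Fin n),
        Tendsto (fun n : ℕ+ => successProb (H n) (σ n)
          ⌊(1 + f (H n).maxDegree) * ((H n).maxDegree * (n : ℕ) / 2)⌋₊) atTop (𝓝 1) ∧
        Tendsto (fun n : ℕ+ => poissonSuccessProb (H n) (σ n)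
          ((1 + f (H n).maxDegree) * ((H n).maxDegree * (n : ℕ) / 2))) atTop (𝓝 1) := by
  obtain ⟨g, N, C, hg, hgC, hfail⟩ := exists_rate
  refine ⟨fun d => g d + (NNReal.sqrt d)⁻¹, ?_, fun H _ => ?_⟩
  · have h1 : Tendsto (fun d : ℕ => (NNReal.sqrt d)⁻¹) atTop (𝓝 0) := by
      refine NNReal.tendsto_coe.mp ?_
      have := tendsto_inv_atTop_zero.comp
        (Real.tendsto_sqrt_atTop.comp (tendsto_natCast_atTop_atTop (R := ℝ)))
      refine this.congr fun d => ?_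
      simp
    simpa using hg.add h1
  have hmono : ∀ n : ℕ+, Monotone fun G : SimpleGraph (Fin n) => (H n).IsContained G :=
    fun n G G' h hG => SimpleGraph.IsContained.trans hG (SimpleGraph.IsContained.of_le h)
  let m : ℕ+ → ℕ := fun n => ⌊(1 + (g (H n).maxDegree : ℝ)) * ((H n).maxDegree * (n : ℕ) / 2)⌋₊
  choose σ hσ using fun n : ℕ+ => exists_strategy (hmono n) (m n)
  have hN : ∀ᶠ n : ℕ+ in atTop, N ≤ (n : ℕ) := tendsto_PNat_val_atTop_atTop.eventually_ge_atTop N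
  have hfail' : ∀ n : ℕ+, N ≤ (n : ℕ) → ∀ t, m n ≤ t →
      ENNReal.ofReal (1 - 1 / (n : ℕ)) ≤ successProb (H n) (σ n) t := by
    intro n hn t ht
    refine le_trans (ENNReal.ofReal_le_ofReal ?_) (hσ n t ht)
    have := hfail n (H n) (H n).maxDegree hn
      (by simpa using (H n).maxDegree_lt_card_verts) fun v => by
        convert (H n).degree_le_maxDegree v
    simp only [m]
    linarith
  have hinv : Tendsto (fun n : ℕ => (1 : ℝ) - 1 / n) atTop (𝓝 1) := by
    simpa using (tendsto_one_div_atTop_nhds_zero_nat (𝕜 := ℝ)).const_sub 1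
  have hexp : Tendsto (fun n : ℕ => (1 - Real.exp (-(n / (16 * (1 + (C : ℝ)))))) * (1 - 1 / n))
      atTop (𝓝 1) := by
    have h1 : Tendsto (fun n : ℕ => Real.exp (-(n / (16 * (1 + (C : ℝ)))))) atTop (𝓝 0) :=
      Real.tendsto_exp_neg_atTop_nhds_zero.comp
        (tendsto_natCast_atTop_atTop.atTop_div_const (by positivity))
    simpa using (h1.const_sub 1).mul hinv
  refine ⟨σ, tendsto_one_of_ofReal_le hinv ?_ fun n => ?_,
    tendsto_one_of_ofReal_le hexp ?_ fun n => ?_⟩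
  · filter_upwards [hN] with n hn
    refine hfail' n hn _ (Nat.le_floor ?_)
    rw [← NNReal.coe_le_coe]
    push_cast
    refine (Nat.floor_le (by positivity)).trans ?_
    gcongr
    simp
  · have : IsProbabilityMeasure (offerLaw n) := by unfold offerLaw; infer_instance
    exact prob_le_one
  · filter_upwards [hN] with n hn
    refine le_poissonSuccessProb (Real.exp_pos _).le (Real.exp_le_one_iff.mpr ?_)
      (hfail' n hn _ le_rfl) ?_
    · have : (0 : ℝ) ≤ (n : ℕ) / (16 * (1 + (C : ℝ))) := by positivity
      linarith
    · rcases Nat.eq_zero_or_pos (H n).maxDegree with h0 | hpos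
      · have : m n = 0 := by simp [m, h0]
        simp [this]
      · have hd : (1 : ℝ) ≤ (H n).maxDegree := by exact_mod_cast hpos
        refine poissonMeasure_Iio_le_of_gap (d := (H n).maxDegree) (g := g (H n).maxDegree)
          (s := (Real.sqrt (H n).maxDegree)⁻¹) (NNReal.coe_nonneg _) (by exact_mod_cast hgC _)
          (by positivity) (inv_le_one_of_one_le₀ (Real.one_le_sqrt.mpr hd)) ?_
          (Nat.floor_le (by positivity)) ?_
        · rw [inv_pow, Real.sq_sqrt (by linarith)]
          exact mul_inv_cancel₀ (by linarith)
        · push_cast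
          simp
  · have : IsProbabilityMeasure (offerLaw n) := by unfold offerLaw; infer_instance
    exact prob_le_one

end UpperBound

theorem theorem1p2 :
    -- upper bound: one error function `f`, depending on the maximum degree only
    (∃ f : ℕ → ℝ≥0, Tendsto f atTop (𝓝 0) ∧
      ∀ (H : (n : ℕ+) → SimpleGraph (Fin n)) [∀ n, DecidableRel (H n).Adj],
        ∃ σ : (n : ℕ+) → BuilderStrategy (Fin n),
          Tendsto (fun n : ℕ+ => successProb (H n) (σ n)
            ⌊(1 + f (H n).maxDegree) * ((H n).maxDegree * (n : ℕ) / 2)⌋₊) atTop (𝓝 1) ∧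
          Tendsto (fun n : ℕ+ => poissonSuccessProb (H n) (σ n)
            ((1 + f (H n).maxDegree) * ((H n).maxDegree * (n : ℕ) / 2))) atTop (𝓝 1)) ∧
    -- optimality: some graphs of maximum degree `Δ` can never be built in under `Δ n / 2` rounds
    (∀ (n : ℕ+) (Δ : ℕ), Δ < n → Even (Δ * n) →
      ∃ (H : SimpleGraph (Fin n)) (_ : DecidableRel H.Adj), H.maxDegree = Δ ∧
        ∀ (σ : BuilderStrategy (Fin n)) (v : ℕ → Fin n) (t : ℕ),
          H.IsContained (σ.graphAfter v t) → Δ * (n : ℕ) ≤ 2 * t) := by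
  exact ⟨exists_error_function, fun n Δ hΔ h => exists_graph_mul_le hΔ h⟩
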